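/- **Setting.** A signature has finitely many fluents $F$ (relations with $a_F$ object arguments and one situation argument), finitely many action types $A(\vec x)$ with object parameters, and a countably infinite set of object constants; there are no other functions and no non-fluent predicates. A formula is *uniform* if all its fluents refer to one and the same situation $s$ and it mentions neither $\mathit{Poss}$, nor the order or equality of situations, nor quantification over situations (quantification over objects and over actions, equality of objects and of actions, and action terms are allowed). A *basic action theory* $\mathcal D$ consists of: a finite set $\mathcal D_0$ of first-order sentences uniform in $S_0$ (incomplete information on the initial situation); one precondition axiom $\mathit{Poss}(A(\vec x),s)\equiv\phi_A(\vec x,s)$ per action type and one successor state axiom $F(\vec x,do(a,s))\equiv\phi_F(\vec x,a,s)$ per fluent, with $\phi_A,\phi_F$ first-order and uniform in $s$; unique name axioms for actions and domain closure on action types; unique name axioms for all object constants; and the (second-order) foundational axioms of the situation calculus. Let $C$ be the finite set of constants that occur in $\mathcal D_0$, the precondition axioms or the successor state axioms. A situation is *executable* if every action performed in reaching it was possible where it was performed. $\mathcal D$ is *bounded by* $b\in\mathbb N$ if in every model of $\mathcal D$ and every executable situation each fluent has fewer than $b$ distinct tuples in its extension. The *active domain* $adom(s)$ of a situation $s$ of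 a model consists of the objects that occur in the extension of some fluent at $s$ or are denoted by a constant in $C$; the *active-domain interpretation* at $s$ is the interpretation of the fluents at $s$ and of the constants in $C$, restricted to $adom(s)$. **The logic $\mu\mathcal L_p$.** Its formulas are $$\Phi::=\varphi\mid\neg\Phi\mid\Phi_1\wedge\Phi_2\mid\exists x.\,\mathrm{live}(x)\wedge\Phi\mid \mathrm{live}(\vec x)\wedge\langle-\rangle\Phi\mid\mathrm{live}(\vec x)\wedge[-]\Phi\mid Z\mid\mu Z.\Phi,$$ where $\varphi$ is a possibly open uniform first-order formula with the situation suppressed whose free variables are object variables and whose constants are in $C$; $Z$ is a $0$-ary predicate variable; in $\mu Z.\Phi$ every occurrence of $Z$ in $\Phi$ is under an even number of negations; and in $\mathrm{live}(\vec x)\wedge\langle-\rangle\Phi$ and $\mathrm{live}(\vec x)\wedge[-]\Phi$ the variables $\vec x$ are exactly the free individual variables of $\Phi$ after each bound predicate variable has been replaced (without capture) by the fixpoint formula that binds it. A formula denotes a set of situations: $\varphi$ and the Boolean connectives have their usual meaning, $\mathrm{live}(d)$ holds at $s$ iff $d\in adom(s)$, $\langle-\rangle\Phi$ (resp. $[-]\Phi$)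 holds at $s$ iff $\Phi$ holds at $do(a,s)$ for some (resp. every) action $a$ with $\mathit{Poss}(a,s)$, and $\mu Z.\Phi$ is the least fixpoint, namely the intersection of all sets $E$ of situations such that the denotation of $\Phi$ with $Z:=E$ is contained in $E$. $\mathcal D\models\Phi$, for closed $\Phi$, means that $\Phi$ holds at $S_0$ in every model of $\mathcal D$. **Theorem.** 1. (Decidability.) There is an algorithm that, given a basic action theory $\mathcal D$, a number $b$ such that $\mathcal D$ is bounded by $b$, and a closed $\mu\mathcal L_p$ formula $\Phi$ over $\mathcal D$, halts and correctly decides whether $\mathcal D\models\Phi$. 2. (Complete information.) For a finite database $I$ (finite extensions for the fluents and denotations for the constants in $C$, over an infinite object domain) let $\mathcal D^I$ be $\mathcal D$ with $\mathcal D_0$ replaced by $I$: its models are the structures that satisfy all axioms of $\mathcal D$ other than $\mathcal D_0$ and whose active-domain interpretation at $S_0$ is isomorphic to that of $I$ (active domain taken with respect to the $C$ of $\mathcal D$). There is an algorithm that, given $\mathcal D$, $b$, $I$ such that $\mathcal D^I$ is bounded by $b$, and a closed $\mu\mathcal L_p$ formula $\Phi$ over $\mathcal D$, halts and correctly decides whether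 $\mathcal D^I\models\Phi$. 3. (Classes.) There is an algorithm that, given $\mathcal D$ and $b$ such that $\mathcal D$ is bounded by $b$, halts with a finite list $I_1,\dots,I_n$ of databases such that the active-domain interpretation at $S_0$ of every model of $\mathcal D$ is isomorphic to that of some $I_i$; and, for each $i$, the class of models of $\mathcal D$ whose active-domain interpretation at $S_0$ is isomorphic to that of $I_i$ is non-empty and is exactly the class of models of $\mathcal D^{I_i}$, and $\mathcal D^{I_i}$ is bounded by $b$, so that the algorithm of 2 applies to it. Moreover, if $\mathcal D$ is bounded by some $b$, any two models of $\mathcal D$ with isomorphic active-domain interpretations at $S_0$ satisfy the same closed $\mu\mathcal L_p$ formulas over $\mathcal D$. -/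

import Mathlib

universe u v

namespace SitCalc

/-! ### Syntax -/

/-- A situation calculus signature with finitely many fluents and finitely many action types, given
by the list of the arities of the fluents (not counting the situation argument) and the list of the
numbers of parameters of the action types.  All parameters are of sort object.  The object constants
are indexed by `ℕ`. -/
structure Signature where
  fluents : List ℕ
  actions : List ℕ

namespace Signature

/-- The fluent symbols. -/
abbrev Fl (σ : Signature) : Type := Fin σ.fluents.length

/-- The action types. -/
abbrev Ac (σ : Signature) : Type := Fin σ.actions.length

/-- The arity of a fluent, without its situation argument. -/
abbrev arF (σ : Signature) (F : σ.Fl) : ℕ := σ.fluents.get F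

/-- The number of parameters of an action type. -/
abbrev arA (σ : Signature) (A : σ.Ac) : ℕ := σ.actions.get A

end Signature

/-- Object terms over `n` object variables: variables and constants. -/
inductive OTerm (n : ℕ) : Type
  | var (i : Fin n) : OTerm n
  | const (c : ℕ) : OTerm n

/-- Action terms over `n` object variables and `m` action variables. -/
inductive ATerm (σ : Signature) (n m : ℕ) : Type
  | var (i : Fin m) : ATerm σ n m
  | app (A : σ.Ac) (args : Fin (σ.arA A) → OTerm n) : ATerm σ n m

/-- Situation-suppressed first-order formulas that are uniform in a situation, with `n` object
variables and `m` action variables in scope.  Variables are de Bruijn indices: under a quantifier,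
index `0` is the quantified variable and the older variables are shifted by one.  A uniform formula
mentions no situation but the suppressed one, does not quantify over situations, and mentions
neither `Poss` nor the order of situations. -/
inductive FOForm (σ : Signature) : ℕ → ℕ → Type
  | fluent {n m : ℕ} (F : σ.Fl) (args : Fin (σ.arF F) → OTerm n) : FOForm σ n m
  | eqO {n m : ℕ} (t₁ t₂ : OTerm n) : FOForm σ n m
  | eqA {n m : ℕ} (a₁ a₂ : ATerm σ n m) : FOForm σ n m
  | neg {n m : ℕ} (φ : FOForm σ n m) : FOForm σ n m
  | and {n m : ℕ} (φ ψ : FOForm σ n m) : FOForm σ n m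
  | exO {n m : ℕ} (φ : FOForm σ (n + 1) m) : FOForm σ n m
  | exA {n m : ℕ} (φ : FOForm σ n (m + 1)) : FOForm σ n m

/-- Formulas of the first-order mu-calculus with persistence, with `n` individual variables and `k`
predicate variables in scope (de Bruijn indices).  `exLive Φ` is `∃ x. live(x) ∧ Φ`, `dia X Φ` is
`live(X) ∧ ⟨-⟩Φ`, `box X Φ` is `live(X) ∧ [-]Φ`, and `mu Φ` is `μ Z. Φ`. -/
inductive MuForm (σ : Signature) : ℕ → ℕ → Type
  | fo {n k : ℕ} (φ : FOForm σ n 0) : MuForm σ n k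
  | neg {n k : ℕ} (Φ : MuForm σ n k) : MuForm σ n k
  | and {n k : ℕ} (Φ Ψ : MuForm σ n k) : MuForm σ n k
  | exLive {n k : ℕ} (Φ : MuForm σ (n + 1) k) : MuForm σ n k
  | dia {n k : ℕ} (X : List (Fin n)) (Φ : MuForm σ n k) : MuForm σ n k
  | box {n k : ℕ} (X : List (Fin n)) (Φ : MuForm σ n k) : MuForm σ n k
  | pvar {n k : ℕ} (Z : Fin k) : MuForm σ n k
  | mu {n k : ℕ} (Φ : MuForm σ n (k + 1)) : MuForm σ n k

/-- The part of a basic action theory that depends on the domain: a finite list of initial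
situation axioms (sentences about `S₀`), for every action type `A` the right-hand side of the
precondition axiom `Poss(A(x₀, …), s) ≡ φ_A(x₀, …, s)`, and for every fluent `F` the right-hand side
of the successor state axiom `F(x₀, …, do(a, s)) ≡ φ_F(x₀, …, a, s)`, where `a` is the only action
variable in scope. -/
structure BAT (σ : Signature) where
  init : List (FOForm σ 0 0)
  pre : (A : σ.Ac) → FOForm σ (σ.arA A) 0
  ssa : (F : σ.Fl) → FOForm σ (σ.arF F) 1

/-! ### Constants and free variables -/

/-- The constants occurring in an object term. -/
def OTerm.consts {n : ℕ} : OTerm n → Finset ℕ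
  | .var _ => ∅
  | .const c => {c}

/-- The constants occurring in an action term. -/
def ATerm.consts {σ : Signature} {n m : ℕ} : ATerm σ n m → Finset ℕ
  | .var _ => ∅
  | .app _ args => Finset.univ.biUnion fun i => (args i).consts

/-- The constants occurring in a first-order formula. -/
def FOForm.consts {σ : Signature} : {n m : ℕ} → FOForm σ n m → Finset ℕ
  | _, _, .fluent _ args => Finset.univ.biUnion fun i => (args i).consts
  | _, _, .eqO t₁ t₂ => t₁.consts ∪ t₂.consts
  | _, _, .eqA a₁ a₂ => a₁.consts ∪ a₂.consts
  | _, _, .neg φ => φ.consts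
  | _, _, .and φ ψ => φ.consts ∪ ψ.consts
  | _, _, .exO φ => φ.consts
  | _, _, .exA φ => φ.consts

/-- The constants occurring in a mu-calculus formula. -/
def MuForm.consts {σ : Signature} : {n k : ℕ} → MuForm σ n k → Finset ℕ
  | _, _, .fo φ => φ.consts
  | _, _, .neg Φ => Φ.consts
  | _, _, .and Φ Ψ => Φ.consts ∪ Ψ.consts
  | _, _, .exLive Φ => Φ.consts
  | _, _, .dia _ Φ => Φ.consts
  | _, _, .box _ Φ => Φ.consts
  | _, _, .pvar _ => ∅
  | _, _, .mu Φ => Φ.consts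

/-- The finite set `C` of the constants explicitly mentioned in the initial situation axioms, the
precondition axioms and the successor state axioms. -/
def BAT.consts {σ : Signature} (D : BAT σ) : Finset ℕ :=
  (D.init.map FOForm.consts).foldr (· ∪ ·) ∅ ∪
    (Finset.univ.biUnion fun A => (D.pre A).consts) ∪
    (Finset.univ.biUnion fun F => (D.ssa F).consts)

/-- The variables occurring in an object term. -/
def OTerm.free {n : ℕ} : OTerm n → Set (Fin n)
  | .var i => {i}
  | .const _ => ∅

/-- The object variables occurring in an action term. -/
def ATerm.free {σ : Signature} {n m : ℕ} : ATerm σ n m → Set (Fin n)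
  | .var _ => ∅
  | .app _ args => ⋃ j, (args j).free

/-- The free object variables of a first-order formula. -/
def FOForm.free {σ : Signature} : {n m : ℕ} → FOForm σ n m → Set (Fin n)
  | _, _, .fluent _ args => ⋃ j, (args j).free
  | _, _, .eqO t₁ t₂ => t₁.free ∪ t₂.free
  | _, _, .eqA a₁ a₂ => a₁.free ∪ a₂.free
  | _, _, .neg φ => φ.free
  | _, _, .and φ ψ => φ.free ∪ ψ.free
  | _, _, .exO φ => {i | i.succ ∈ φ.free}
  | _, _, .exA φ => φ.free

/-- The free individual variables of a mu-calculus formula after each predicate variable `Z` in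
scope has been replaced (without capture of variables) by a formula whose free individual variables
are `ρ Z`.  In `mu Φ` the new predicate variable is bound and contributes nothing. -/
def MuForm.free {σ : Signature} :
    {n k : ℕ} → MuForm σ n k → (Fin k → Set (Fin n)) → Set (Fin n)
  | _, _, .fo φ, _ => φ.free
  | _, _, .neg Φ, ρ => Φ.free ρ
  | _, _, .and Φ Ψ, ρ => Φ.free ρ ∪ Ψ.free ρ
  | _, _, .exLive Φ, ρ => {i | i.succ ∈ Φ.free fun Z => Fin.succ '' ρ Z}
  | _, _, .dia X Φ, ρ => {i | i ∈ X} ∪ Φ.free ρ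
  | _, _, .box X Φ, ρ => {i | i ∈ X} ∪ Φ.free ρ
  | _, _, .pvar Z, ρ => ρ Z
  | n, k, .mu Φ, ρ => Φ.free (Fin.cons ∅ ρ : Fin (k + 1) → Set (Fin n))

/-- `Φ.EvenNeg Z p`: every occurrence of the predicate variable `Z` in `Φ` lies under an even number
of negations, where `p` tells whether an even number of negations surrounds `Φ` itself. -/
def MuForm.EvenNeg {σ : Signature} : {n k : ℕ} → MuForm σ n k → Fin k → Bool → Prop
  | _, _, .fo _, _, _ => True
  | _, _, .neg Φ, Z, p => Φ.EvenNeg Z (!p)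
  | _, _, .and Φ Ψ, Z, p => Φ.EvenNeg Z p ∧ Ψ.EvenNeg Z p
  | _, _, .exLive Φ, Z, p => Φ.EvenNeg Z p
  | _, _, .dia _ Φ, Z, p => Φ.EvenNeg Z p
  | _, _, .box _ Φ, Z, p => Φ.EvenNeg Z p
  | _, _, .pvar Y, Z, p => Y = Z → p = true
  | _, _, .mu Φ, Z, p => Φ.EvenNeg Z.succ p

/-- Well-formedness, where `ρ Z` is the set of the free individual variables of the fixpoint formula
that binds `Z`: the variables `X` in `live(X) ∧ ⟨-⟩Φ` and `live(X) ∧ [-]Φ` are exactly the free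
individual variables of `Φ` after each predicate variable has been replaced by the fixpoint formula
that binds it, and in `μ Z. Φ` the formula `Φ` is syntactically monotone in `Z`. -/
def MuForm.WF {σ : Signature} : {n k : ℕ} → MuForm σ n k → (Fin k → Set (Fin n)) → Prop
  | _, _, .fo _, _ => True
  | _, _, .neg Φ, ρ => Φ.WF ρ
  | _, _, .and Φ Ψ, ρ => Φ.WF ρ ∧ Ψ.WF ρ
  | _, _, .exLive Φ, ρ => Φ.WF fun Z => Fin.succ '' ρ Z
  | _, _, .dia X Φ, ρ => {i | i ∈ X} = Φ.free ρ ∧ Φ.WF ρ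
  | _, _, .box X Φ, ρ => {i | i ∈ X} = Φ.free ρ ∧ Φ.WF ρ
  | _, _, .pvar _, _ => True
  | n, k, .mu Φ, ρ => Φ.EvenNeg 0 true ∧
      Φ.WF (Fin.cons ((MuForm.mu Φ).free ρ) ρ : Fin (k + 1) → Set (Fin n))

/-- A well-formed closed formula over the theory `D`: it mentions no constants but those explicitly
mentioned in `D`. -/
def MuForm.Admissible {σ : Signature} (D : BAT σ) (Φ : MuForm σ 0 0) : Prop :=
  Φ.WF Fin.elim0 ∧ Φ.consts ⊆ D.consts

/-! ### Semantics -/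

/-- Structures for the three-sorted language of the situation calculus.  `lt` is the precedence
relation on situations. -/
structure Structure (σ : Signature) : Type (u + 1) where
  Obj : Type u
  Act : Type u
  Sit : Type u
  const : ℕ → Obj
  act : (A : σ.Ac) → (Fin (σ.arA A) → Obj) → Act
  S₀ : Sit
  doA : Act → Sit → Sit
  lt : Sit → Sit → Prop
  Poss : Act → Sit → Prop
  fluent : (F : σ.Fl) → (Fin (σ.arF F) → Obj) → Sit → Prop

/-- Interpretations of the (situation-suppressed) fluents and of the constants. -/
structure Interp (σ : Signature) : Type (u + 1) where
  Dom : Type u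
  fluent : (F : σ.Fl) → (Fin (σ.arF F) → Dom) → Prop
  const : ℕ → Dom

/-- The active domain: all the individuals that occur in the extension of some fluent or interpret
some constant in `C`. -/
def Interp.adom {σ : Signature} (I : Interp.{u} σ) (C : Finset ℕ) : Set I.Dom :=
  {d | (∃ F x, I.fluent F x ∧ ∃ i, x i = d) ∨ ∃ c ∈ C, I.const c = d}

/-- The restrictions of two interpretations of the fluents and of the constants in `C` to their
active domains are isomorphic. -/
def ActiveIso {σ : Signature} (C : Finset ℕ) (I : Interp.{u} σ) (J : Interp.{v} σ) : Prop :=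
  ∃ h : I.adom C ≃ J.adom C,
    (∀ (F : σ.Fl) (x : Fin (σ.arF F) → I.adom C),
      I.fluent F (fun i => (x i : I.Dom)) ↔ J.fluent F (fun i => (h (x i) : J.Dom))) ∧
    ∀ (c : ℕ) (hc : c ∈ C), (h ⟨I.const c, Or.inr ⟨c, hc, rfl⟩⟩ : J.Dom) = J.const c

/-- The value of an object term. -/
def OTerm.eval {n : ℕ} {X : Type u} (const : ℕ → X) (x : Fin n → X) : OTerm n → X
  | .var i => x i
  | .const c => const c

namespace Structure

variable {σ : Signature} (M : Structure.{u} σ)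

/-- The interpretation of the fluents and constants associated with a situation. -/
def interp (s : M.Sit) : Interp.{u} σ where
  Dom := M.Obj
  fluent F x := M.fluent F x s
  const := M.const

/-- The active domain of a situation, with respect to the set `C` of constants. -/
def adom (C : Finset ℕ) (s : M.Sit) : Set M.Obj := (M.interp s).adom C

/-- The foundational axioms of the situation calculus. -/
def Foundational : Prop :=
  (∀ a₁ a₂ s₁ s₂, M.doA a₁ s₁ = M.doA a₂ s₂ → a₁ = a₂ ∧ s₁ = s₂) ∧
  (∀ P : M.Sit → Prop, P M.S₀ → (∀ a s, P s → P (M.doA a s)) → ∀ s, P s) ∧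
  (∀ s, ¬ M.lt s M.S₀) ∧
  (∀ a s s', M.lt s (M.doA a s') ↔ (M.lt s s' ∨ s = s'))

/-- Unique name axioms for actions, and domain closure on action types. -/
def ActionAxioms : Prop :=
  (∀ A x y, M.act A x = M.act A y → x = y) ∧
  (∀ A B x y, A ≠ B → M.act A x ≠ M.act B y) ∧
  (∀ a, ∃ A x, a = M.act A x)

/-- Unique name axioms for the object constants. -/
def UniqueNames : Prop := ∀ c d : ℕ, c ≠ d → M.const c ≠ M.const d

/-- Every action performed in reaching `s` was executable in the situation in which it occurred. -/
def Executable (s : M.Sit) : Prop :=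
  ∀ a s', (M.lt (M.doA a s') s ∨ M.doA a s' = s) → M.Poss a s'

/-- Every fluent has fewer than `b` distinct tuples in its extension in `s`. -/
def BoundedSit (b : ℕ) (s : M.Sit) : Prop :=
  ∀ F : σ.Fl, ¬ ∃ x : Fin b → (Fin (σ.arF F) → M.Obj),
    Function.Injective x ∧ ∀ i, M.fluent F (x i) s

/-- Every executable situation is bounded by `b`. -/
def Bounded (b : ℕ) : Prop := ∀ s, M.Executable s → M.BoundedSit b s

end Structure

/-- The value of an action term. -/
def ATerm.eval {σ : Signature} {n m : ℕ} (M : Structure.{u} σ) (x : Fin n → M.Obj)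
    (y : Fin m → M.Act) : ATerm σ n m → M.Act
  | .var i => y i
  | .app A args => M.act A fun i => (args i).eval M.const x

/-- Satisfaction of a uniform first-order formula in the situation `s`, where `x` and `y` are the
values of the object variables and of the action variables. -/
def FOForm.Holds {σ : Signature} (M : Structure.{u} σ) (s : M.Sit) :
    {n m : ℕ} → FOForm σ n m → (Fin n → M.Obj) → (Fin m → M.Act) → Prop
  | _, _, .fluent F args, x, _ => M.fluent F (fun i => (args i).eval M.const x) s
  | _, _, .eqO t₁ t₂, x, _ => t₁.eval M.const x = t₂.eval M.const x
  | _, _, .eqA a₁ a₂, x, y => a₁.eval M x y = a₂.eval M x y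
  | _, _, .neg φ, x, y => ¬ φ.Holds M s x y
  | _, _, .and φ ψ, x, y => φ.Holds M s x y ∧ ψ.Holds M s x y
  | n, _, .exO φ, x, y => ∃ d : M.Obj, φ.Holds M s (Fin.cons d x : Fin (n + 1) → M.Obj) y
  | _, m, .exA φ, x, y => ∃ a : M.Act, φ.Holds M s x (Fin.cons a y : Fin (m + 1) → M.Act)

/-- The extension of a mu-calculus formula, a set of situations, where `x` and `V` are the values of
the individual variables and of the predicate variables, and `C` is the set of constants that
counts for the active domain. -/
def MuForm.ext {σ : Signature} (M : Structure.{u} σ) (C : Finset ℕ) :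
    {n k : ℕ} → MuForm σ n k → (Fin n → M.Obj) → (Fin k → Set M.Sit) → Set M.Sit
  | _, _, .fo φ, x, _ => {s | φ.Holds M s x Fin.elim0}
  | _, _, .neg Φ, x, V => (Φ.ext M C x V)ᶜ
  | _, _, .and Φ Ψ, x, V => Φ.ext M C x V ∩ Ψ.ext M C x V
  | n, _, .exLive Φ, x, V =>
      {s | ∃ d ∈ M.adom C s, s ∈ Φ.ext M C (Fin.cons d x : Fin (n + 1) → M.Obj) V}
  | _, _, .dia X Φ, x, V =>
      {s | (∀ i ∈ X, x i ∈ M.adom C s) ∧ ∃ a, M.Poss a s ∧ M.doA a s ∈ Φ.ext M C x V}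
  | _, _, .box X Φ, x, V =>
      {s | (∀ i ∈ X, x i ∈ M.adom C s) ∧ ∀ a, M.Poss a s → M.doA a s ∈ Φ.ext M C x V}
  | _, _, .pvar Z, _, V => V Z
  | _, k, .mu Φ, x, V =>
      ⋂₀ {E | Φ.ext M C x (Fin.cons E V : Fin (k + 1) → Set M.Sit) ⊆ E}

/-- The closed formula `Φ` over the theory `D` holds in the initial situation of `M`. -/
def MuForm.TrueIn {σ : Signature} (D : BAT σ) (M : Structure.{u} σ) (Φ : MuForm σ 0 0) : Prop :=
  M.S₀ ∈ Φ.ext M D.consts Fin.elim0 Fin.elim0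

namespace BAT

variable {σ : Signature} (D : BAT σ)

/-- `M` satisfies all the axioms of the theory except the initial situation axioms. -/
def DynModel (M : Structure.{u} σ) : Prop :=
  M.Foundational ∧ M.ActionAxioms ∧ M.UniqueNames ∧
  (∀ A x s, M.Poss (M.act A x) s ↔ (D.pre A).Holds M s x Fin.elim0) ∧
  (∀ F x a s, M.fluent F x (M.doA a s) ↔ (D.ssa F).Holds M s x (fun _ => a))

/-- `M` is a model of the basic action theory. -/
def Model (M : Structure.{u} σ) : Prop :=
  D.DynModel M ∧ ∀ φ ∈ D.init, φ.Holds M M.S₀ Fin.elim0 Fin.elim0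

/-- The theory is bounded by `b`: it entails that every executable situation is bounded by `b`. -/
def BoundedBy (b : ℕ) : Prop := ∀ M : Structure.{u} σ, D.Model M → M.Bounded b

/-- `D ⊨ Φ`: the closed formula holds in the initial situation of every model of the theory. -/
def Entails (Φ : MuForm σ 0 0) : Prop := ∀ M : Structure.{u} σ, D.Model M → Φ.TrueIn D M

end BAT

/-! ### Databases: complete information on the initial situation -/

/-- A finite database over the domain `ℕ`: for each fluent (by position) the list of the tuples in
its extension, and a list of pairs that assigns objects to constants. -/
abbrev DB : Type := List (List (List ℕ)) × List (ℕ × ℕ)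

/-- The interpretation over the infinite domain `ℕ` that a database describes.  Constants that the
database does not list denote `0`; only the constants of the theory matter. -/
def DB.interp (σ : Signature) (I : DB) : Interp.{0} σ where
  Dom := ℕ
  fluent F x := List.ofFn x ∈ I.1.getD F []
  const c := (I.2.lookup c).getD 0

namespace BAT

variable {σ : Signature} (D : BAT σ)

/-- In `M`, the interpretation of the fluents and of the constants of the theory at the initial
situation is, up to a renaming of the objects, the one given by the database. -/
def InClass (I : DB) (M : Structure.{u} σ) : Prop :=
  ActiveIso D.consts (M.interp M.S₀) (I.interp σ)

/-- `M` is a model of the theory with complete information on the initial situation in which the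
initial situation axioms have been replaced by the database `I`. -/
def ModelDB (I : DB) (M : Structure.{u} σ) : Prop := D.DynModel M ∧ D.InClass I M

/-- The theory with complete information given by `I` is bounded by `b`. -/
def BoundedByDB (I : DB) (b : ℕ) : Prop :=
  ∀ M : Structure.{u} σ, D.ModelDB I M → M.Bounded b

/-- The theory with complete information given by `I` entails `Φ`. -/
def EntailsDB (I : DB) (Φ : MuForm σ 0 0) : Prop :=
  ∀ M : Structure.{u} σ, D.ModelDB I M → Φ.TrueIn D M

end BAT

/-! ### Codes: the inputs and outputs of algorithms -/

/-- The code of an object term. -/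
def OTerm.code {n : ℕ} : OTerm n → ℕ
  | .var i => Nat.pair 0 i
  | .const c => Nat.pair 1 c

/-- The code of an action term. -/
def ATerm.code {σ : Signature} {n m : ℕ} : ATerm σ n m → ℕ
  | .var i => Nat.pair 0 i
  | .app A args => Nat.pair 1 (Nat.pair A (Encodable.encode (List.ofFn fun i => (args i).code)))

/-- The code of a first-order formula. -/
def FOForm.code {σ : Signature} : {n m : ℕ} → FOForm σ n m → ℕ
  | _, _, .fluent F args =>
      Nat.pair 0 (Nat.pair F (Encodable.encode (List.ofFn fun i => (args i).code)))
  | _, _, .eqO t₁ t₂ => Nat.pair 1 (Nat.pair t₁.code t₂.code)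
  | _, _, .eqA a₁ a₂ => Nat.pair 2 (Nat.pair a₁.code a₂.code)
  | _, _, .neg φ => Nat.pair 3 φ.code
  | _, _, .and φ ψ => Nat.pair 4 (Nat.pair φ.code ψ.code)
  | _, _, .exO φ => Nat.pair 5 φ.code
  | _, _, .exA φ => Nat.pair 6 φ.code

/-- The code of a mu-calculus formula. -/
def MuForm.code {σ : Signature} : {n k : ℕ} → MuForm σ n k → ℕ
  | _, _, .fo φ => Nat.pair 0 φ.code
  | _, _, .neg Φ => Nat.pair 1 Φ.code
  | _, _, .and Φ Ψ => Nat.pair 2 (Nat.pair Φ.code Ψ.code)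
  | _, _, .exLive Φ => Nat.pair 3 Φ.code
  | _, _, .dia X Φ => Nat.pair 4 (Nat.pair (Encodable.encode (X.map Fin.val)) Φ.code)
  | _, _, .box X Φ => Nat.pair 5 (Nat.pair (Encodable.encode (X.map Fin.val)) Φ.code)
  | _, _, .pvar Z => Nat.pair 6 Z
  | _, _, .mu Φ => Nat.pair 7 Φ.code

/-- The code of a basic action theory, together with its signature. -/
def BAT.code {σ : Signature} (D : BAT σ) : ℕ :=
  Encodable.encode [Encodable.encode σ.fluents, Encodable.encode σ.actions,
    Encodable.encode (D.init.map FOForm.code),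
    Encodable.encode (List.ofFn fun A => (D.pre A).code),
    Encodable.encode (List.ofFn fun F => (D.ssa F).code)]

/-- On input `x`, the partial function `f` halts with the correct answer (`1` for yes and `0` for
no) to the question whether `P` holds. -/
def Answers (f : ℕ →. ℕ) (x : ℕ) (P : Prop) : Prop :=
  (P → f x = Part.some 1) ∧ (¬ P → f x = Part.some 0)

end SitCalc

open SitCalc

namespace SitCalc

/-! ### Finite partial bijections -/

/-! Two situations, possibly of different models, correspond under a finite partial bijection `H` of
objects if `H` matches the constants in `C` and every finite partial bijection extending `H`
preserves the fluents (`Corr`). Unique names make the object domains infinite, so a finite partial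
bijection can always be extended by one more object on either side, and a back-and-forth argument
shows that corresponding situations satisfy the same first-order formulas (`FOForm.holds_iff`).
Preconditions and successor state axioms are given by such formulas, so correspondence survives the
execution of related actions (`Corr.do`, `Corr.poss_iff`). It is thus a bisimulation up to renaming,
and it respects all mu-calculus formulas whose fixpoints are replaced by finite approximants
(`MuForm.mem_aext_iff`).

Boundedness makes the approximants exact. A bounded situation together with finitely many parameters
has one of finitely many isomorphism types, and equality of types yields a correspondence
(`exists_sitType`). Among the executable situations every iterate of a fixpoint operator is a union
of types, so the increasing chain of iterates is stationary after at most as many steps as there are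
types, a number with a computable bound (`MuForm.mem_ext_iff`, `card_sitType_le`).

Isomorphic initial active domains give corresponding initial situations, so truth depends on the
initial database only. Up to renaming, the databases of models form a finite computable list
(`BAT.Fits.exists_candidate`), and each database that separates the constants has a canonical model
`canon`, whose objects are natural numbers and whose situations are sequences of actions. There the
numbers beyond those mentioned so far are interchangeable (`corr_idBelow`), so quantifiers over
objects and actions need only the old numbers and a few fresh ones.

Evaluation in `canon` is organised as an and-or graph `next`. Finite derivations of values are coded
as certificates, which are checked primitive recursively and found by unbounded search
(`exists_partrec_search`). The search halts because induction over formulas and action sequences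
assigns a value to every relevant node (`decides_mu`). Entailment is then a conjunction over the
candidate databases, and the list of classes is found by searching for a list that the graph
confirms. -/

/-- A finite relation that is the graph of an injective partial function. -/
structure PBij {X : Type u} {Y : Type v} (H : Set (X × Y)) : Prop where
  finite : H.Finite
  inj : ∀ p ∈ H, ∀ q ∈ H, p.1 = q.1 ↔ p.2 = q.2

namespace PBij

variable {X : Type u} {Y : Type v} {H : Set (X × Y)}

theorem eq_iff (h : PBij H) {x₁ x₂ : X} {y₁ y₂ : Y} (h₁ : (x₁, y₁) ∈ H) (h₂ : (x₂, y₂) ∈ H) :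
    x₁ = x₂ ↔ y₁ = y₂ := h.inj _ h₁ _ h₂

theorem swap (h : PBij H) : PBij (Prod.swap ⁻¹' H) where
  finite := h.finite.preimage Prod.swap_injective.injOn
  inj _ hp _ hq := (h.inj _ hp _ hq).symm

/-- A partial bijection stays one when a pair of new elements is added. -/
theorem insert (h : PBij H) {x : X} {y : Y} (hx : ∀ p ∈ H, p.1 ≠ x) (hy : ∀ p ∈ H, p.2 ≠ y) :
    PBij (insert (x, y) H) where
  finite := h.finite.insert _
  inj p hp q hq := by
    rcases hp with rfl | hp <;> rcases hq with rfl | hq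
    · simp
    · exact iff_of_false (hx q hq).symm (hy q hq).symm
    · exact iff_of_false (hx p hp) (hy p hp)
    · exact h.inj p hp q hq

/-- One step of extension, where the new element may be taken in a set `B` that has an element
outside the range. -/
theorem extend_of (h : PBij H) {B : Set Y} (hB : ∀ p ∈ H, p.2 ∈ B) (hnew : ∃ y ∈ B, ∀ p ∈ H, p.2 ≠ y)
    (x : X) : ∃ y ∈ B, PBij (Insert.insert (x, y) H) := by
  by_cases hx : ∃ p ∈ H, p.1 = x
  · obtain ⟨p, hp, rfl⟩ := hx
    exact ⟨p.2, hB p hp, by rwa [Set.insert_eq_of_mem (by exact hp)]⟩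
  · push Not at hx
    obtain ⟨y, hy, hyH⟩ := hnew
    exact ⟨y, hy, h.insert hx hyH⟩

/-- The forth step of the back-and-forth argument: the range of `H` is finite, so an infinite `Y`
always has a fresh value. -/
theorem extend [Infinite Y] (h : PBij H) (x : X) : ∃ y, PBij (Insert.insert (x, y) H) := by
  have hfin : (Prod.snd '' H).Finite := h.finite.image _
  obtain ⟨y, hy⟩ := hfin.exists_notMem
  obtain ⟨z, -, hz⟩ := h.extend_of (B := Set.univ) (fun _ _ => trivial)
    ⟨y, trivial, fun p hp e => hy ⟨p, hp, e⟩⟩ x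
  exact ⟨z, hz⟩

theorem extend_right [Infinite X] (h : PBij H) (y : Y) :
    ∃ x, PBij (Insert.insert (x, y) H) := by
  obtain ⟨x, hx⟩ := h.swap.extend y
  refine ⟨x, ?_⟩
  convert hx.swap using 1
  ext ⟨a, b⟩
  simp [and_comm]

/-- Extension to a tuple, with control over the values. -/
theorem extend_tuple_of {B : ℕ → Set Y} (hmono : ∀ j, B j ⊆ B (j + 1))
    (hB : ∀ j (H : Set (X × Y)), PBij H → (∀ p ∈ H, p.2 ∈ B j) →
      ∀ x, ∃ y ∈ B (j + 1), PBij (Insert.insert (x, y) H)) :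
    ∀ (k j : ℕ) (H : Set (X × Y)), PBij H → (∀ p ∈ H, p.2 ∈ B j) → ∀ d : Fin k → X,
      ∃ H', H ⊆ H' ∧ PBij H' ∧ (∀ p ∈ H', p.2 ∈ B (j + k)) ∧ ∃ d' : Fin k → Y, ∀ i, (d i, d' i) ∈ H'
  | 0, j, H, h, hj, _ => ⟨H, subset_rfl, h, hj, Fin.elim0, fun i => i.elim0⟩
  | k + 1, j, H, h, hj, d => by
    -- Each entry of the tuple costs one level of the chain `B`. With constant `B` this is plain
    -- extension; with initial segments of the natural numbers it bounds the fresh values.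
    obtain ⟨y, hy, h₁⟩ := hB j H h hj (d 0)
    obtain ⟨H', hs, h', hj', d', hd'⟩ := extend_tuple_of hmono hB k (j + 1) _ h₁
      (by rintro p (rfl | hp); exacts [hy, hmono _ (hj p hp)]) (fun i => d i.succ)
    refine ⟨H', (Set.subset_insert _ _).trans hs, h', by simpa [add_assoc, add_comm 1 k] using hj',
      Fin.cons y d', fun i => ?_⟩
    refine Fin.cases ?_ (fun i => ?_) i
    · exact hs (Or.inl rfl)
    · exact hd' i

theorem extend_tuple [Infinite Y] (h : PBij H) {k : ℕ} (d : Fin k → X) :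
    ∃ H', H ⊆ H' ∧ PBij H' ∧ ∃ d' : Fin k → Y, ∀ i, (d i, d' i) ∈ H' := by
  obtain ⟨H', hs, h', -, hd⟩ := extend_tuple_of (X := X) (B := fun _ => (Set.univ : Set Y))
    (fun _ => subset_rfl)
    (fun _ H h _ x => (h.extend x).imp fun y hy => ⟨trivial, hy⟩) k 0 H h (fun _ _ => trivial) d
  exact ⟨H', hs, h', hd⟩

theorem extend_tuple_right [Infinite X] (h : PBij H) {k : ℕ} (d' : Fin k → Y) :
    ∃ H', H ⊆ H' ∧ PBij H' ∧ ∃ d : Fin k → X, ∀ i, (d i, d' i) ∈ H' := by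
  obtain ⟨H', hs, h', d, hd⟩ := h.swap.extend_tuple d'
  exact ⟨Prod.swap ⁻¹' H', fun p hp => hs hp, h'.swap, d, hd⟩

end PBij

/-! ### Correspondence of situations -/

variable {σ : Signature}

/-- The situations `s` and `s'` correspond to each other under the finite partial bijection `H` of
the objects: `H` relates the constants of the theory, and all the partial bijections that extend `H`
preserve the fluents. -/
structure Corr (D : BAT σ) (M : Structure.{u} σ) (M' : Structure.{v} σ) (H : Set (M.Obj × M'.Obj))
    (s : M.Sit) (s' : M'.Sit) : Prop where
  pbij : PBij H
  consts : ∀ c ∈ D.consts, (M.const c, M'.const c) ∈ H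
  fluents : ∀ H', H ⊆ H' → PBij H' → ∀ F x x', (∀ i, (x i, x' i) ∈ H') →
    (M.fluent F x s ↔ M'.fluent F x' s')

/-- Two actions of the same type with related arguments. -/
def ActRel (M : Structure.{u} σ) (M' : Structure.{v} σ) (H : Set (M.Obj × M'.Obj))
    (a : M.Act) (a' : M'.Act) : Prop :=
  ∃ A x x', a = M.act A x ∧ a' = M'.act A x' ∧ ∀ i, (x i, x' i) ∈ H

section

variable {D : BAT σ} {M : Structure.{u} σ} {M' : Structure.{v} σ} {H H' : Set (M.Obj × M'.Obj)}
  {s : M.Sit} {s' : M'.Sit}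

/-- Since `Corr` quantifies over all extensions of `H`, enlarging the bijection only weakens the
condition on the fluents. -/
theorem Corr.mono (h : Corr D M M' H s s') (hs : H ⊆ H') (hH' : PBij H') : Corr D M M' H' s s' where
  pbij := hH'
  consts c hc := hs (h.consts c hc)
  fluents H₁ h₁ := h.fluents H₁ (hs.trans h₁)

theorem ActRel.mono {a : M.Act} {a' : M'.Act} (h : ActRel M M' H a a') (hs : H ⊆ H') :
    ActRel M M' H' a a' := by
  obtain ⟨A, x, x', h₁, h₂, h₃⟩ := h
  exact ⟨A, x, x', h₁, h₂, fun i => hs (h₃ i)⟩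

/-- Domain closure reduces an action to its type and a finite tuple of objects, so extending by an
action is extending by that tuple. -/
theorem ActRel.extend [Infinite M'.Obj] (hM : M.ActionAxioms) (h : PBij H) (a : M.Act) :
    ∃ H', H ⊆ H' ∧ PBij H' ∧ ∃ a', ActRel M M' H' a a' := by
  obtain ⟨A, x, rfl⟩ := hM.2.2 a
  obtain ⟨H', hs, hH', x', hx'⟩ := h.extend_tuple (Y := M'.Obj) x
  exact ⟨H', hs, hH', _, A, x, x', rfl, rfl, hx'⟩

theorem ActRel.extend_right [Infinite M.Obj] (hM' : M'.ActionAxioms) (h : PBij H) (a' : M'.Act) :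
    ∃ H', H ⊆ H' ∧ PBij H' ∧ ∃ a, ActRel M M' H' a a' := by
  obtain ⟨A, x', rfl⟩ := hM'.2.2 a'
  obtain ⟨H', hs, hH', x, hx⟩ := h.extend_tuple_right (X := M.Obj) x'
  exact ⟨H', hs, hH', _, A, x, x', rfl, rfl, hx⟩

/-- Unique names for actions reduce equality of actions to equality of the types and of the
arguments, which `H` respects. -/
theorem ActRel.eq_iff (hM : M.ActionAxioms) (hM' : M'.ActionAxioms) (h : PBij H)
    {a b : M.Act} {a' b' : M'.Act} (ha : ActRel M M' H a a') (hb : ActRel M M' H b b') :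
    a = b ↔ a' = b' := by
  obtain ⟨A, x, x', rfl, rfl, hx⟩ := ha
  obtain ⟨B, y, y', rfl, rfl, hy⟩ := hb
  by_cases hAB : A = B
  · subst hAB
    have key : x = y ↔ x' = y' := by
      simp only [funext_iff]
      exact forall_congr' fun i => h.eq_iff (hx i) (hy i)
    constructor
    · intro e
      rw [key.1 (hM.1 _ _ _ e)]
    · intro e
      rw [key.2 (hM'.1 _ _ _ e)]
  · exact iff_of_false (hM.2.1 _ _ _ _ hAB) (hM'.2.1 _ _ _ _ hAB)

/-! ### Invariance of terms and first-order formulas under correspondence -/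

theorem OTerm.eval_rel (hc : ∀ c ∈ D.consts, (M.const c, M'.const c) ∈ H) {n : ℕ} (t : OTerm n)
    (ht : t.consts ⊆ D.consts) {x : Fin n → M.Obj} {x' : Fin n → M'.Obj}
    (hx : ∀ i, (x i, x' i) ∈ H) : (t.eval M.const x, t.eval M'.const x') ∈ H := by
  cases t with
  | var i => exact hx i
  | const c => exact hc c (ht (by simp [OTerm.consts]))

theorem ATerm.eval_rel (hc : ∀ c ∈ D.consts, (M.const c, M'.const c) ∈ H) {n m : ℕ}
    (t : ATerm σ n m) (ht : t.consts ⊆ D.consts) {x : Fin n → M.Obj} {x' : Fin n → M'.Obj}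
    (hx : ∀ i, (x i, x' i) ∈ H) {y : Fin m → M.Act} {y' : Fin m → M'.Act}
    (hy : ∀ i, ActRel M M' H (y i) (y' i)) : ActRel M M' H (t.eval M x y) (t.eval M' x' y') := by
  cases t with
  | var i => exact hy i
  | app A args =>
    refine ⟨A, _, _, rfl, rfl, fun i => OTerm.eval_rel hc _ (fun c hc' => ht ?_) hx⟩
    simp only [ATerm.consts, Finset.mem_biUnion]
    exact ⟨i, Finset.mem_univ _, hc'⟩

theorem FOForm.consts_arg_subset {n m : ℕ} {F : σ.Fl} {args : Fin (σ.arF F) → OTerm n}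
    (i : Fin (σ.arF F)) :
    (args i).consts ⊆ (FOForm.fluent (m := m) F args).consts := fun c hc => by
  simp only [FOForm.consts, Finset.mem_biUnion]
  exact ⟨i, Finset.mem_univ _, hc⟩

/-- First-order formulas do not distinguish corresponding situations. -/
theorem FOForm.holds_iff [Infinite M.Obj] [Infinite M'.Obj] (hM : M.ActionAxioms)
    (hM' : M'.ActionAxioms) {n m : ℕ} (φ : FOForm σ n m) :
    φ.consts ⊆ D.consts → ∀ {H} {x : Fin n → M.Obj} {x' : Fin n → M'.Obj} {y : Fin m → M.Act}
      {y' : Fin m → M'.Act}, Corr D M M' H s s' → (∀ i, (x i, x' i) ∈ H) →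
      (∀ i, ActRel M M' H (y i) (y' i)) → (φ.Holds M s x y ↔ φ.Holds M' s' x' y') := by
  induction φ with
  | fluent F args =>
    intro hφ H x x' y y' h hx _
    exact h.fluents H subset_rfl h.pbij F _ _ fun i =>
      OTerm.eval_rel h.consts _ ((FOForm.consts_arg_subset (m := 0) i).trans hφ) hx
  | eqO t₁ t₂ =>
    intro hφ H x x' y y' h hx _
    exact h.pbij.eq_iff
      (OTerm.eval_rel h.consts _ (Finset.union_subset_left hφ) hx)
      (OTerm.eval_rel h.consts _ (Finset.union_subset_right hφ) hx)
  | eqA a₁ a₂ =>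
    intro hφ H x x' y y' h hx hy
    exact ActRel.eq_iff hM hM' h.pbij
      (ATerm.eval_rel h.consts _ (Finset.union_subset_left hφ) hx hy)
      (ATerm.eval_rel h.consts _ (Finset.union_subset_right hφ) hx hy)
  | neg φ ih => exact fun hφ H x x' y y' h hx hy => not_congr (ih hφ h hx hy)
  | and φ ψ ih₁ ih₂ =>
    exact fun hφ H x x' y y' h hx hy => and_congr
      (ih₁ (Finset.union_subset_left hφ) h hx hy) (ih₂ (Finset.union_subset_right hφ) h hx hy)
  | exO φ ih =>
    intro hφ H x x' y y' h hx hy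
    -- Any legal pair of witnesses may be added to `H`; the two directions then need only a partner
    -- for the given witness.
    have key : ∀ d d', PBij (insert (d, d') H) →
        (φ.Holds M s (Fin.cons d x) y ↔ φ.Holds M' s' (Fin.cons d' x') y') := fun d d' hd =>
      ih hφ (h.mono (Set.subset_insert _ _) hd)
        (fun i => Fin.cases (Or.inl rfl) (fun i => Or.inr (hx i)) i)
        (fun i => (hy i).mono (Set.subset_insert _ _))
    constructor
    · rintro ⟨d, hd⟩
      obtain ⟨d', hd'⟩ := h.pbij.extend d
      exact ⟨d', (key d d' hd').1 hd⟩
    · rintro ⟨d', hd⟩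
      obtain ⟨d, hd'⟩ := h.pbij.extend_right d'
      exact ⟨d, (key d d' hd').2 hd⟩
  | exA φ ih =>
    intro hφ H x x' y y' h hx hy
    have key : ∀ H', H ⊆ H' → PBij H' → ∀ a a', ActRel M M' H' a a' →
        (φ.Holds M s x (Fin.cons a y) ↔ φ.Holds M' s' x' (Fin.cons a' y')) :=
      fun H' hs hH' a a' ha => ih hφ (h.mono hs hH') (fun i => hs (hx i))
        (fun i => Fin.cases ha (fun i => (hy i).mono hs) i)
    constructor
    · rintro ⟨a, ha⟩
      obtain ⟨H', hs, hH', a', haa'⟩ := ActRel.extend (M' := M') hM h.pbij a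
      exact ⟨a', (key H' hs hH' a a' haa').1 ha⟩
    · rintro ⟨a', ha⟩
      obtain ⟨H', hs, hH', a, haa'⟩ := ActRel.extend_right (M := M) hM' h.pbij a'
      exact ⟨a, (key H' hs hH' a a' haa').2 ha⟩

theorem Structure.UniqueNames.infinite {M : Structure.{u} σ} (h : M.UniqueNames) :
    Infinite M.Obj :=
  Infinite.of_injective M.const fun c d e => by_contra fun hne => h c d hne e

theorem BAT.pre_consts_subset (D : BAT σ) (A : σ.Ac) : (D.pre A).consts ⊆ D.consts := fun c hc => by
  simp only [BAT.consts, Finset.mem_union, Finset.mem_biUnion]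
  exact Or.inl (Or.inr ⟨A, Finset.mem_univ _, hc⟩)

theorem BAT.ssa_consts_subset (D : BAT σ) (F : σ.Fl) : (D.ssa F).consts ⊆ D.consts := fun c hc => by
  simp only [BAT.consts, Finset.mem_union, Finset.mem_biUnion]
  exact Or.inr ⟨F, Finset.mem_univ _, hc⟩

theorem mem_foldr_union_iff {c : ℕ} : ∀ l : List (Finset ℕ),
    c ∈ l.foldr (· ∪ ·) ∅ ↔ ∃ S ∈ l, c ∈ S
  | [] => by simp
  | S :: l => by simp [mem_foldr_union_iff l]

theorem BAT.mem_consts_iff (D : BAT σ) {c : ℕ} : c ∈ D.consts ↔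
    (∃ φ ∈ D.init, c ∈ φ.consts) ∨ (∃ A, c ∈ (D.pre A).consts) ∨ ∃ F, c ∈ (D.ssa F).consts := by
  simp [BAT.consts, mem_foldr_union_iff]

theorem BAT.init_consts_subset (D : BAT σ) {φ : FOForm σ 0 0} (hφ : φ ∈ D.init) :
    φ.consts ⊆ D.consts := fun _ hc => D.mem_consts_iff.2 (Or.inl ⟨φ, hφ, hc⟩)

theorem Corr.holds_iff (hM : D.DynModel M) (hM' : D.DynModel M') (h : Corr D M M' H s s')
    {n m : ℕ} {φ : FOForm σ n m}
    (hφ : φ.consts ⊆ D.consts) {x : Fin n → M.Obj} {x' : Fin n → M'.Obj} (hx : ∀ i, (x i, x' i) ∈ H)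
    {y : Fin m → M.Act} {y' : Fin m → M'.Act} (hy : ∀ i, ActRel M M' H (y i) (y' i)) :
    φ.Holds M s x y ↔ φ.Holds M' s' x' y' :=
  haveI := hM.2.2.1.infinite
  haveI := hM'.2.2.1.infinite
  FOForm.holds_iff hM.2.1 hM'.2.1 φ hφ h hx hy

/-- The successor state axiom turns a fluent after the action into a first-order formula before it.
Any extension of `H` is still a correspondence there, so that formula is preserved. -/
theorem Corr.do (hM : D.DynModel M) (hM' : D.DynModel M') (h : Corr D M M' H s s') {a : M.Act}
    {a' : M'.Act} (ha : ActRel M M' H a a') : Corr D M M' H (M.doA a s) (M'.doA a' s') where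
  pbij := h.pbij
  consts := h.consts
  fluents H' hs hH' F x x' hx := by
    rw [hM.2.2.2.2, hM'.2.2.2.2]
    exact (h.mono hs hH').holds_iff hM hM' (D.ssa_consts_subset F) hx fun _ => ha.mono hs

theorem Corr.poss_iff (hM : D.DynModel M) (hM' : D.DynModel M') (h : Corr D M M' H s s')
    {a : M.Act} {a' : M'.Act} (ha : ActRel M M' H a a') : M.Poss a s ↔ M'.Poss a' s' := by
  obtain ⟨A, x, x', rfl, rfl, hx⟩ := ha
  rw [hM.2.2.2.1, hM'.2.2.2.1]
  exact h.holds_iff hM hM' (D.pre_consts_subset A) hx fun i => i.elim0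

theorem Structure.mem_adom_iff {M : Structure.{u} σ} {C : Finset ℕ} {s : M.Sit} {d : M.Obj} :
    d ∈ M.adom C s ↔ (∃ F x, M.fluent F x s ∧ ∃ i, x i = d) ∨ ∃ c ∈ C, M.const c = d := Iff.rfl

/-- Liveness is transported by extending `H` to the whole tuple that witnesses it: the position
occupied by `d` is then occupied by `d'`. -/
theorem Corr.mem_adom_iff (hM : D.DynModel M) (hM' : D.DynModel M') (h : Corr D M M' H s s')
    {d : M.Obj} {d' : M'.Obj} (hd : (d, d') ∈ H) :
    d ∈ M.adom D.consts s ↔ d' ∈ M'.adom D.consts s' := by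
  have := hM.2.2.1.infinite
  have := hM'.2.2.1.infinite
  simp only [Structure.mem_adom_iff]
  refine or_congr ⟨?_, ?_⟩ (exists_congr fun c => and_congr_right fun hc => ?_)
  · rintro ⟨F, x, hx, i, rfl⟩
    obtain ⟨H', hs, hH', x', hx'⟩ := h.pbij.extend_tuple x
    exact ⟨F, x', (h.fluents H' hs hH' F x x' hx').1 hx, i, (hH'.eq_iff (hx' i) (hs hd)).1 rfl⟩
  · rintro ⟨F, x', hx, i, rfl⟩
    obtain ⟨H', hs, hH', x, hx'⟩ := h.pbij.extend_tuple_right x'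
    exact ⟨F, x, (h.fluents H' hs hH' F x x' hx').2 hx, i, (hH'.eq_iff (hx' i) (hs hd)).2 rfl⟩
  · exact h.pbij.eq_iff (h.consts c hc) hd

/-- Isomorphic finite active-domain interpretations give corresponding initial situations. -/
theorem exists_corr_of_activeIso (hfin : (M.adom D.consts s).Finite)
    (h : ActiveIso D.consts (M.interp s) (M'.interp s')) : ∃ H, Corr D M M' H s s' := by
  obtain ⟨e, he, hc⟩ : ∃ e : M.adom D.consts s ≃ M'.adom D.consts s',
      (∀ (F : σ.Fl) (x : Fin (σ.arF F) → M.adom D.consts s),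
        M.fluent F (fun i => (x i).1) s ↔ M'.fluent F (fun i => (e (x i)).1) s') ∧
      ∀ (c : ℕ) (hc : c ∈ D.consts),
        (e ⟨M.const c, Or.inr ⟨c, hc, rfl⟩⟩).1 = M'.const c := h
  have : Finite (M.adom D.consts s) := hfin
  -- The correspondence is the graph of the isomorphism. A tuple in a fluent lies inside the active
  -- domain, so any extension of the graph must send it to its image under `e`; this gives the
  -- condition on fluents.
  let g : M.adom D.consts s → M.Obj × M'.Obj := fun d => (d.1, (e d).1)
  have hg : ∀ d, (d.1, (e d).1) ∈ Set.range g := fun d => ⟨d, rfl⟩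
  refine ⟨Set.range g, ⟨Set.finite_range g, ?_⟩, ?_, ?_⟩
  · rintro _ ⟨d, rfl⟩ _ ⟨d', rfl⟩
    change d.1 = d'.1 ↔ (e d).1 = (e d').1
    rw [Subtype.coe_inj, Subtype.coe_inj]
    exact e.injective.eq_iff.symm
  · exact fun c hcC => ⟨⟨M.const c, Or.inr ⟨c, hcC, rfl⟩⟩, Prod.ext rfl (hc c hcC)⟩
  · intro H' hs hH' F x x' hx
    constructor
    · intro hF
      have := (he F fun i => ⟨x i, Or.inl ⟨F, x, hF, i, rfl⟩⟩).1 hF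
      rwa [show x' = _ from funext fun i =>
        (hH'.eq_iff (hx i) (hs (hg ⟨x i, Or.inl ⟨F, x, hF, i, rfl⟩⟩))).1 rfl]
    · intro hF
      let z : Fin (σ.arF F) → M.adom D.consts s :=
        fun i => e.symm ⟨x' i, Or.inl ⟨F, x', hF, i, rfl⟩⟩
      have hz : ∀ i, (e (z i)).1 = x' i := fun i => by rw [Equiv.apply_symm_apply]
      have := (he F z).2 (by rwa [show (fun i => (e (z i)).1) = x' from funext hz])
      rwa [show x = _ from funext fun i => (hH'.eq_iff (hx i) (hs (hg (z i)))).2 (hz i).symm]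

/-! ### Approximants of fixpoints -/

/-- The variant of the semantics in which every least fixpoint is replaced by its `K`-th finite
approximant. -/
def MuForm.aext (M : Structure.{u} σ) (C : Finset ℕ) (K : ℕ) :
    {n k : ℕ} → MuForm σ n k → (Fin n → M.Obj) → (Fin k → Set M.Sit) → Set M.Sit
  | _, _, .fo φ, x, _ => {s | φ.Holds M s x Fin.elim0}
  | _, _, .neg Φ, x, V => (Φ.aext M C K x V)ᶜ
  | _, _, .and Φ Ψ, x, V => Φ.aext M C K x V ∩ Ψ.aext M C K x V
  | n, _, .exLive Φ, x, V =>
      {s | ∃ d ∈ M.adom C s, s ∈ Φ.aext M C K (Fin.cons d x : Fin (n + 1) → M.Obj) V}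
  | _, _, .dia X Φ, x, V =>
      {s | (∀ i ∈ X, x i ∈ M.adom C s) ∧ ∃ a, M.Poss a s ∧ M.doA a s ∈ Φ.aext M C K x V}
  | _, _, .box X Φ, x, V =>
      {s | (∀ i ∈ X, x i ∈ M.adom C s) ∧ ∀ a, M.Poss a s → M.doA a s ∈ Φ.aext M C K x V}
  | _, _, .pvar Z, _, V => V Z
  | _, k, .mu Φ, x, V =>
      (fun E => Φ.aext M C K x (Fin.cons E V : Fin (k + 1) → Set M.Sit))^[K] ∅

/-- The values of the predicate variables do not distinguish corresponding situations. -/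
def PredRel (D : BAT σ) (M : Structure.{u} σ) (M' : Structure.{v} σ) (H : Set (M.Obj × M'.Obj))
    {k : ℕ} (V : Fin k → Set M.Sit) (V' : Fin k → Set M'.Sit) : Prop :=
  ∀ Z H' s s', H ⊆ H' → Corr D M M' H' s s' → (s ∈ V Z ↔ s' ∈ V' Z)

theorem PredRel.mono {k : ℕ} {V : Fin k → Set M.Sit} {V' : Fin k → Set M'.Sit}
    (h : PredRel D M M' H V V') (hs : H ⊆ H') : PredRel D M M' H' V V' :=
  fun Z H₁ _ _ h₁ => h Z H₁ _ _ (hs.trans h₁)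

theorem PredRel.cons {k : ℕ} {V : Fin k → Set M.Sit} {V' : Fin k → Set M'.Sit}
    (h : PredRel D M M' H V V') {E : Set M.Sit} {E' : Set M'.Sit}
    (hE : ∀ H' s s', H ⊆ H' → Corr D M M' H' s s' → (s ∈ E ↔ s' ∈ E')) :
    PredRel D M M' H (Fin.cons E V : Fin (k + 1) → Set M.Sit) (Fin.cons E' V') :=
  fun Z => Fin.cases hE h Z

end

/-- The semantics by approximants does not distinguish corresponding situations. -/
theorem MuForm.mem_aext_iff {D : BAT σ} {M : Structure.{u} σ} {M' : Structure.{v} σ}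
    (hM : D.DynModel M) (hM' : D.DynModel M') (K : ℕ) {n k : ℕ} (Φ : MuForm σ n k) :
    Φ.consts ⊆ D.consts → ∀ {H : Set (M.Obj × M'.Obj)} {x : Fin n → M.Obj} {x' : Fin n → M'.Obj}
      {V : Fin k → Set M.Sit} {V' : Fin k → Set M'.Sit}, (∀ i, (x i, x' i) ∈ H) →
      PredRel D M M' H V V' → ∀ {s s'}, Corr D M M' H s s' →
      (s ∈ Φ.aext M D.consts K x V ↔ s' ∈ Φ.aext M' D.consts K x' V') := by
  have := hM.2.2.1.infinite
  have := hM'.2.2.1.infinite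
  induction Φ with
  | fo φ => exact fun hΦ H x x' V V' hx _ s s' h => h.holds_iff hM hM' hΦ hx fun i => i.elim0
  | neg Φ ih => exact fun hΦ H x x' V V' hx hV s s' h => not_congr (ih hΦ hx hV h)
  | and Φ Ψ ih₁ ih₂ =>
    exact fun hΦ H x x' V V' hx hV s s' h => and_congr
      (ih₁ (Finset.union_subset_left hΦ) hx hV h) (ih₂ (Finset.union_subset_right hΦ) hx hV h)
  | exLive Φ ih =>
    intro hΦ H x x' V V' hx hV s s' h
    have key : ∀ d d', PBij (insert (d, d') H) →
        ((d ∈ M.adom D.consts s ∧ s ∈ Φ.aext M D.consts K (Fin.cons d x) V) ↔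
          (d' ∈ M'.adom D.consts s' ∧ s' ∈ Φ.aext M' D.consts K (Fin.cons d' x') V')) :=
      fun d d' hd => by
        have h' := h.mono (Set.subset_insert _ _) hd
        exact and_congr (h'.mem_adom_iff hM hM' (Or.inl rfl))
          (ih hΦ (fun i => Fin.cases (Or.inl rfl) (fun i => Or.inr (hx i)) i)
            (hV.mono (Set.subset_insert _ _)) h')
    constructor
    · rintro ⟨d, hd⟩
      obtain ⟨d', hd'⟩ := h.pbij.extend d
      exact ⟨d', (key d d' hd').1 hd⟩
    · rintro ⟨d', hd⟩
      obtain ⟨d, hd'⟩ := h.pbij.extend_right d'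
      exact ⟨d, (key d d' hd').2 hd⟩
  | dia X Φ ih =>
    intro hΦ H x x' V V' hx hV s s' h
    -- The arguments of the action join `H`, while the values of the individual variables stay
    -- related, so the induction hypothesis applies in the successor situations.
    have key : ∀ H', H ⊆ H' → PBij H' → ∀ a a', ActRel M M' H' a a' →
        ((M.Poss a s ∧ M.doA a s ∈ Φ.aext M D.consts K x V) ↔
          (M'.Poss a' s' ∧ M'.doA a' s' ∈ Φ.aext M' D.consts K x' V')) :=
      fun H' hs hH' a a' ha => and_congr ((h.mono hs hH').poss_iff hM hM' ha)
        (ih hΦ (fun i => hs (hx i)) (hV.mono hs) ((h.mono hs hH').do hM hM' ha))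
    refine and_congr (forall₂_congr fun i _ => h.mem_adom_iff hM hM' (hx i)) ⟨?_, ?_⟩
    · rintro ⟨a, ha⟩
      obtain ⟨H', hs, hH', a', haa'⟩ := ActRel.extend (M' := M') hM.2.1 h.pbij a
      exact ⟨a', (key H' hs hH' a a' haa').1 ha⟩
    · rintro ⟨a', ha⟩
      obtain ⟨H', hs, hH', a, haa'⟩ := ActRel.extend_right (M := M) hM'.2.1 h.pbij a'
      exact ⟨a, (key H' hs hH' a a' haa').2 ha⟩
  | box X Φ ih =>
    intro hΦ H x x' V V' hx hV s s' h
    have key : ∀ H', H ⊆ H' → PBij H' → ∀ a a', ActRel M M' H' a a' →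
        ((M.Poss a s → M.doA a s ∈ Φ.aext M D.consts K x V) ↔
          (M'.Poss a' s' → M'.doA a' s' ∈ Φ.aext M' D.consts K x' V')) :=
      fun H' hs hH' a a' ha => imp_congr ((h.mono hs hH').poss_iff hM hM' ha)
        (ih hΦ (fun i => hs (hx i)) (hV.mono hs) ((h.mono hs hH').do hM hM' ha))
    refine and_congr (forall₂_congr fun i _ => h.mem_adom_iff hM hM' (hx i)) ⟨?_, ?_⟩
    · intro ha a'
      obtain ⟨H', hs, hH', a, haa'⟩ := ActRel.extend_right (M := M) hM'.2.1 h.pbij a'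
      exact (key H' hs hH' a a' haa').1 (ha a)
    · intro ha a
      obtain ⟨H', hs, hH', a', haa'⟩ := ActRel.extend (M' := M') hM.2.1 h.pbij a
      exact (key H' hs hH' a a' haa').2 (ha a')
  | pvar Z => exact fun _ H x x' V V' _ hV s s' h => hV Z H s s' subset_rfl h
  | mu Φ ih =>
    intro hΦ H x x' V V' hx hV s s' h
    -- Every approximant must be invariant under all larger bijections, since it becomes the value
    -- of a predicate variable that may be used after further extensions.
    have key : ∀ i : ℕ, ∀ H' s s', H ⊆ H' → Corr D M M' H' s s' →
        (s ∈ (fun E => Φ.aext M D.consts K x (Fin.cons E V))^[i] ∅ ↔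
          s' ∈ (fun E => Φ.aext M' D.consts K x' (Fin.cons E V'))^[i] ∅) := by
      intro i
      induction i with
      | zero => intro H' s s' _ _; simp
      | succ i ihi =>
        intro H' s s' hs h'
        rw [Function.iterate_succ_apply', Function.iterate_succ_apply']
        exact ih hΦ (fun i => hs (hx i))
          ((hV.mono hs).cons fun H₁ s s' h₁ => ihi H₁ s s' (hs.trans h₁)) h'
    exact key K H s s' subset_rfl h

/-- The approximants of a fixpoint do not distinguish corresponding situations. -/
theorem MuForm.mem_iterate_aext_iff {D : BAT σ} {M : Structure.{u} σ} {M' : Structure.{v} σ}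
    (hM : D.DynModel M) (hM' : D.DynModel M') (K : ℕ) {n k : ℕ} (Φ : MuForm σ n (k + 1))
    (hΦ : Φ.consts ⊆ D.consts) {H : Set (M.Obj × M'.Obj)} {x : Fin n → M.Obj}
    {x' : Fin n → M'.Obj} {V : Fin k → Set M.Sit} {V' : Fin k → Set M'.Sit}
    (hx : ∀ i, (x i, x' i) ∈ H) (hV : PredRel D M M' H V V') (i : ℕ) :
    ∀ H' s s', H ⊆ H' → Corr D M M' H' s s' →
      (s ∈ (fun E => Φ.aext M D.consts K x (Fin.cons E V : Fin (k + 1) → Set M.Sit))^[i] ∅ ↔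
        s' ∈ (fun E => Φ.aext M' D.consts K x' (Fin.cons E V' : Fin (k + 1) → Set M'.Sit))^[i] ∅) := by
  induction i with
  | zero => intro H' s s' _ _; simp
  | succ i ih =>
    intro H' s s' hs h
    rw [Function.iterate_succ_apply', Function.iterate_succ_apply']
    exact Φ.mem_aext_iff hM hM' K hΦ (fun i => hs (hx i))
      ((hV.mono hs).cons fun H₁ s s' h₁ => ih H₁ s s' (hs.trans h₁)) h


end SitCalc

namespace SitCalc

variable {σ : Signature}

/-! ### Executable situations -/

namespace Structure

variable {M : Structure.{u} σ}

theorem Foundational.executable_init (h : M.Foundational) : M.Executable M.S₀ := by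
  intro a s hs
  rcases hs with hs | hs
  · exact absurd hs (h.2.2.1 _)
  · exact absurd (hs ▸ (h.2.2.2 a s s).2 (Or.inr rfl)) (h.2.2.1 s)

/-- Executable situations are closed under possible actions, so evaluation that starts in one never
leaves the region where boundedness applies. -/
theorem Foundational.executable_do (h : M.Foundational) {a : M.Act} {s : M.Sit}
    (hs : M.Executable s) (ha : M.Poss a s) : M.Executable (M.doA a s) := by
  intro a' s' h'
  rw [h.2.2.2] at h'
  rcases h' with h' | h'
  · exact hs a' s' h'
  · obtain ⟨rfl, rfl⟩ := h.1 _ _ _ _ h'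
    exact ha

/-- An enumeration of length `b`, with repetitions allowed, is a uniform way to list fewer than `b`
tuples: all situations then share one index set. -/
theorem BoundedSit.exists_enum [Nonempty M.Obj] {b : ℕ} {s : M.Sit} (h : M.BoundedSit b s)
    (F : σ.Fl) : ∃ g : Fin b → Fin (σ.arF F) → M.Obj, ∀ x, M.fluent F x s → ∃ k, g k = x := by
  have hF := h F
  by_contra hcon
  push Not at hcon
  refine hF ?_
  -- an enumeration of length `k ≤ b` that misses no tuple cannot exist, so an injection can be built
  have key : ∀ k ≤ b, ∃ x : Fin k → (Fin (σ.arF F) → M.Obj),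
      Function.Injective x ∧ ∀ i, M.fluent F (x i) s := by
    intro k
    induction k with
    | zero => exact fun _ => ⟨Fin.elim0, fun i => i.elim0, fun i => i.elim0⟩
    | succ k ih =>
      intro hk
      obtain ⟨x, hx, hxF⟩ := ih (by omega)
      have hne : Nonempty (Fin (σ.arF F) → M.Obj) := inferInstance
      obtain ⟨y, hy, hyx⟩ := hcon fun j => if hj : j.1 < k then x ⟨j, hj⟩ else hne.some
      refine ⟨Fin.cons y x, Fin.cons_injective_iff.2 ⟨?_, hx⟩, fun i => Fin.cases hy hxF i⟩
      rintro ⟨j, rfl⟩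
      exact hyx ⟨j, by omega⟩ (by simp)
  exact key b le_rfl

end Structure

/-! ### Finitely many isomorphism types of bounded situations -/

/-- The index set of an enumeration of `n` given objects, of the denotations of the constants of the
theory and of the objects in the extensions of the fluents of a situation bounded by `b`. -/
abbrev EnumIdx (D : BAT σ) (b n : ℕ) : Type :=
  Fin n ⊕ D.consts ⊕ (Σ F : σ.Fl, Fin b × Fin (σ.arF F))

/-- Isomorphism types of enumerated situations. -/
abbrev SitType (D : BAT σ) (b n : ℕ) : Type :=
  (EnumIdx D b n → EnumIdx D b n → Prop) ×
    ((F : σ.Fl) → (Fin (σ.arF F) → EnumIdx D b n) → Prop)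

instance (D : BAT σ) (b n : ℕ) : Finite (SitType D b n) := inferInstance

/-- A bounded situation is described up to isomorphism by the equality pattern of an enumeration of
its relevant objects and by the fluents on that enumeration. Matching the two enumerations index by
index is the required correspondence; it fixes the parameters `x` because they occupy the same
indices in both. -/
theorem exists_sitType {D : BAT σ} {M : Structure.{u} σ} (hM : D.DynModel M) {b n : ℕ}
    (hb : M.Bounded b) (x : Fin n → M.Obj) :
    ∃ τ : M.Sit → SitType D b n, ∀ s s', M.Executable s → M.Executable s' → τ s = τ s' →
      ∃ H, (∀ i, (x i, x i) ∈ H) ∧ Corr D M M H s s' := by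
  have := hM.2.2.1.infinite
  have henum : ∀ s, ∃ g : (F : σ.Fl) → Fin b → Fin (σ.arF F) → M.Obj,
      M.Executable s → ∀ F x, M.fluent F x s → ∃ k, g F k = x := fun s => by
    by_cases hs : M.Executable s
    -- Only executable situations are bounded; elsewhere the enumeration is a dummy and the type
    -- carries no promise.
    · choose g hg using fun F => (hb s hs).exists_enum F
      exact ⟨g, fun _ => hg⟩
    · exact ⟨fun _ _ _ => M.const 0, fun h => absurd h hs⟩
  choose g hg using henum
  let e : M.Sit → EnumIdx D b n → M.Obj := fun s =>
    Sum.elim x (Sum.elim (fun c => M.const c) fun p => g s p.1 p.2.1 p.2.2)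
  let τ : M.Sit → SitType D b n := fun s =>
    ⟨fun i j => e s i = e s j, fun F (p : Fin (σ.arF F) → EnumIdx D b n) =>
      M.fluent F (fun i => e s (p i)) s⟩
  refine ⟨τ, fun s s' hs hs' hτ => ⟨Set.range fun j => (e s j, e s' j), fun i => ⟨Sum.inl i, rfl⟩, ?_⟩⟩
  obtain ⟨h₁, h₂⟩ := Prod.ext_iff.1 hτ
  have h₁' : ∀ i j, e s i = e s j ↔ e s' i = e s' j := fun i j =>
    iff_of_eq (congrFun (congrFun h₁ i) j)
  have h₂' : ∀ (F : σ.Fl) (p : Fin (σ.arF F) → EnumIdx D b n), M.fluent F (fun i => e s (p i)) s ↔ M.fluent F (fun i => e s' (p i)) s' :=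
    fun F p => iff_of_eq (congrFun (congrFun h₂ F) p)
  refine ⟨⟨Set.finite_range _, ?_⟩, fun c hc => ⟨Sum.inr (Sum.inl ⟨c, hc⟩), rfl⟩, ?_⟩
  · rintro _ ⟨i, rfl⟩ _ ⟨j, rfl⟩
    exact h₁' i j
  · intro H' hsub hH' F y y' hy
    constructor
    · intro hF
      obtain ⟨k, rfl⟩ := hg s hs F y hF
      have hy' : y' = fun i => e s' (Sum.inr (Sum.inr ⟨F, k, i⟩)) := funext fun i =>
        (hH'.eq_iff (hy i) (hsub ⟨Sum.inr (Sum.inr ⟨F, k, i⟩), rfl⟩)).1 rfl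
      rw [hy']
      exact (h₂' F fun i => Sum.inr (Sum.inr ⟨F, k, i⟩)).1 hF
    · intro hF
      obtain ⟨k, rfl⟩ := hg s' hs' F y' hF
      have hy' : y = fun i => e s (Sum.inr (Sum.inr ⟨F, k, i⟩)) := funext fun i =>
        (hH'.eq_iff (hy i) (hsub ⟨Sum.inr (Sum.inr ⟨F, k, i⟩), rfl⟩)).2 rfl
      rw [hy']
      exact (h₂' F fun i => Sum.inr (Sum.inr ⟨F, k, i⟩)).2 hF

/-- An increasing chain of sets that are saturated for a map to a finite type is stationary at some
step, on the set `X`. -/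
theorem exists_chain_stationary {S T : Type*} [Finite T] {K : ℕ} (hK : Nat.card T ≤ K)
    (X : Set S) (τ : S → T) (A : ℕ → Set S) (hA : Monotone A)
    (hsat : ∀ i, ∀ s ∈ X, ∀ s' ∈ X, τ s = τ s' → s ∈ A i → s' ∈ A i) :
    ∃ i ≤ K, ∀ s ∈ X, s ∈ A (i + 1) → s ∈ A i := by
  by_contra hcon
  push Not at hcon
  choose f hfX hf hf' using hcon
  -- If the chain grew at every step up to `K`, the elements `f i` that enter at stage `i + 1` would
  -- have `K + 1` different types: an equal type at a later stage would have entered already.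
  have hlt : ∀ i j (hi : i ≤ K) (hj : j ≤ K), i < j → τ (f i hi) ≠ τ (f j hj) := fun i j hi hj hij e =>
    hf' j hj (hsat j _ (hfX i hi) _ (hfX j hj) e (hA hij (hf i hi)))
  have hinj : Function.Injective fun i : Fin (K + 1) => τ (f i (Nat.lt_succ_iff.1 i.2)) := by
    intro i j e
    rcases lt_trichotomy i j with h | h | h
    · exact absurd e (hlt _ _ _ _ h)
    · exact h
    · exact absurd e.symm (hlt _ _ _ _ h)
  have := Nat.card_le_card_of_injective _ hinj
  simp at this
  omega

/-! ### Fixpoints and their approximants -/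

/-- Monotonicity in a predicate variable all of whose occurrences have the same polarity. -/
theorem MuForm.ext_mono {M : Structure.{u} σ} {C : Finset ℕ} {n k : ℕ} (Φ : MuForm σ n k) :
    ∀ {Z : Fin k} {p : Bool} {x : Fin n → M.Obj} {V V' : Fin k → Set M.Sit}, Φ.EvenNeg Z p →
      (∀ Y, Y ≠ Z → V Y = V' Y) → (p = true → V Z ⊆ V' Z) → (p = false → V' Z ⊆ V Z) →
      Φ.ext M C x V ⊆ Φ.ext M C x V' := by
  induction Φ with
  | fo φ => exact fun _ _ _ _ => subset_rfl
  | neg Φ ih =>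
    intro Z p x V V' h hV h₁ h₂
    exact Set.compl_subset_compl.2 (ih h (fun Y hY => (hV Y hY).symm)
      (fun hp => h₂ (by simpa using hp)) fun hp => h₁ (by simpa using hp))
  | and Φ Ψ ih₁ ih₂ =>
    exact fun h hV h₁ h₂ => Set.inter_subset_inter (ih₁ h.1 hV h₁ h₂) (ih₂ h.2 hV h₁ h₂)
  | exLive Φ ih =>
    rintro Z p x V V' h hV h₁ h₂ s ⟨d, hd, hs⟩
    exact ⟨d, hd, ih h hV h₁ h₂ hs⟩
  | dia X Φ ih =>
    rintro Z p x V V' h hV h₁ h₂ s ⟨hX, a, ha, hs⟩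
    exact ⟨hX, a, ha, ih h hV h₁ h₂ hs⟩
  | box X Φ ih =>
    rintro Z p x V V' h hV h₁ h₂ s ⟨hX, hs⟩
    exact ⟨hX, fun a ha => ih h hV h₁ h₂ (hs a ha)⟩
  | pvar Y =>
    intro Z p x V V' h hV h₁ h₂
    change V Y ⊆ V' Y
    by_cases hY : Y = Z
    · subst hY
      exact h₁ (h rfl)
    · rw [hV Y hY]
  | mu Φ ih =>
    intro Z p x V V' h hV h₁ h₂
    refine Set.sInter_subset_sInter fun E hE => le_trans (b := Φ.ext M C x (Fin.cons E V')) ?_ hE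
    exact ih (Z := Z.succ) h (fun Y => Fin.cases (fun _ => rfl)
      (fun Y hY => hV Y fun e => hY (e ▸ rfl)) Y) h₁ h₂

/-- In executable situations of a bounded model, a least fixpoint is its `K`-th approximant for all
large enough `K`. -/
theorem MuForm.mem_ext_iff {D : BAT σ} {M : Structure.{u} σ} (hM : D.DynModel M) {b : ℕ}
    (hb : M.Bounded b) {K W : ℕ} (hK : ∀ n ≤ W, Nat.card (SitType D b n) ≤ K) {n k : ℕ}
    (Φ : MuForm σ n k) : ∀ {ρ}, Φ.WF ρ → Φ.consts ⊆ D.consts → n + Φ.code ≤ W →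
    ∀ {x : Fin n → M.Obj} {V V' : Fin k → Set M.Sit},
      (∀ Z s, M.Executable s → (s ∈ V Z ↔ s ∈ V' Z)) →
      (∀ H, (∀ i, (x i, x i) ∈ H) → PredRel D M M H V' V') →
      ∀ s, M.Executable s → (s ∈ Φ.ext M D.consts x V ↔ s ∈ Φ.aext M D.consts K x V') := by
  induction Φ with
  | fo φ => exact fun _ _ _ _ _ _ _ _ _ _ => Iff.rfl
  | neg Φ ih =>
    intro ρ hwf hc hW x V V' hV hV' s hs
    exact not_congr (ih hwf hc (by have := Nat.add_le_pair 1 Φ.code; simp only [code] at hW; omega)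
      hV hV' s hs)
  | and Φ Ψ ih₁ ih₂ =>
    intro ρ hwf hc hW x V V' hV hV' s hs
    have h₁ := Nat.add_le_pair 2 (Nat.pair Φ.code Ψ.code)
    have h₂ := Nat.add_le_pair Φ.code Ψ.code
    simp only [code] at hW
    exact and_congr (ih₁ hwf.1 (Finset.union_subset_left hc) (by omega) hV hV' s hs)
      (ih₂ hwf.2 (Finset.union_subset_right hc) (by omega) hV hV' s hs)
  -- The invariant `n + Φ.code ≤ W` survives the new variable because `Nat.pair 3 Φ.code` exceeds
  -- `Φ.code` by at least 3. Hence no subformula has more than `W` variables in scope.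
  | exLive Φ ih =>
    intro ρ hwf hc hW x V V' hV hV' s hs
    have h₁ := Nat.add_le_pair 3 Φ.code
    simp only [code] at hW
    refine exists_congr fun d => and_congr_right fun _ => ih hwf hc (by omega) hV ?_ s hs
    exact fun H hH => hV' H fun i => by simpa using hH i.succ
  | dia X Φ ih =>
    intro ρ hwf hc hW x V V' hV hV' s hs
    have h₁ := Nat.add_le_pair 4 (Nat.pair (Encodable.encode (X.map Fin.val)) Φ.code)
    have h₂ := Nat.add_le_pair (Encodable.encode (X.map Fin.val)) Φ.code
    simp only [code] at hW
    exact and_congr_right fun _ => exists_congr fun a => and_congr_right fun ha =>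
      ih hwf.2 hc (by omega) hV hV' _ (hM.1.executable_do hs ha)
  | box X Φ ih =>
    intro ρ hwf hc hW x V V' hV hV' s hs
    have h₁ := Nat.add_le_pair 5 (Nat.pair (Encodable.encode (X.map Fin.val)) Φ.code)
    have h₂ := Nat.add_le_pair (Encodable.encode (X.map Fin.val)) Φ.code
    simp only [code] at hW
    exact and_congr_right fun _ => forall₂_congr fun a ha =>
      ih hwf.2 hc (by omega) hV hV' _ (hM.1.executable_do hs ha)
  | pvar Z => exact fun _ _ _ _ _ _ hV _ s hs => hV Z s hs
  | mu Φ ih =>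
    rename_i n k
    intro ρ hwf hc hW x V V' hV hV' s hs
    have h₁ := Nat.add_le_pair 7 Φ.code
    simp only [code] at hW
    let T : Set M.Sit → Set M.Sit :=
      fun E => Φ.ext M D.consts x (Fin.cons E V : Fin (k + 1) → Set M.Sit)
    let T' : Set M.Sit → Set M.Sit :=
      fun E => Φ.aext M D.consts K x (Fin.cons E V' : Fin (k + 1) → Set M.Sit)
    have hT : Monotone T := fun E E' hE => Φ.ext_mono hwf.1
      (fun Y => Fin.cases (fun h => absurd rfl h) (fun _ _ => rfl) Y) (fun _ => hE) (by simp)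
    have hinv : ∀ i H s s', (∀ i, (x i, x i) ∈ H) → Corr D M M H s s' →
        (s ∈ T'^[i] ∅ ↔ s' ∈ T'^[i] ∅) := fun i H s s' hx h =>
      Φ.mem_iterate_aext_iff hM hM K hc hx (hV' H hx) i H s s' subset_rfl h
    -- Only the executable part of `E` matters at executable situations, since the modalities move
    -- along possible actions.
    have hstep : ∀ i (E : Set M.Sit), (∀ s, M.Executable s → (s ∈ E ↔ s ∈ T'^[i] ∅)) →
        ∀ s, M.Executable s → (s ∈ T E ↔ s ∈ T'^[i + 1] ∅) := by
      intro i E hE s hs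
      rw [Function.iterate_succ_apply']
      exact ih hwf.2 hc (by omega) (fun Z => Fin.cases hE hV Z) (fun H hx =>
        (hV' H hx).cons fun H₁ s s' hs h' => hinv i H₁ s s' (fun i => hs (hx i)) h') s hs
    have hagree : ∀ i s, M.Executable s → (s ∈ T^[i] ∅ ↔ s ∈ T'^[i] ∅) := by
      intro i
      induction i with
      | zero => intro s _; simp
      | succ i ihi =>
        rw [Function.iterate_succ_apply' T]
        exact hstep i _ ihi
    have hmono : Monotone fun i => T^[i] ∅ := monotone_nat_of_le_succ fun i => by
      induction i with
      | zero => simp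
      | succ i ihi =>
        rw [Function.iterate_succ_apply', Function.iterate_succ_apply' T (i + 1)]
        exact hT ihi
    change s ∈ ⋂₀ {E | T E ⊆ E} ↔ s ∈ T'^[K] ∅
    rw [← hagree K s hs]
    constructor
    · obtain ⟨τ, hτ⟩ := exists_sitType hM hb x
      obtain ⟨i, hiK, hi⟩ := exists_chain_stationary (hK n (by omega)) {s | M.Executable s} τ
        (fun i => T^[i] ∅) hmono (fun i s hs s' hs' e h => by
          obtain ⟨H, hx, hH⟩ := hτ s s' hs hs' e
          exact (hagree i s' hs').2 ((hinv i H s s' hx hH).1 ((hagree i s hs).1 h)))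
      intro h
      refine hmono hiK (?_ : s ∈ T^[i] ∅)
      -- The least fixpoint is taken over all situations, but types control only the executable
      -- ones. Adding all the other situations to the stationary iterate makes it a genuine prefixed
      -- point.
      have hE := h (T^[i] ∅ ∪ {s | ¬ M.Executable s}) fun t ht => by
        by_cases htX : M.Executable t
        · refine Or.inl (hi t htX ((hagree (i + 1) t htX).2 ((hstep i _ ?_ t htX).1 ht)))
          intro s hs
          rw [← hagree i s hs]
          simp [hs]
        · exact Or.inr htX
      exact hE.resolve_right (not_not.2 hs)
    · intro h E hE
      have : ∀ i, T^[i] ∅ ⊆ E := fun i => by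
        induction i with
        | zero => simp
        | succ i ihi =>
          rw [Function.iterate_succ_apply']
          exact (hT ihi).trans hE
      exact this K h

/-- A bound for the number of isomorphism types. -/
def typeBound (W : ℕ) : ℕ :=
  2 ^ ((W * W * W + W + W + 1) * (W * W * W + W + W + 1) + W * (W * W * W + W + W + 1) ^ W)

/-- At most `W` parameters, `W` constants and `W * W * W` positions in fluents can be indices; types
are a binary relation on the indices and, for each fluent, a set of index tuples. -/
theorem card_sitType_le (D : BAT σ) {W b n : ℕ} (hb : b ≤ W) (hn : n ≤ W)
    (hC : ∀ c ∈ D.consts, c < W) (hF : σ.fluents.length ≤ W) (ha : ∀ F, σ.arF F ≤ W) :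
    Nat.card (SitType D b n) ≤ typeBound W := by
  classical
  have hJ : Nat.card (EnumIdx D b n) ≤ W * W * W + W + W + 1 := by
    rw [Nat.card_eq_fintype_card]
    simp only [EnumIdx, Fintype.card_sum, Fintype.card_fin, Fintype.card_coe, Fintype.card_sigma,
      Fintype.card_prod]
    have h1 : D.consts.card ≤ W := by
      simpa using Finset.card_le_card (fun c hc => Finset.mem_range.2 (hC c hc) :
        D.consts ⊆ Finset.range W)
    have h2 : ∑ F : σ.Fl, b * σ.arF F ≤ W * W * W := by
      calc ∑ F : σ.Fl, b * σ.arF F ≤ ∑ _F : σ.Fl, W * W :=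
            Finset.sum_le_sum fun F _ => Nat.mul_le_mul hb (ha F)
        _ = σ.fluents.length * (W * W) := by simp
        _ ≤ W * (W * W) := Nat.mul_le_mul_right _ hF
        _ = W * W * W := by ring
    omega
  unfold typeBound
  -- The extra 1 in the bound makes the base positive, so that its powers are monotone in the
  -- exponent.
  have hj : 1 ≤ W * W * W + W + W + 1 := by omega
  generalize W * W * W + W + W + 1 = j at hJ hj
  have hP : Nat.card Prop = 2 := by simp
  rw [Nat.card_prod, pow_add]
  refine Nat.mul_le_mul ?_ ?_
  · rw [Nat.card_fun, Nat.card_fun, hP, ← pow_mul]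
    exact Nat.pow_le_pow_right (by norm_num) (Nat.mul_le_mul hJ hJ)
  · rw [Nat.card_pi]
    calc ∏ F : σ.Fl, Nat.card ((Fin (σ.arF F) → EnumIdx D b n) → Prop)
        ≤ ∏ _F : σ.Fl, 2 ^ j ^ W := Finset.prod_le_prod' fun F _ => by
          rw [Nat.card_fun, Nat.card_fun, hP, Nat.card_eq_fintype_card (α := Fin _), Fintype.card_fin]
          exact Nat.pow_le_pow_right (by norm_num)
            ((Nat.pow_le_pow_left hJ _).trans (Nat.pow_le_pow_right hj (ha F)))
      _ = 2 ^ (σ.fluents.length * j ^ W) := by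
          rw [Finset.prod_const, Finset.card_univ, Fintype.card_fin, ← pow_mul, mul_comm]
      _ ≤ 2 ^ (W * j ^ W) := Nat.pow_le_pow_right (by norm_num) (Nat.mul_le_mul_right _ hF)


end SitCalc

namespace SitCalc

variable {σ : Signature}

/-! ### The canonical model over a database -/

/-- The object that a constant denotes in a database. -/
def DB.value (I : DB) (c : ℕ) : ℕ := (I.2.lookup c).getD 0

/-- The constants of the theory denote different objects of the database. -/
def InjConsts (D : BAT σ) (I : DB) : Prop :=
  ∀ c ∈ D.consts, ∀ c' ∈ D.consts, I.value c = I.value c' → c = c'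

open Classical in
/-- The denotations of the constants in the canonical model: the constants outside of the theory
denote fresh objects. -/
noncomputable def canonConst (D : BAT σ) (I : DB) (c : ℕ) : ℕ :=
  if c ∈ D.consts then I.value c else ∑ c' ∈ D.consts, I.value c' + 1 + c

theorem canonConst_of_mem {D : BAT σ} {I : DB} {c : ℕ} (hc : c ∈ D.consts) :
    canonConst D I c = I.value c := if_pos hc

/-- Constants outside the theory lie strictly above the sum of all values of constants of the
theory. They may coincide with other objects of the database, which is harmless because they do not
count for the active domain. -/
theorem canonConst_injective {D : BAT σ} {I : DB} (h : InjConsts D I) :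
    Function.Injective (canonConst D I) := by
  have key : ∀ c ∈ D.consts, ∀ c', c' ∉ D.consts → canonConst D I c < canonConst D I c' := by
    intro c hc c' hc'
    rw [canonConst, canonConst, if_pos hc, if_neg hc']
    have : I.value c ≤ ∑ c' ∈ D.consts, I.value c' :=
      Finset.single_le_sum (f := fun c' => I.value c')
        (fun _ _ => Nat.zero_le _) hc
    exact Nat.lt_of_le_of_lt this (by omega)
  intro c c' e
  by_cases hc : c ∈ D.consts <;> by_cases hc' : c' ∈ D.consts
  · rw [canonConst_of_mem hc, canonConst_of_mem hc'] at e
    exact h c hc c' hc' e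
  · exact absurd e (key c hc c' hc').ne
  · exact absurd e (key c' hc' c hc).ne'
  · rw [canonConst, canonConst, if_neg hc, if_neg hc'] at e
    omega

/-- The actions of the canonical model. -/
abbrev CanonAct (σ : Signature) : Type u := Σ A : σ.Ac, (Fin (σ.arA A) → ULift.{u} ℕ)

/-- The structure with a single situation in which the fluents are given by `P`. -/
@[reducible] def staticStructure (κ : ℕ → ℕ) (P : (F : σ.Fl) → (Fin (σ.arF F) → ULift.{u} ℕ) → Prop) :
    Structure.{u} σ where
  Obj := ULift.{u} ℕ
  Act := CanonAct.{u} σ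
  Sit := PUnit
  const c := ⟨κ c⟩
  act A x := ⟨A, x⟩
  S₀ := ⟨⟩
  doA _ s := s
  lt _ _ := False
  Poss _ _ := False
  fluent F x _ := P F x

/-- The fluents of the canonical model after a sequence of actions. -/
def canonFluent (D : BAT σ) (I : DB) :
    List (CanonAct.{u} σ) → (F : σ.Fl) → (Fin (σ.arF F) → ULift.{u} ℕ) → Prop
  | [], F, x => (I.interp σ).fluent F fun i => (x i).down
  -- A uniform formula needs only the fluents at the previous situation, so evaluating it in a
  -- one-situation structure avoids a circular definition of the model.
  | a :: s, F, x => (D.ssa F).Holds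
      (staticStructure (canonConst D I) (canonFluent D I s)) ⟨⟩ x fun _ => a

/-- The model of the dynamic axioms over a database, in which the situations are the finite
sequences of actions. -/
@[reducible] noncomputable def canon (D : BAT σ) (I : DB) : Structure.{u} σ where
  Obj := ULift.{u} ℕ
  Act := CanonAct.{u} σ
  Sit := List (CanonAct.{u} σ)
  const c := ⟨canonConst D I c⟩
  act A x := ⟨A, x⟩
  S₀ := []
  doA a s := a :: s
  lt s s' := s ≠ s' ∧ s <:+ s'
  Poss a s := (D.pre a.1).Holds
      (staticStructure (canonConst D I) (canonFluent D I s)) ⟨⟩ a.2 Fin.elim0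
  fluent F x s := canonFluent D I s F x

theorem ATerm.eval_canon (D : BAT σ) (I : DB) (P) {n m : ℕ} (t : ATerm σ n m)
    (x : Fin n → ULift.{u} ℕ) (y : Fin m → CanonAct.{u} σ) :
    t.eval (canon D I) x y = t.eval (staticStructure (canonConst D I) P) x y := by
  cases t <;> rfl

theorem FOForm.holds_canon (D : BAT σ) (I : DB) (s : List (CanonAct.{u} σ)) {n m : ℕ}
    (φ : FOForm σ n m) : ∀ (x : Fin n → ULift.{u} ℕ) (y : Fin m → CanonAct.{u} σ),
    φ.Holds (canon D I) s x y ↔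
      φ.Holds (staticStructure (canonConst D I) (canonFluent D I s)) ⟨⟩ x y := by
  induction φ with
  | fluent F args => exact fun x y => Iff.rfl
  | eqO t₁ t₂ => exact fun x y => Iff.rfl
  | eqA a₁ a₂ =>
    intro x y
    simp only [Holds, ATerm.eval_canon D I (canonFluent D I s)]
  | neg φ ih => exact fun x y => not_congr (ih x y)
  | and φ ψ ih₁ ih₂ => exact fun x y => and_congr (ih₁ x y) (ih₂ x y)
  | exO φ ih => exact fun x y => exists_congr fun d => ih _ y
  | exA φ ih => exact fun x y => exists_congr fun d => ih x _

/-- Sequences of actions are the free situations: induction on lists gives the induction axiom, and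
precedence is being a proper suffix. The axioms on preconditions and successor states hold by
construction once `FOForm.holds_canon` removes the auxiliary static structure. -/
theorem canon_dynModel {D : BAT σ} {I : DB} (h : InjConsts D I) :
    D.DynModel (canon.{u} D I) := by
  refine ⟨⟨?_, ?_, ?_, ?_⟩, ⟨?_, ?_, ?_⟩, ?_, ?_, ?_⟩
  · intro a₁ a₂ s₁ s₂ e
    exact List.cons_eq_cons.1 e
  · intro P h0 hs s
    induction s with
    | nil => exact h0
    | cons a s ih => exact hs a s ih
  · rintro s ⟨hne, hs⟩
    exact hne (List.suffix_nil.1 hs)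
  · intro a s s'
    change (s ≠ a :: s' ∧ s <:+ a :: s') ↔ (s ≠ s' ∧ s <:+ s') ∨ s = s'
    rw [List.suffix_cons_iff]
    have : s <:+ s' → s ≠ a :: s' := by
      rintro hs rfl
      have := hs.length_le
      simp at this
    have h' : s = s' → s <:+ s' := fun e => e ▸ List.suffix_rfl
    tauto
  · rintro A x y e
    exact eq_of_heq (Sigma.mk.inj e).2
  · rintro A B x y hAB e
    exact hAB (Sigma.mk.inj e).1
  · rintro ⟨A, x⟩
    exact ⟨A, x, rfl⟩
  · intro c d hcd e
    exact hcd (canonConst_injective h (ULift.up.inj e))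
  · exact fun A x s => (FOForm.holds_canon D I s (D.pre A) x Fin.elim0).symm
  · exact fun F x a s => (FOForm.holds_canon D I s (D.ssa F) x fun _ => a).symm

/-! ### Isomorphisms of active domains -/

theorem ActiveIso.symm {C : Finset ℕ} {I : Interp.{u} σ} {J : Interp.{v} σ} (h : ActiveIso C I J) :
    ActiveIso C J I := by
  obtain ⟨e, he, hc⟩ := h
  refine ⟨e.symm, fun F x => ?_, fun c hcC => ?_⟩
  · rw [he]
    simp
  · have : (⟨J.const c, Or.inr ⟨c, hcC, rfl⟩⟩ : J.adom C) = e ⟨I.const c, Or.inr ⟨c, hcC, rfl⟩⟩ :=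
      Subtype.ext (hc c hcC).symm
    rw [this, Equiv.symm_apply_apply]

theorem ActiveIso.trans {C : Finset ℕ} {I : Interp.{u} σ} {J : Interp.{v} σ} {L : Interp σ}
    (h : ActiveIso C I J) (h' : ActiveIso C J L) : ActiveIso C I L := by
  obtain ⟨e, he, hc⟩ := h
  obtain ⟨e', he', hc'⟩ := h'
  refine ⟨e.trans e', fun F x => ?_, fun c hcC => ?_⟩
  · rw [he, he']
    simp
  · rw [Equiv.trans_apply, ← hc' c hcC]
    congr 2
    exact Subtype.ext (hc c hcC)

theorem canon_inClass (D : BAT σ) (I : DB) : D.InClass I (canon.{u} D I) := by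
  have hmem : ∀ d : ULift.{u} ℕ, d ∈ ((canon.{u} D I).interp []).adom D.consts ↔
      d.down ∈ (I.interp σ).adom D.consts := by
    intro d
    refine or_congr ⟨?_, ?_⟩ (exists_congr fun c => and_congr_right fun hc => ?_)
    · rintro ⟨F, x, hx, i, rfl⟩
      exact ⟨F, _, hx, i, rfl⟩
    · rintro ⟨F, x, hx, i, hd⟩
      exact ⟨F, fun i => ⟨x i⟩, hx, i, ULift.ext _ _ hd⟩
    · change (⟨canonConst D I c⟩ : ULift.{u} ℕ) = d ↔ I.value c = d.down
      rw [← canonConst_of_mem hc]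
      exact ⟨fun e => congrArg ULift.down e, fun e => ULift.ext _ _ e⟩
  exact ⟨Equiv.subtypeEquiv Equiv.ulift hmem, fun F x => Iff.rfl,
    fun c hc => canonConst_of_mem hc⟩

/-- Unique names force a realised database to separate the constants of the theory. The canonical
model shows that this condition is also sufficient. -/
theorem BAT.ModelDB.injConsts {D : BAT σ} {I : DB} {M : Structure.{u} σ} (h : D.ModelDB I M) :
    InjConsts D I := by
  intro c hc c' hc' e
  obtain ⟨f, -, hf⟩ := h.2
  change (I.interp σ).const c = (I.interp σ).const c' at e
  rw [← hf c hc, ← hf c' hc', Subtype.coe_inj, f.injective.eq_iff] at e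
  by_contra hne
  exact h.1.2.2.1 c c' hne (congrArg Subtype.val e)

/-! ### Sizes of codes -/

theorem encode_le_of_mem {α : Type*} [Encodable α] {a : α} : ∀ {l : List α}, a ∈ l →
    Encodable.encode a ≤ Encodable.encode l
  | b :: l, h => by
    rw [Encodable.encode_list_cons]
    rcases List.mem_cons.1 h with rfl | h
    · exact (Nat.left_le_pair _ _).trans (Nat.le_succ _)
    · exact (encode_le_of_mem h).trans ((Nat.right_le_pair _ _).trans (Nat.le_succ _))

theorem fst_le_encode {α β : Type*} [Encodable α] [Encodable β] (p : α × β) :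
    Encodable.encode p.1 ≤ Encodable.encode p := Nat.left_le_pair _ _

theorem snd_le_encode {α β : Type*} [Encodable α] [Encodable β] (p : α × β) :
    Encodable.encode p.2 ≤ Encodable.encode p := Nat.right_le_pair _ _

theorem mem_of_getD_mem {α : Type*} {l : List (List α)} {i : ℕ} {a : α} (h : a ∈ l.getD i []) :
    ∃ l' ∈ l, a ∈ l' := by
  by_cases hi : i < l.length
  · rw [List.getD_eq_getElem _ _ hi] at h
    exact ⟨_, List.getElem_mem hi, h⟩
  · rw [List.getD_eq_default _ _ (not_lt.1 hi)] at h
    simp at h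

theorem mem_of_lookup_eq_some {α β : Type*} [BEq α] [LawfulBEq α] {a : α} {b : β} :
    ∀ {l : List (α × β)}, l.lookup a = some b → (a, b) ∈ l
  | (a', b') :: l, h => by
    rw [List.lookup_cons] at h
    cases e : a == a' <;> rw [e] at h
    swap
    · obtain rfl := eq_of_beq e
      simp [Option.some.inj h]
    · exact List.mem_cons_of_mem _ (mem_of_lookup_eq_some h)

/-- All the objects that are mentioned in a database are smaller than `m`. -/
structure DB.Below (I : DB) (m : ℕ) : Prop where
  fluent : ∀ F, ∀ t ∈ I.1.getD F [], ∀ d ∈ t, d < m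
  value : ∀ c, I.value c < m

theorem DB.Below.mono {I : DB} {m m' : ℕ} (h : I.Below m) (hm : m ≤ m') : I.Below m' :=
  ⟨fun F t ht d hd => (h.fluent F t ht d hd).trans_le hm, fun c => (h.value c).trans_le hm⟩

/-- Codes of pairs and lists dominate the codes of their components, so the code of the database
plus one is a computable starting point for fresh objects. -/
theorem DB.below_encode (I : DB) : I.Below (Encodable.encode I + 1) where
  fluent F t h d hd := by
    obtain ⟨l, hl, hx⟩ := mem_of_getD_mem h
    have h2 := (encode_le_of_mem hx).trans (encode_le_of_mem hl)
    exact Nat.lt_succ_of_le ((encode_le_of_mem hd).trans (h2.trans (fst_le_encode I)))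
  value c := by
    unfold DB.value
    cases h : I.2.lookup c with
    | none => simp
    | some v =>
      have h2 := (snd_le_encode (c, v)).trans (encode_le_of_mem (mem_of_lookup_eq_some h))
      exact Nat.lt_succ_of_le (h2.trans (snd_le_encode I))

theorem DB.Below.interp_fluent {I : DB} {m : ℕ} (h : I.Below m) {F : σ.Fl} {x : Fin (σ.arF F) → ℕ}
    (hx : (I.interp σ).fluent F x) (i : Fin (σ.arF F)) : x i < m :=
  h.fluent F _ hx _ ((List.mem_ofFn' x (x i)).2 ⟨i, rfl⟩)

theorem DB.finite_adom (σ : Signature) (I : DB) (C : Finset ℕ) : ((I.interp σ).adom C).Finite := by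
  refine (Set.finite_Iio (Encodable.encode I + 1)).subset ?_
  rintro d (⟨F, x, hx, i, rfl⟩ | ⟨c, -, rfl⟩)
  · exact I.below_encode.interp_fluent hx i
  · exact I.below_encode.value c

/-- The models of a database correspond to the canonical model. -/
theorem BAT.InClass.exists_corr {D : BAT σ} {I : DB} {M : Structure.{u} σ} (h : D.InClass I M) :
    ∃ H, Corr D M (canon.{v} D I) H M.S₀ [] := by
  refine exists_corr_of_activeIso ?_ (ActiveIso.trans h (canon_inClass D I).symm)
  obtain ⟨e, -⟩ := h
  have := (I.finite_adom σ D.consts).to_subtype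
  exact Set.finite_coe_iff.1 (Finite.of_equiv _ e.symm)

/-! ### The canonical model and its finite parts -/

/-- The identity of the objects smaller than `m` in the canonical model. -/
def idBelow (m : ℕ) : Set (ULift.{u} ℕ × ULift.{u} ℕ) := {p | p.1 = p.2 ∧ p.1.down < m}

theorem pbij_idBelow (m : ℕ) : PBij (idBelow.{u} m) where
  finite := by
    refine ((Set.finite_Iio m).image fun d => ((⟨d⟩, ⟨d⟩) : ULift.{u} ℕ × ULift.{u} ℕ)).subset ?_
    rintro ⟨⟨d⟩, ⟨d'⟩⟩ ⟨h, hd⟩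
    obtain rfl : d = d' := congrArg ULift.down h
    exact ⟨d, hd, rfl⟩
  inj := by
    rintro p hp q hq
    rw [hp.1, hq.1]

theorem idBelow_mono {m m' : ℕ} (h : m ≤ m') : idBelow.{u} m ⊆ idBelow m' :=
  fun _ hp => ⟨hp.1, hp.2.trans_le h⟩

/-- All the parameters of the actions are smaller than `m`. -/
def HistBelow (s : List (CanonAct.{u} σ)) (m : ℕ) : Prop := ∀ a ∈ s, ∀ i, (a.2 i).down < m

theorem HistBelow.mono {s : List (CanonAct.{u} σ)} {m m' : ℕ} (h : HistBelow s m) (hm : m ≤ m') :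
    HistBelow s m' := fun a ha i => (h a ha i).trans_le hm

/-- Numbers from `m` on are interchangeable: they do not occur in the initial fluents, and actions
with parameters below `m` are related to themselves, so `Corr.do` propagates this along the whole
history. -/
theorem corr_idBelow {D : BAT σ} {I : DB} (hI : InjConsts D I) {m : ℕ} (hm : I.Below m) :
    ∀ s : List (CanonAct.{u} σ), HistBelow s m →
      Corr D (canon.{u} D I) (canon.{u} D I) (idBelow m) s s
  | [], _ => by
    refine ⟨pbij_idBelow m, fun c hc => ⟨rfl, ?_⟩, fun H' hs hH' F x x' hx => ?_⟩
    · change canonConst D I c < m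
      rw [canonConst_of_mem hc]
      exact hm.value c
    · constructor
      · intro h
        rwa [← show x = x' from funext fun i =>
          (hH'.eq_iff (hs ⟨rfl, hm.interp_fluent h i⟩) (hx i)).1 rfl]
      · intro h
        rwa [show x = x' from funext fun i =>
          ((hH'.eq_iff (hx i) (hs ⟨rfl, hm.interp_fluent h i⟩)).2 rfl)]
  | a :: s, h => by
    have ih := corr_idBelow hI hm s fun b hb => h b (List.mem_cons_of_mem _ hb)
    refine ih.do (canon_dynModel hI) (canon_dynModel hI) (a := a) (a' := a)
      ⟨a.1, a.2, a.2, rfl, rfl, fun i => ⟨rfl, h a List.mem_cons_self i⟩⟩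

/-- Tuples of objects can be replaced by tuples of small ones. -/
theorem exists_extend_below {X : Type*} {H : Set (X × ULift.{u} ℕ)} (hH : PBij H) {m : ℕ}
    (hm : ∀ p ∈ H, p.2.down < m) {k : ℕ} (d : Fin k → X) :
    ∃ H', H ⊆ H' ∧ PBij H' ∧ ∃ d' : Fin k → ULift.{u} ℕ, (∀ i, (d i, d' i) ∈ H') ∧
      ∀ i, (d' i).down < m + k := by
  -- At level `j` the values lie below `m + j`; the number `m + j` itself is then a fresh value for
  -- the next entry.
  obtain ⟨H', hs, hH', hb, d', hd⟩ := PBij.extend_tuple_of (X := X)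
    (B := fun j => {y : ULift.{u} ℕ | y.down < m + j})
    (fun j y hy => (show y.down < m + (j + 1) from Nat.lt_succ_of_lt hy))
    (fun j H hH hj x => hH.extend_of (fun p hp => Nat.lt_succ_of_lt (hj p hp))
      ⟨⟨m + j⟩, Nat.lt_succ_self _, fun p hp e => by
        have h : p.2.down < m + j := hj p hp
        rw [e] at h
        exact lt_irrefl _ h⟩ x) k 0 H hH hm d
  exact ⟨H', hs, hH', d', hd, fun i => by simpa using hb _ (hd i)⟩


/-! ### Recursive evaluation of infinite and-or graphs -/

/-- Evaluation of the nodes of a graph.  If `next n = (r, l)`, then the node `n` has the value `r`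
if every node listed in `l` has the value that is listed with it, and it has the value `!r` if some
node listed in `l` has the opposite value. -/
inductive Ev {N : Type*} (next : N → Bool × List (Bool × N)) : N → Bool → Prop
  | all {n : N} {v : Bool} (hv : v = (next n).1) (h : ∀ p ∈ (next n).2, Ev next p.2 p.1) :
      Ev next n v
  | some {n : N} {v : Bool} {p : Bool × N} (hv : v = !(next n).1) (hp : p ∈ (next n).2)
      (h : Ev next p.2 (!p.1)) : Ev next n v

section

variable {N : Type*} {next : N → Bool × List (Bool × N)}

/-- A node cannot have all its listed values and miss one of them; induction on the derivation rules
out the mixed cases. Hence any certificate found is trustworthy, whichever one the search meets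
first. -/
theorem Ev.unique {n : N} {v v' : Bool} (h : Ev next n v) : Ev next n v' → v = v' := by
  induction h generalizing v' with
  | all hv _ ih =>
    rintro (⟨hv', -⟩ | ⟨hv', hp, h⟩)
    · rw [hv, hv']
    · have := ih _ hp h
      simp at this
  | some hv hp _ ih =>
    rintro (⟨hv', h⟩ | ⟨hv', -, -⟩)
    · have := ih (h _ hp)
      simp at this
    · rw [hv, hv']

/-- The entry `p` follows from the entries `t` by one evaluation step. -/
def Justified (next : N → Bool × List (Bool × N)) (p : Bool × N) (t : List (Bool × N)) : Prop :=
  (p.1 = (next p.2).1 ∧ ∀ q ∈ (next p.2).2, q ∈ t) ∨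
    (p.1 = !(next p.2).1 ∧ ∃ q ∈ (next p.2).2, (!q.1, q.2) ∈ t)

/-- Lists in which every entry follows from later ones. -/
def IsCert (next : N → Bool × List (Bool × N)) : List (Bool × N) → Prop
  | [] => True
  | p :: t => Justified next p t ∧ IsCert next t

theorem Justified.mono {p : Bool × N} {t t' : List (Bool × N)} (h : Justified next p t)
    (hs : ∀ q ∈ t, q ∈ t') : Justified next p t' := by
  rcases h with ⟨h₁, h₂⟩ | ⟨h₁, q, hq, h₂⟩
  · exact Or.inl ⟨h₁, fun q hq => hs q (h₂ q hq)⟩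
  · exact Or.inr ⟨h₁, q, hq, hs _ h₂⟩

theorem IsCert.append : ∀ {l l' : List (Bool × N)}, IsCert next l → IsCert next l' →
    IsCert next (l ++ l')
  | [], _, _, h' => h'
  | _ :: _, _, h, h' => ⟨h.1.mono fun _ hq => List.mem_append_left _ hq, h.2.append h'⟩

theorem IsCert.ev : ∀ {l : List (Bool × N)}, IsCert next l → ∀ p ∈ l, Ev next p.2 p.1
  | p :: t, h, q, hq => by
    rcases List.mem_cons.1 hq with rfl | hq
    · rcases h.1 with ⟨hv, h'⟩ | ⟨hv, r, hr, h'⟩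
      · exact .all hv fun r hr => h.2.ev r (h' r hr)
      · exact .some hv hr (h.2.ev _ h')
    · exact h.2.ev q hq

/-- A derivation tree is flattened into a list by concatenating the lists of its premises behind the
conclusion. -/
theorem Ev.exists_cert {n : N} {v : Bool} (h : Ev next n v) :
    ∃ l, IsCert next l ∧ (v, n) ∈ l := by
  induction h with
  | @all n v hv _ ih =>
    have key : ∀ L : List (Bool × N), (∀ p ∈ L, ∃ l, IsCert next l ∧ (p.1, p.2) ∈ l) →
        ∃ l, IsCert next l ∧ ∀ p ∈ L, p ∈ l := by
      intro L
      induction L with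
      | nil => exact fun _ => ⟨[], trivial, by simp⟩
      | cons p L ihL =>
        intro hL
        obtain ⟨l, hl, hp⟩ := hL p List.mem_cons_self
        obtain ⟨l', hl', hp'⟩ := ihL fun q hq => hL q (List.mem_cons_of_mem _ hq)
        refine ⟨l ++ l', hl.append hl', fun q hq => ?_⟩
        rcases List.mem_cons.1 hq with rfl | hq
        · exact List.mem_append_left _ hp
        · exact List.mem_append_right _ (hp' q hq)
    obtain ⟨l, hl, h⟩ := key _ ih
    exact ⟨(v, n) :: l, ⟨Or.inl ⟨hv, h⟩, hl⟩, List.mem_cons_self⟩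
  | @some n v p hv hp _ ih =>
    obtain ⟨l, hl, h⟩ := ih
    exact ⟨(v, n) :: l, ⟨Or.inr ⟨hv, p, hp, h⟩, hl⟩, List.mem_cons_self⟩

end

/-! ### Primitive recursive certificates and the search for them -/

section

variable {N : Type} [Primcodable N] {next : N → Bool × List (Bool × N)}

theorem primrecRel_mem {α : Type*} [Primcodable α] :
    PrimrecRel fun (a : α) (l : List α) => a ∈ l := by
  classical
  have h : PrimrecRel fun (l : List α) (a : α) => ∃ b ∈ l, b = a :=
    PrimrecRel.exists_mem_list Primrec.eq
  exact (h.comp Primrec.snd Primrec.fst).of_eq fun p => by simp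

theorem primrecRel_justified (hnext : Primrec next) : PrimrecRel (Justified next) := by
  have hn : Primrec fun p : (Bool × N) × List (Bool × N) => next p.1.2 :=
    hnext.comp (Primrec.snd.comp Primrec.fst)
  have h₁ : PrimrecRel fun (L t : List (Bool × N)) => ∀ q ∈ L, q ∈ t :=
    PrimrecRel.forall_mem_list primrecRel_mem
  have h₂ : PrimrecRel fun (L t : List (Bool × N)) => ∃ q ∈ L, (!q.1, q.2) ∈ t :=
    PrimrecRel.exists_mem_list (R := fun (q : Bool × N) (t : List (Bool × N)) => (!q.1, q.2) ∈ t)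
      (primrecRel_mem.comp (Primrec.pair ((Primrec.dom_bool not).comp
        (Primrec.fst.comp Primrec.fst)) (Primrec.snd.comp Primrec.fst)) Primrec.snd)
  exact PrimrecPred.or
    (PrimrecPred.and (Primrec.eq.comp (Primrec.fst.comp Primrec.fst) (Primrec.fst.comp hn))
      (h₁.comp (Primrec.snd.comp hn) Primrec.snd))
    (PrimrecPred.and (Primrec.eq.comp (Primrec.fst.comp Primrec.fst)
        ((Primrec.dom_bool not).comp (Primrec.fst.comp hn)))
      (h₂.comp (Primrec.snd.comp hn) Primrec.snd))

/-- Each entry is justified by a finite check against its tail, so the whole check is a recursion on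
the list. -/
theorem primrecPred_isCert (hnext : Primrec next) : PrimrecPred (IsCert next) := by
  classical
  have hj : Primrec₂ fun (p : Bool × N) t => decide (Justified next p t) :=
    (primrecRel_justified hnext).decide
  let f : List (Bool × N) → Bool := fun l =>
    List.rec true (fun p t ih => decide (Justified next p t) && ih) l
  have hf : Primrec f := Primrec.list_rec Primrec.id (Primrec.const true)
    (h := fun _ q => decide (Justified next q.1 q.2.1) && q.2.2)
    ((Primrec.dom_bool₂ and).comp (hj.comp (Primrec.fst.comp Primrec.snd)
      (Primrec.fst.comp (Primrec.snd.comp Primrec.snd)))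
      (Primrec.snd.comp (Primrec.snd.comp Primrec.snd)))
  have key : ∀ l, f l = true ↔ IsCert next l := by
    intro l
    induction l with
    | nil => exact iff_of_true rfl trivial
    | cons p t ih =>
      have : f (p :: t) = (decide (Justified next p t) && f t) := rfl
      rw [this, Bool.and_eq_true, ih, decide_eq_true_iff]
      exact Iff.rfl
  exact Primrec.primrecPred (hf.of_eq fun l => by
    rw [Bool.eq_iff_iff, key, decide_eq_true_iff])

/-- Search for a value `y` for which the literal `q x y` holds. -/
theorem exists_partrec_search (hnext : Primrec next) {β : Type} [Primcodable β]
    {q : ℕ → β → Bool × N} (hq : Primrec₂ q) :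
    ∃ f : ℕ →. ℕ, Nat.Partrec f ∧ ∀ x, (∃ y, Ev next (q x y).2 (q x y).1) →
      ∃ y, Ev next (q x y).2 (q x y).1 ∧ f x = Part.some (Encodable.encode y) := by
  classical
  -- The search runs over pairs of a certificate and an answer; soundness of certificates makes the
  -- returned answer correct.
  let P : ℕ → (List (Bool × N) × β) → Prop := fun x z => IsCert next z.1 ∧ q x z.2 ∈ z.1
  have hP : PrimrecRel P := PrimrecPred.and
    ((primrecPred_isCert hnext).comp (Primrec.fst.comp Primrec.snd))
    (primrecRel_mem.comp (hq.comp Primrec.fst (Primrec.snd.comp Primrec.snd))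
      (Primrec.fst.comp Primrec.snd))
  let g : ℕ → (List (Bool × N) × β) → Option ℕ := fun x z =>
    if P x z then some (Encodable.encode z.2) else none
  have hg : Primrec₂ g := Primrec.ite hP
    (Primrec.option_some.comp (Primrec.encode.comp (Primrec.snd.comp Primrec.snd)))
    (Primrec.const none)
  let F : ℕ → ℕ → Option ℕ := fun x k =>
    (Encodable.decode (α := List (Bool × N) × β) k).bind (g x)
  have hF : Primrec₂ F := Primrec.option_bind (Primrec.decode.comp Primrec.snd)
    (hg.comp (Primrec.fst.comp Primrec.fst) Primrec.snd)
  refine ⟨fun x => Nat.rfindOpt (F x), ?_, fun x hx => ?_⟩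
  · exact Partrec.nat_iff.1 (Partrec.rfindOpt hF.to_comp)
  · obtain ⟨y, hy⟩ := hx
    obtain ⟨l, hl, hyl⟩ := hy.exists_cert
    have hdom : (Nat.rfindOpt (F x)).Dom := Nat.rfindOpt_dom.2
      ⟨Encodable.encode (l, y), Encodable.encode y, by
        simp only [F, Encodable.encodek, Option.bind_some, g]
        rw [if_pos ⟨hl, hyl⟩]
        exact rfl⟩
    obtain ⟨v, hv⟩ := Part.dom_iff_mem.1 hdom
    obtain ⟨k, hk⟩ := Nat.rfindOpt_spec hv
    obtain ⟨⟨l', y'⟩, -, hz⟩ := Option.bind_eq_some_iff.1 hk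
    by_cases hPz : P x (l', y')
    · simp only [g, if_pos hPz, Option.some.injEq] at hz
      refine ⟨y', hPz.1.ev _ hPz.2, ?_⟩
      rw [hz]
      exact Part.eq_some_iff.2 hv
    · simp [g, if_neg hPz] at hz

end


/-! ### Automation for primitive recursive functions -/

attribute [fun_prop] Primrec

section

variable {α β γ : Type} [Primcodable α] [Primcodable β] [Primcodable γ]

@[fun_prop] theorem primrec_id' : Primrec fun a : α => a := Primrec.id

@[fun_prop] theorem primrec_const' (b : β) : Primrec fun _ : α => b := Primrec.const b

@[fun_prop] theorem primrec_comp' {f : β → γ} {g : α → β} (hf : Primrec f) (hg : Primrec g) :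
    Primrec fun a => f (g a) := hf.comp hg

@[fun_prop] theorem primrec_prodMk {f : α → β} {g : α → γ} (hf : Primrec f) (hg : Primrec g) :
    Primrec fun a => (f a, g a) := hf.pair hg

@[fun_prop] theorem primrec_prodFst {f : α → β × γ} (hf : Primrec f) : Primrec fun a => (f a).1 :=
  Primrec.fst.comp hf

@[fun_prop] theorem primrec_prodSnd {f : α → β × γ} (hf : Primrec f) : Primrec fun a => (f a).2 :=
  Primrec.snd.comp hf

@[fun_prop] theorem primrec_add {f g : α → ℕ} (hf : Primrec f) (hg : Primrec g) :
    Primrec fun a => f a + g a := Primrec.nat_add.comp hf hg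

@[fun_prop] theorem primrec_sub {f g : α → ℕ} (hf : Primrec f) (hg : Primrec g) :
    Primrec fun a => f a - g a := Primrec.nat_sub.comp hf hg

@[fun_prop] theorem primrec_mul {f g : α → ℕ} (hf : Primrec f) (hg : Primrec g) :
    Primrec fun a => f a * g a := Primrec.nat_mul.comp hf hg

@[fun_prop] theorem primrec_pow {f g : α → ℕ} (hf : Primrec f) (hg : Primrec g) :
    Primrec fun a => f a ^ g a := (Primrec₂.unpaired'.1 Nat.Primrec.pow).comp hf hg

@[fun_prop] theorem primrec_natPair {f g : α → ℕ} (hf : Primrec f) (hg : Primrec g) :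
    Primrec fun a => Nat.pair (f a) (g a) := Primrec₂.natPair.comp hf hg

@[fun_prop] theorem primrec_unpair {f : α → ℕ} (hf : Primrec f) :
    Primrec fun a => Nat.unpair (f a) := Primrec.unpair.comp hf

@[fun_prop] theorem primrec_encode {f : α → β} (hf : Primrec f) :
    Primrec fun a => Encodable.encode (f a) := Primrec.encode.comp hf

@[fun_prop] theorem primrec_decode {f : α → ℕ} (hf : Primrec f) :
    Primrec fun a => Encodable.decode (α := β) (f a) := Primrec.decode.comp hf

@[fun_prop] theorem primrec_optionGetD {f : α → Option β} {g : α → β} (hf : Primrec f)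
    (hg : Primrec g) : Primrec fun a => (f a).getD (g a) := Primrec.option_getD.comp hf hg

@[fun_prop] theorem primrec_cond {c : α → Bool} {f g : α → β} (hc : Primrec c) (hf : Primrec f)
    (hg : Primrec g) : Primrec fun a => bif c a then f a else g a := Primrec.cond hc hf hg

@[fun_prop] theorem primrec_not {f : α → Bool} (hf : Primrec f) : Primrec fun a => !f a :=
  (Primrec.dom_bool not).comp hf

@[fun_prop] theorem primrec_and {f g : α → Bool} (hf : Primrec f) (hg : Primrec g) :
    Primrec fun a => f a && g a := (Primrec.dom_bool₂ and).comp hf hg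

@[fun_prop] theorem primrec_or {f g : α → Bool} (hf : Primrec f) (hg : Primrec g) :
    Primrec fun a => f a || g a := (Primrec.dom_bool₂ or).comp hf hg

@[fun_prop] theorem primrec_decide_eq {f g : α → β} [∀ a, Decidable (f a = g a)]
    (hf : Primrec f) (hg : Primrec g) : Primrec fun a => decide (f a = g a) :=
  PrimrecPred.decide (p := fun a => f a = g a) (Primrec.eq.comp hf hg)

@[fun_prop] theorem primrec_decide_mem {f : α → β} {g : α → List β}
    [∀ a, Decidable (f a ∈ g a)] (hf : Primrec f) (hg : Primrec g) :
    Primrec fun a => decide (f a ∈ g a) :=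
  PrimrecPred.decide (p := fun a => f a ∈ g a) (primrecRel_mem.comp hf hg)

@[fun_prop] theorem primrec_cons {f : α → β} {g : α → List β} (hf : Primrec f) (hg : Primrec g) :
    Primrec fun a => f a :: g a := Primrec.list_cons.comp hf hg

@[fun_prop] theorem primrec_append {f g : α → List β} (hf : Primrec f) (hg : Primrec g) :
    Primrec fun a => f a ++ g a := Primrec.list_append.comp hf hg

@[fun_prop] theorem primrec_map {f : α → List β} {g : α → β → γ} (hf : Primrec f)
    (hg : Primrec fun p : α × β => g p.1 p.2) : Primrec fun a => (f a).map (g a) :=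
  Primrec.list_map hf hg.to₂

@[fun_prop] theorem primrec_flatMap {f : α → List β} {g : α → β → List γ} (hf : Primrec f)
    (hg : Primrec fun p : α × β => g p.1 p.2) : Primrec fun a => (f a).flatMap (g a) :=
  Primrec.list_flatMap hf hg.to₂

@[fun_prop] theorem primrec_foldr {f : α → List β} {g : α → γ} {h : α → β → γ → γ}
    (hf : Primrec f) (hg : Primrec g) (hh : Primrec fun p : α × β × γ => h p.1 p.2.1 p.2.2) :
    Primrec fun a => (f a).foldr (h a) (g a) :=
  Primrec.list_foldr (h := fun a p => h a p.1 p.2) hf hg hh.to₂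

@[fun_prop] theorem primrec_range {f : α → ℕ} (hf : Primrec f) :
    Primrec fun a => List.range (f a) := Primrec.list_range.comp hf

@[fun_prop] theorem primrec_length {f : α → List β} (hf : Primrec f) :
    Primrec fun a => (f a).length := Primrec.list_length.comp hf

@[fun_prop] theorem primrec_tail {f : α → List β} (hf : Primrec f) :
    Primrec fun a => (f a).tail := Primrec.list_tail.comp hf

@[fun_prop] theorem primrec_drop {f : α → List β} {g : α → ℕ} (hf : Primrec f) (hg : Primrec g) :
    Primrec fun a => (f a).drop (g a) := Primrec.list_drop.comp hg hf

@[fun_prop] theorem primrec_getD {f : α → List β} {g : α → ℕ} (d : β) (hf : Primrec f)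
    (hg : Primrec g) : Primrec fun a => (f a).getD (g a) d := (Primrec.list_getD d).comp hf hg

@[fun_prop] theorem primrec_lookup [DecidableEq β] {f : α → β} {g : α → List (β × γ)}
    (hf : Primrec f) (hg : Primrec g) : Primrec fun a => (g a).lookup (f a) :=
  Primrec.listLookup.comp hf hg

end

/-! ### Enumerations -/

/-- The tuples of length `k` over the numbers below `m`. -/
def tuples (m k : ℕ) : List (List ℕ) :=
  (List.range k).foldr (fun _ ih => (List.range m).flatMap fun d => ih.map fun t => d :: t) [[]]

@[fun_prop] theorem primrec_tuples {α : Type} [Primcodable α] {f g : α → ℕ} (hf : Primrec f)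
    (hg : Primrec g) : Primrec fun a => tuples (f a) (g a) := by
  unfold tuples
  fun_prop

theorem mem_foldr_tuples {α : Type*} {m : ℕ} (l : List α) : ∀ {t : List ℕ},
    t ∈ l.foldr (fun _ ih => (List.range m).flatMap fun d => ih.map fun t => d :: t) [[]] ↔
      t.length = l.length ∧ ∀ d ∈ t, d < m := by
  induction l with
  | nil => intro t; cases t <;> simp
  | cons a l ih =>
    intro t
    rw [List.foldr_cons]
    simp only [List.mem_flatMap, List.mem_range, List.mem_map, ih]
    constructor
    · rintro ⟨d, hd, t, ⟨h₁, h₂⟩, rfl⟩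
      simpa [h₁, hd] using h₂
    · rintro ⟨h₁, h₂⟩
      cases t with
      | nil => simp at h₁
      | cons d t =>
        exact ⟨d, h₂ d List.mem_cons_self, t, ⟨by simpa using h₁,
          fun e he => h₂ e (List.mem_cons_of_mem _ he)⟩, rfl⟩

theorem mem_tuples {m k : ℕ} {t : List ℕ} : t ∈ tuples m k ↔ t.length = k ∧ ∀ d ∈ t, d < m := by
  unfold tuples
  rw [mem_foldr_tuples, List.length_range]

/-- All the sublists of a list. -/
def sublistsOf (l : List (List ℕ)) : List (List (List ℕ)) :=
  l.foldr (fun a ih => ih ++ ih.map fun t => a :: t) [[]]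

@[fun_prop] theorem primrec_sublistsOf {α : Type} [Primcodable α] {f : α → List (List ℕ)}
    (hf : Primrec f) : Primrec fun a => sublistsOf (f a) := by
  unfold sublistsOf
  fun_prop

theorem filter_mem_sublistsOf (p : List ℕ → Bool) (l : List (List ℕ)) :
    l.filter p ∈ sublistsOf l := by
  induction l with
  | nil => simp [sublistsOf]
  | cons a l ih =>
    have h : sublistsOf (a :: l) = sublistsOf l ++ (sublistsOf l).map fun t => a :: t := rfl
    rw [h, List.filter_cons]
    split_ifs
    · exact List.mem_append_right _ (List.mem_map_of_mem ih)
    · exact List.mem_append_left _ ih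

/-- The choices of extensions over the numbers below `m` for fluents of the given arities. -/
def extensions (m : ℕ) (l : List ℕ) : List (List (List (List ℕ))) :=
  l.foldr (fun k ih => (sublistsOf (tuples m k)).flatMap fun S => ih.map fun E => S :: E) [[]]

@[fun_prop] theorem primrec_extensions {α : Type} [Primcodable α] {f : α → ℕ} {g : α → List ℕ}
    (hf : Primrec f) (hg : Primrec g) : Primrec fun a => extensions (f a) (g a) := by
  unfold extensions
  fun_prop

/-- Any choice of sets of small tuples is represented in the enumeration, namely by filtering the
list of all small tuples for each fluent. -/
theorem exists_mem_extensions {m : ℕ} : ∀ (l : List ℕ) (P : ℕ → List ℕ → Bool),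
    ∃ E ∈ extensions m l, ∀ (i : ℕ) (hi : i < l.length) t,
      t ∈ E.getD i [] ↔ t ∈ tuples m l[i] ∧ P i t = true
  | [], _ => ⟨[], by simp [extensions], fun i hi => by simp at hi⟩
  | k :: l, P => by
    obtain ⟨E, hE, h⟩ := exists_mem_extensions l fun i => P (i + 1)
    refine ⟨(tuples m k).filter (P 0) :: E, ?_, fun i hi t => ?_⟩
    · exact List.mem_flatMap.2 ⟨_, filter_mem_sublistsOf _ _, List.mem_map_of_mem hE⟩
    · cases i with
      | zero => simp
      | succ i => simpa using h i (by simpa using hi) t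

/-! ### Nodes of the evaluation graph -/

/-- The code of an action: its type and its arguments. -/
abbrev ActCode : Type := ℕ × List ℕ

/-- The data of an evaluation problem: the arities of the fluents and of the actions, the codes of
the initial situation axioms, of the preconditions and of the successor state axioms, the database,
and a number that exceeds all constants and bounds the number of the fluents and so on. -/
abbrev Ctx : Type := (List ℕ × List ℕ) × (List ℕ × List ℕ × List ℕ) × DB × ℕ

/-- Approximants of fixpoint formulas: the code of the body, the values of the individual variables,
and the index of the approximant. -/
abbrev Approx : Type := ℕ × List ℕ × ℕ

/-- Nodes of the evaluation graph.  The components of a node are the context, the kind of question,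
the code of a formula, the values of the object variables and of the action variables, the
sequence of the actions performed (the last one first), the values of the predicate
variables, and a strict bound for the objects mentioned. -/
abbrev Node : Type :=
  Ctx × ℕ × ℕ × List ℕ × List ActCode × List ActCode × List Approx × ℕ

instance : Primcodable Ctx := inferInstance

instance : Primcodable Node := inferInstance

instance : Primcodable (Bool × Node) := inferInstance

/-- Lists of literals together with the value of their conjunction. -/
abbrev Step : Type := Bool × List (Bool × Node)

instance : Primcodable Step := inferInstance

/-- The node with the given components. -/
def mkNode (g : Ctx) (k c : ℕ) (env : List ℕ) (acts hist : List ActCode) (V : List Approx)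
    (m : ℕ) : Node := (g, k, c, env, acts, hist, V, m)

@[fun_prop] theorem primrec_mkNode {α : Type} [Primcodable α] {g : α → Ctx} {k c : α → ℕ}
    {env : α → List ℕ} {acts hist : α → List ActCode} {V : α → List Approx} {m : α → ℕ}
    (hg : Primrec g) (hk : Primrec k) (hc : Primrec c) (henv : Primrec env) (hacts : Primrec acts)
    (hhist : Primrec hist) (hV : Primrec V) (hm : Primrec m) : Primrec fun a =>
      mkNode (g a) (k a) (c a) (env a) (acts a) (hist a) (V a) (m a) := by
  unfold mkNode
  fun_prop

/-- Decoding of lists of numbers. -/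
def toList (c : ℕ) : List ℕ := (Encodable.decode (α := List ℕ) c).getD []

@[fun_prop] theorem primrec_toList {α : Type} [Primcodable α] {f : α → ℕ} (hf : Primrec f) :
    Primrec fun a => toList (f a) := by
  unfold toList
  fun_prop

@[simp] theorem toList_encode (l : List ℕ) : toList (Encodable.encode l) = l := by
  simp [toList]

@[fun_prop] theorem primrec_value {α : Type} [Primcodable α] {f : α → DB} {g : α → ℕ}
    (hf : Primrec f) (hg : Primrec g) : Primrec fun a => DB.value (f a) (g a) := by
  unfold DB.value
  fun_prop

/-- The value of an object term. -/
def termValue (I : DB) (env : List ℕ) (t : ℕ) : ℕ :=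
  bif decide (t.unpair.1 = 0) then env.getD t.unpair.2 0 else I.value t.unpair.2

@[fun_prop] theorem primrec_termValue {α : Type} [Primcodable α] {f : α → DB} {e : α → List ℕ}
    {g : α → ℕ} (hf : Primrec f) (he : Primrec e) (hg : Primrec g) :
    Primrec fun a => termValue (f a) (e a) (g a) := by
  unfold termValue
  fun_prop

/-- The value of an action term. -/
def actionValue (I : DB) (env : List ℕ) (acts : List ActCode) (t : ℕ) : ActCode :=
  bif decide (t.unpair.1 = 0) then acts.getD t.unpair.2 (0, [])
  else (t.unpair.2.unpair.1, (toList t.unpair.2.unpair.2).map fun t => termValue I env t)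

@[fun_prop] theorem primrec_actionValue {α : Type} [Primcodable α] {f : α → DB} {e : α → List ℕ}
    {y : α → List ActCode} {g : α → ℕ} (hf : Primrec f) (he : Primrec e) (hy : Primrec y)
    (hg : Primrec g) : Primrec fun a => actionValue (f a) (e a) (y a) (g a) := by
  unfold actionValue
  fun_prop

/-- The actions of the types with the given arities, with old parameters, smaller than `m`, or with
the first fresh ones. -/
def actionsBelow (ar : List ℕ) (m : ℕ) : List ActCode :=
  (List.range ar.length).flatMap fun A =>
    (tuples (m + ar.getD A 0) (ar.getD A 0)).map fun t => (A, t)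

@[fun_prop] theorem primrec_actionsBelow {α : Type} [Primcodable α] {f : α → List ℕ} {g : α → ℕ}
    (hf : Primrec f) (hg : Primrec g) : Primrec fun a => actionsBelow (f a) (g a) := by
  unfold actionsBelow
  fun_prop

/-- The databases that represent all the classes of initial situations. -/
def candidates (fl : List ℕ) (W : ℕ) : List DB :=
  -- Numbers below `W` are reserved for the constants, each naming itself; the next `W * W * W`
  -- numbers suffice for the positions in bounded fluents.
  (extensions (W + W * W * W) fl).map fun E => (E, (List.range W).map fun c => (c, c))

@[fun_prop] theorem primrec_candidates {α : Type} [Primcodable α] {f : α → List ℕ} {g : α → ℕ}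
    (hf : Primrec f) (hg : Primrec g) : Primrec fun a => candidates (f a) (g a) := by
  unfold candidates
  fun_prop

@[fun_prop] theorem primrec_typeBound {α : Type} [Primcodable α] {f : α → ℕ} (hf : Primrec f) :
    Primrec fun a => typeBound (f a) := by
  unfold typeBound
  fun_prop

/-! ### The evaluation graph -/

/-- Equality test. -/
def same {α : Type} [DecidableEq α] (a b : α) : Bool := decide (a = b)

@[fun_prop] theorem primrec_same {α β : Type} [Primcodable α] [Primcodable β] [DecidableEq β]
    {f g : α → β} (hf : Primrec f) (hg : Primrec g) : Primrec fun a => same (f a) (g a) :=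
  primrec_decide_eq hf hg

/-- Does the first-order formula `c` hold? -/
abbrev foNode (g : Ctx) (c : ℕ) (env : List ℕ) (acts hist : List ActCode) (m : ℕ) : Node :=
  mkNode g 0 c env acts hist [] m

/-- Does the tuple `t` belong to the extension of the fluent `F`? -/
abbrev fluentNode (g : Ctx) (F : ℕ) (t : List ℕ) (hist : List ActCode) (m : ℕ) : Node :=
  mkNode g 1 F t [] hist [] m

/-- Does the mu-calculus formula `c` hold? -/
abbrev muNode (g : Ctx) (c : ℕ) (env : List ℕ) (hist : List ActCode) (V : List Approx) (m : ℕ) :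
    Node :=
  mkNode g 2 c env [] hist V m

/-- Is the youngest individual variable live and does `c` hold? -/
abbrev liveAndNode (g : Ctx) (c : ℕ) (env : List ℕ) (hist : List ActCode) (V : List Approx)
    (m : ℕ) : Node :=
  mkNode g 3 c env [] hist V m

/-- Is the object `d` live? -/
abbrev liveNode (g : Ctx) (d : ℕ) (hist : List ActCode) (m : ℕ) : Node :=
  mkNode g 4 0 [d] [] hist [] m

/-- Does `c` hold after some possible action? -/
abbrev diaNode (g : Ctx) (c : ℕ) (env : List ℕ) (hist : List ActCode) (V : List Approx) (m : ℕ) :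
    Node :=
  mkNode g 5 c env [] hist V m

/-- Was the last action possible and does `c` hold? -/
abbrev possAndNode (g : Ctx) (c : ℕ) (env : List ℕ) (hist : List ActCode) (V : List Approx)
    (m : ℕ) : Node :=
  mkNode g 6 c env [] hist V m

/-- Does the constant `c` occur in the theory? -/
abbrev occursNode (g : Ctx) (c : ℕ) : Node := mkNode g 7 0 [c] [] [] [] 0

/-- Does the constant `c` occur in the formula `φ`? -/
abbrev occursInNode (g : Ctx) (c φ : ℕ) : Node := mkNode g 8 φ [c] [] [] [] 0

/-- Do two constants of the theory denote the same object? -/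
abbrev clashNode (g : Ctx) : Node := mkNode g 9 0 [] [] [] [] 0

/-- Do both constants occur in the theory? -/
abbrev occurBothNode (g : Ctx) (c c' : ℕ) : Node := mkNode g 10 0 [c, c'] [] [] [] 0

/-- Does the mu-calculus formula `Φ` follow from the theory with the database of the context? -/
abbrev entailsDBNode (g : Ctx) (Φ : ℕ) : Node := mkNode g 11 Φ [] [] [] [] 0

/-- Is the database of the context inconsistent with the theory or does `Φ` hold in it? -/
abbrev impliesNode (g : Ctx) (Φ : ℕ) : Node := mkNode g 12 Φ [] [] [] [] 0

/-- Does the mu-calculus formula `Φ` follow from the theory? -/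
abbrev entailsNode (g : Ctx) (Φ : ℕ) : Node := mkNode g 13 Φ [] [] [] [] 0

/-- Is the database of the context consistent with the theory? -/
abbrev consistentNode (g : Ctx) : Node := mkNode g 14 0 [] [] [] [] 0

/-- Does the list of databases with the code `L` contain exactly the consistent ones, among the
candidates, and no inconsistent ones? -/
abbrev classesNode (g : Ctx) (L : ℕ) : Node := mkNode g 15 L [] [] [] [] 0

/-- A step that answers the question. -/
abbrev answer (b : Bool) : Step := (b, [])

/-- First-order formulas. -/
def foStep (g : Ctx) (c : ℕ) (env : List ℕ) (acts hist : List ActCode) (m : ℕ) : Step :=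
  bif decide (c.unpair.1 = 0) then
    (true, [(true, fluentNode g c.unpair.2.unpair.1
      ((toList c.unpair.2.unpair.2).map fun t => termValue g.2.2.1 env t) hist m)])
  else bif decide (c.unpair.1 = 1) then
    answer (same (termValue g.2.2.1 env c.unpair.2.unpair.1)
      (termValue g.2.2.1 env c.unpair.2.unpair.2))
  else bif decide (c.unpair.1 = 2) then
    answer (same (actionValue g.2.2.1 env acts c.unpair.2.unpair.1)
      (actionValue g.2.2.1 env acts c.unpair.2.unpair.2))
  else bif decide (c.unpair.1 = 3) then
    (true, [(false, foNode g c.unpair.2 env acts hist m)])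
  else bif decide (c.unpair.1 = 4) then
    (true, [(true, foNode g c.unpair.2.unpair.1 env acts hist m),
      (true, foNode g c.unpair.2.unpair.2 env acts hist m)])
  else bif decide (c.unpair.1 = 5) then
    -- All numbers from `m` on behave alike, so the single fresh number `m` represents them.
    (false, (List.range (m + 1)).map fun d =>
      (false, foNode g c.unpair.2 (d :: env) acts hist (m + 1)))
  else
    (false, (actionsBelow g.1.2 m).map fun a =>
      (false, foNode g c.unpair.2 env (a :: acts) hist (m + a.2.length)))

/-- Fluents, by regression. -/
def fluentStep (g : Ctx) (F : ℕ) (t : List ℕ) (hist : List ActCode) (m : ℕ) : Step :=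
  bif decide (hist.length = 0) then answer (decide (t ∈ g.2.2.1.1.getD F []))
  else (true, [(true, foNode g (g.2.1.2.2.getD F 0) t [hist.getD 0 (0, [])] hist.tail m)])

/-- Formulas of the mu-calculus. -/
def muStep (g : Ctx) (c : ℕ) (env : List ℕ) (hist : List ActCode) (V : List Approx) (m : ℕ) :
    Step :=
  bif decide (c.unpair.1 = 0) then (true, [(true, foNode g c.unpair.2 env [] hist m)])
  else bif decide (c.unpair.1 = 1) then (true, [(false, muNode g c.unpair.2 env hist V m)])
  else bif decide (c.unpair.1 = 2) then
    (true, [(true, muNode g c.unpair.2.unpair.1 env hist V m),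
      (true, muNode g c.unpair.2.unpair.2 env hist V m)])
  else bif decide (c.unpair.1 = 3) then
    (false, (List.range (m + 1)).map fun d =>
      (false, liveAndNode g c.unpair.2 (d :: env) hist V (m + 1)))
  else bif decide (c.unpair.1 = 4) then
    (true, (true, diaNode g c.unpair.2.unpair.2 env hist V m) ::
      (toList c.unpair.2.unpair.1).map fun i => (true, liveNode g (env.getD i 0) hist m))
  else bif decide (c.unpair.1 = 5) then
    -- The box is evaluated as a negated diamond of the negation; `Nat.pair 1` is the code of
    -- negation.
    (true, (false, diaNode g (Nat.pair 1 c.unpair.2.unpair.2) env hist V m) ::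
      (toList c.unpair.2.unpair.1).map fun i => (true, liveNode g (env.getD i 0) hist m))
  else bif decide (c.unpair.1 = 6) then
    bif decide ((V.getD c.unpair.2 (0, [], 0)).2.2 = 0) then answer false
    -- Approximant `i` is the body with approximant `i - 1` for its variable. The body is evaluated
    -- with the variable values stored at its binder, and the predicate variables bound inside it
    -- are dropped from the stack.
    else (true, [(true, muNode g (V.getD c.unpair.2 (0, [], 0)).1
      (V.getD c.unpair.2 (0, [], 0)).2.1 hist
      (((V.getD c.unpair.2 (0, [], 0)).1, (V.getD c.unpair.2 (0, [], 0)).2.1,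
        (V.getD c.unpair.2 (0, [], 0)).2.2 - 1) :: V.drop (c.unpair.2 + 1)) m)])
  else
    -- The body is evaluated with its variable at index `typeBound`, so the whole formula receives
    -- the approximant of index `typeBound + 1`.
    (true, [(true, muNode g c.unpair.2 env hist ((c.unpair.2, env, typeBound g.2.2.2) :: V) m)])

/-- Live objects. -/
def liveStep (g : Ctx) (d : ℕ) (hist : List ActCode) (m : ℕ) : Step :=
  (false,
    ((List.range g.1.1.length).flatMap fun F =>
      (tuples (m + g.1.1.getD F 0) (g.1.1.getD F 0)).flatMap fun t =>
        bif decide (d ∈ t) then [(false, fluentNode g F t hist (m + g.1.1.getD F 0))] else []) ++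
    (List.range g.2.2.2).flatMap fun c =>
      bif decide (DB.value g.2.2.1 c = d) then [(false, occursNode g c)] else [])

/-- Possible actions. -/
def diaStep (g : Ctx) (c : ℕ) (env : List ℕ) (hist : List ActCode) (V : List Approx) (m : ℕ) :
    Step :=
  (false, (actionsBelow g.1.2 m).map fun a =>
    (false, possAndNode g c env (a :: hist) V (m + a.2.length)))

/-- The precondition of the last action. -/
def possAndStep (g : Ctx) (c : ℕ) (env : List ℕ) (hist : List ActCode) (V : List Approx) (m : ℕ) :
    Step :=
  (true, [(true, foNode g (g.2.1.2.1.getD (hist.getD 0 (0, [])).1 0) (hist.getD 0 (0, [])).2 []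
    hist.tail m), (true, muNode g c env hist V m)])

/-- Constants of the theory. -/
def occursStep (g : Ctx) (c : ℕ) : Step :=
  (false, (g.2.1.1 ++ g.2.1.2.1 ++ g.2.1.2.2).map fun φ => (false, occursInNode g c φ))

/-- Constants of an action term. -/
def occursInAction (c t : ℕ) : Bool :=
  !decide (t.unpair.1 = 0) && decide (Nat.pair 1 c ∈ toList t.unpair.2.unpair.2)

@[fun_prop] theorem primrec_occursInAction {α : Type} [Primcodable α] {f g : α → ℕ}
    (hf : Primrec f) (hg : Primrec g) : Primrec fun a => occursInAction (f a) (g a) := by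
  unfold occursInAction
  fun_prop

/-- Constants of a first-order formula. -/
def occursInStep (g : Ctx) (c φ : ℕ) : Step :=
  bif decide (φ.unpair.1 = 0) then
    answer (decide (Nat.pair 1 c ∈ toList φ.unpair.2.unpair.2))
  else bif decide (φ.unpair.1 = 1) then
    answer (decide (φ.unpair.2.unpair.1 = Nat.pair 1 c) ||
      decide (φ.unpair.2.unpair.2 = Nat.pair 1 c))
  else bif decide (φ.unpair.1 = 2) then
    answer (occursInAction c φ.unpair.2.unpair.1 || occursInAction c φ.unpair.2.unpair.2)
  else bif decide (φ.unpair.1 = 4) then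
    (false, [(false, occursInNode g c φ.unpair.2.unpair.1),
      (false, occursInNode g c φ.unpair.2.unpair.2)])
  -- Negation and both quantifiers share this case, because each has a single subformula and adds no
  -- constants.
  else (true, [(true, occursInNode g c φ.unpair.2)])

/-- Constants with the same denotation. -/
def clashStep (g : Ctx) : Step :=
  (false, (List.range g.2.2.2).flatMap fun c => (List.range g.2.2.2).flatMap fun c' =>
    bif decide (DB.value g.2.2.1 c = DB.value g.2.2.1 c') && !decide (c = c') then
      [(false, occurBothNode g c c')] else [])

/-- Entailment by the theory with a database. -/
def entailsDBStep (g : Ctx) (Φ : ℕ) : Step :=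
  (false, [(false, clashNode g), (false, muNode g Φ [] [] [] (Encodable.encode g.2.2.1 + 1))])

/-- Consistency of a database with the theory. -/
def consistentStep (g : Ctx) : Step :=
  (true, (false, clashNode g) ::
    g.2.1.1.map fun φ => (true, foNode g φ [] [] [] (Encodable.encode g.2.2.1 + 1)))

/-- The implication for one database. -/
def impliesStep (g : Ctx) (Φ : ℕ) : Step :=
  -- Either literal settles the disjunction by itself: for an inconsistent database the formula node
  -- need not have a value.
  (false, [(true, consistentNode g),
    (false, muNode g Φ [] [] [] (Encodable.encode g.2.2.1 + 1))])

/-- Entailment by the theory. -/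
def entailsStep (g : Ctx) (Φ : ℕ) : Step :=
  (true, (candidates g.1.1 g.2.2.2).map fun I =>
    (true, impliesNode (g.1, g.2.1, I, g.2.2.2) Φ))

/-- The list of the consistent candidates. -/
def classesStep (g : Ctx) (L : ℕ) : Step :=
  (true, ((candidates g.1.1 g.2.2.2).map fun I =>
      (decide (I ∈ (Encodable.decode (α := List DB) L).getD []),
        consistentNode (g.1, g.2.1, I, g.2.2.2))) ++
    ((Encodable.decode (α := List DB) L).getD []).map fun I =>
      (true, consistentNode (g.1, g.2.1, I, g.2.2.2)))

/-- The evaluation graph. -/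
def next : Node → Step := fun n =>
  bif decide (n.2.1 = 0) then
    foStep n.1 n.2.2.1 n.2.2.2.1 n.2.2.2.2.1 n.2.2.2.2.2.1 n.2.2.2.2.2.2.2
  else bif decide (n.2.1 = 1) then
    fluentStep n.1 n.2.2.1 n.2.2.2.1 n.2.2.2.2.2.1 n.2.2.2.2.2.2.2
  else bif decide (n.2.1 = 2) then
    muStep n.1 n.2.2.1 n.2.2.2.1 n.2.2.2.2.2.1 n.2.2.2.2.2.2.1 n.2.2.2.2.2.2.2
  else bif decide (n.2.1 = 3) then
    (true, [(true, liveNode n.1 (n.2.2.2.1.getD 0 0) n.2.2.2.2.2.1 n.2.2.2.2.2.2.2),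
      (true, muNode n.1 n.2.2.1 n.2.2.2.1 n.2.2.2.2.2.1 n.2.2.2.2.2.2.1 n.2.2.2.2.2.2.2)])
  else bif decide (n.2.1 = 4) then
    liveStep n.1 (n.2.2.2.1.getD 0 0) n.2.2.2.2.2.1 n.2.2.2.2.2.2.2
  else bif decide (n.2.1 = 5) then
    diaStep n.1 n.2.2.1 n.2.2.2.1 n.2.2.2.2.2.1 n.2.2.2.2.2.2.1 n.2.2.2.2.2.2.2
  else bif decide (n.2.1 = 6) then
    possAndStep n.1 n.2.2.1 n.2.2.2.1 n.2.2.2.2.2.1 n.2.2.2.2.2.2.1 n.2.2.2.2.2.2.2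
  else bif decide (n.2.1 = 7) then occursStep n.1 (n.2.2.2.1.getD 0 0)
  else bif decide (n.2.1 = 8) then occursInStep n.1 (n.2.2.2.1.getD 0 0) n.2.2.1
  else bif decide (n.2.1 = 9) then clashStep n.1
  else bif decide (n.2.1 = 10) then
    (true, [(true, occursNode n.1 (n.2.2.2.1.getD 0 0)),
      (true, occursNode n.1 (n.2.2.2.1.getD 1 0))])
  else bif decide (n.2.1 = 11) then entailsDBStep n.1 n.2.2.1
  else bif decide (n.2.1 = 12) then impliesStep n.1 n.2.2.1
  else bif decide (n.2.1 = 13) then entailsStep n.1 n.2.2.1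
  else bif decide (n.2.1 = 14) then consistentStep n.1
  else classesStep n.1 n.2.2.1

/-! ### Primitive recursiveness of the evaluation graph -/

section

variable {α : Type} [Primcodable α] {g : α → Ctx} {c d : α → ℕ} {env : α → List ℕ}
  {acts hist : α → List ActCode} {V : α → List Approx} {m : α → ℕ}

@[fun_prop] theorem primrec_foStep (hg : Primrec g) (hc : Primrec c) (henv : Primrec env)
    (hacts : Primrec acts) (hhist : Primrec hist) (hm : Primrec m) :
    Primrec fun a => foStep (g a) (c a) (env a) (acts a) (hist a) (m a) := by
  unfold foStep
  fun_prop

@[fun_prop] theorem primrec_fluentStep (hg : Primrec g) (hc : Primrec c) (henv : Primrec env)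
    (hhist : Primrec hist) (hm : Primrec m) :
    Primrec fun a => fluentStep (g a) (c a) (env a) (hist a) (m a) := by
  unfold fluentStep
  fun_prop

@[fun_prop] theorem primrec_muStep (hg : Primrec g) (hc : Primrec c) (henv : Primrec env)
    (hhist : Primrec hist) (hV : Primrec V) (hm : Primrec m) :
    Primrec fun a => muStep (g a) (c a) (env a) (hist a) (V a) (m a) := by
  unfold muStep
  fun_prop

@[fun_prop] theorem primrec_liveStep (hg : Primrec g) (hc : Primrec c)
    (hhist : Primrec hist) (hm : Primrec m) :
    Primrec fun a => liveStep (g a) (c a) (hist a) (m a) := by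
  unfold liveStep
  fun_prop

@[fun_prop] theorem primrec_diaStep (hg : Primrec g) (hc : Primrec c) (henv : Primrec env)
    (hhist : Primrec hist) (hV : Primrec V) (hm : Primrec m) :
    Primrec fun a => diaStep (g a) (c a) (env a) (hist a) (V a) (m a) := by
  unfold diaStep
  fun_prop

@[fun_prop] theorem primrec_possAndStep (hg : Primrec g) (hc : Primrec c) (henv : Primrec env)
    (hhist : Primrec hist) (hV : Primrec V) (hm : Primrec m) :
    Primrec fun a => possAndStep (g a) (c a) (env a) (hist a) (V a) (m a) := by
  unfold possAndStep
  fun_prop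

@[fun_prop] theorem primrec_occursStep (hg : Primrec g) (hc : Primrec c) :
    Primrec fun a => occursStep (g a) (c a) := by
  unfold occursStep
  fun_prop

@[fun_prop] theorem primrec_occursInStep (hg : Primrec g) (hc : Primrec c) (hd : Primrec d) :
    Primrec fun a => occursInStep (g a) (c a) (d a) := by
  unfold occursInStep
  fun_prop

@[fun_prop] theorem primrec_clashStep (hg : Primrec g) : Primrec fun a => clashStep (g a) := by
  unfold clashStep
  fun_prop

@[fun_prop] theorem primrec_entailsDBStep (hg : Primrec g) (hc : Primrec c) :
    Primrec fun a => entailsDBStep (g a) (c a) := by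
  unfold entailsDBStep
  fun_prop

@[fun_prop] theorem primrec_consistentStep (hg : Primrec g) :
    Primrec fun a => consistentStep (g a) := by
  unfold consistentStep
  fun_prop

@[fun_prop] theorem primrec_impliesStep (hg : Primrec g) (hc : Primrec c) :
    Primrec fun a => impliesStep (g a) (c a) := by
  unfold impliesStep
  fun_prop

@[fun_prop] theorem primrec_entailsStep (hg : Primrec g) (hc : Primrec c) :
    Primrec fun a => entailsStep (g a) (c a) := by
  unfold entailsStep
  fun_prop

@[fun_prop] theorem primrec_classesStep (hg : Primrec g) (hc : Primrec c) :
    Primrec fun a => classesStep (g a) (c a) := by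
  unfold classesStep
  fun_prop

end

theorem primrec_next : Primrec next := by
  unfold next
  fun_prop

/-- The context that is coded by a list of numbers that starts with the code of a theory. -/
def parse (x : ℕ) (I : DB) : Ctx :=
  ((toList ((toList ((toList x).getD 0 0)).getD 0 0), toList ((toList ((toList x).getD 0 0)).getD 1 0)),
    (toList ((toList ((toList x).getD 0 0)).getD 2 0), toList ((toList ((toList x).getD 0 0)).getD 3 0),
      toList ((toList ((toList x).getD 0 0)).getD 4 0)), I, x)

@[fun_prop] theorem primrec_parse {α : Type} [Primcodable α] {f : α → ℕ} {h : α → DB}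
    (hf : Primrec f) (hh : Primrec h) : Primrec fun a => parse (f a) (h a) := by
  unfold parse
  fun_prop


end SitCalc

namespace SitCalc

variable {σ : Signature}

/-! ### Deciding propositions by the evaluation graph -/

/-- The value of the node `n` is the truth value of `P`. -/
structure Decides (n : Node) (P : Prop) : Prop where
  pos : P → Ev next n true
  neg : ¬ P → Ev next n false

/-- The literal `p` is true if and only if `P` is. -/
structure DecidesLit (p : Bool × Node) (P : Prop) : Prop where
  pos : P → Ev next p.2 p.1
  neg : ¬ P → Ev next p.2 (!p.1)

theorem Decides.lit {n : Node} {P : Prop} (h : Decides n P) : DecidesLit (true, n) P := ⟨h.1, h.2⟩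

theorem Decides.lit_not {n : Node} {P : Prop} (h : Decides n P) : DecidesLit (false, n) (¬ P) :=
  ⟨h.2, fun hP => h.1 (not_not.1 hP)⟩

theorem Decides.congr {n : Node} {P Q : Prop} (h : Decides n P) (hPQ : Q ↔ P) : Decides n Q :=
  ⟨fun hQ => h.1 (hPQ.1 hQ), fun hQ => h.2 fun hP => hQ (hPQ.2 hP)⟩

/-- The value of a node depends only on its successors. This identifies an outer predicate variable
with itself seen through a longer stack. -/
theorem Ev.congr_next {n n' : Node} (hn : next n = next n') {v : Bool} (h : Ev next n' v) :
    Ev next n v := by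
  rcases h with ⟨hv, h⟩ | ⟨hv, hp, h⟩
  · exact .all (hn ▸ hv) (hn ▸ h)
  · exact .some (hn ▸ hv) (hn ▸ hp) h

theorem Decides.congr_next {n n' : Node} {P : Prop} (h : Decides n' P) (hn : next n = next n') :
    Decides n P :=
  ⟨fun hP => (h.1 hP).congr_next hn, fun hP => (h.2 hP).congr_next hn⟩

theorem decides_of_answer {n : Node} {P : Prop} {b : Bool} (hn : next n = answer b)
    (hP : P ↔ b = true) : Decides n P := by
  have h : Ev next n b := .all (by rw [hn]) (by rw [hn]; simp)
  constructor
  · intro h'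
    rwa [hP.1 h'] at h
  · intro h'
    rwa [Bool.eq_false_iff.2 fun e => h' (hP.2 e)] at h

/-- Disjunction is written dually: the default value is false, required when every listed node is
false, and a single true node reverses it. -/
theorem decides_of_exists {n : Node} {P : Prop} {α : Type*} {l : List α} {f : α → Node}
    {Q : α → Prop} (hn : next n = (false, l.map fun a => (false, f a)))
    (hl : ∀ a ∈ l, Decides (f a) (Q a)) (hP : P ↔ ∃ a ∈ l, Q a) : Decides n P where
  pos h := by
    obtain ⟨a, ha, hQ⟩ := hP.1 h
    exact .some (p := (false, f a)) (by rw [hn]; rfl)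
      (by rw [hn]; exact List.mem_map_of_mem (f := fun a => (false, f a)) ha) ((hl a ha).1 hQ)
  neg h := by
    refine .all (by rw [hn]) ?_
    rw [hn]
    intro p hp
    obtain ⟨a, ha, rfl⟩ := List.mem_map.1 hp
    exact (hl a ha).2 fun hQ => h (hP.2 ⟨a, ha, hQ⟩)

theorem decides_of_forall {n : Node} {P : Prop} {α : Type*} {l : List α} {f : α → Node}
    {Q : α → Prop} (hn : next n = (true, l.map fun a => (true, f a)))
    (hl : ∀ a ∈ l, Decides (f a) (Q a)) (hP : P ↔ ∀ a ∈ l, Q a) : Decides n P where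
  pos h := by
    refine .all (by rw [hn]) ?_
    rw [hn]
    intro p hp
    obtain ⟨a, ha, rfl⟩ := List.mem_map.1 hp
    exact (hl a ha).1 (hP.1 h a ha)
  neg h := by
    rw [hP] at h
    push Not at h
    obtain ⟨a, ha, hQ⟩ := h
    exact .some (p := (true, f a)) (by rw [hn]; rfl)
      (by rw [hn]; exact List.mem_map_of_mem (f := fun a => (true, f a)) ha) ((hl a ha).2 hQ)

theorem decides_of_one {n n' : Node} {P : Prop} (hn : next n = (true, [(true, n')]))
    (h : Decides n' P) : Decides n P where
  pos hP := .all (by rw [hn]) (by rw [hn]; simpa using h.1 hP)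
  neg hP := .some (p := (true, n')) (by rw [hn]; rfl) (by rw [hn]; simp) (h.2 hP)

theorem decides_of_not {n n' : Node} {P : Prop} (hn : next n = (true, [(false, n')]))
    (h : Decides n' P) : Decides n (¬ P) where
  pos hP := .all (by rw [hn]) (by rw [hn]; simpa using h.2 hP)
  neg hP := .some (p := (false, n')) (by rw [hn]; rfl) (by rw [hn]; simp) (h.1 (not_not.1 hP))

theorem decides_of_and {n n₁ n₂ : Node} {P Q : Prop}
    (hn : next n = (true, [(true, n₁), (true, n₂)])) (h₁ : Decides n₁ P) (h₂ : Decides n₂ Q) :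
    Decides n (P ∧ Q) where
  pos hP := .all (by rw [hn]) (by rw [hn]; simpa using ⟨h₁.1 hP.1, h₂.1 hP.2⟩)
  neg hP := by
    by_cases h : P
    · exact .some (p := (true, n₂)) (by rw [hn]; rfl) (by rw [hn]; simp)
        (h₂.2 fun hQ => hP ⟨h, hQ⟩)
    · exact .some (p := (true, n₁)) (by rw [hn]; rfl) (by rw [hn]; simp) (h₁.2 h)

theorem decides_of_or {n n₁ n₂ : Node} {P Q : Prop}
    (hn : next n = (false, [(false, n₁), (false, n₂)])) (h₁ : Decides n₁ P) (h₂ : Decides n₂ Q) :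
    Decides n (P ∨ Q) where
  pos hP := by
    rcases hP with hP | hP
    · exact .some (p := (false, n₁)) (by rw [hn]; rfl) (by rw [hn]; simp) (h₁.1 hP)
    · exact .some (p := (false, n₂)) (by rw [hn]; rfl) (by rw [hn]; simp) (h₂.1 hP)
  neg hP := .all (by rw [hn]) (by
    rw [hn]
    simpa using ⟨h₁.2 fun h => hP (Or.inl h), h₂.2 fun h => hP (Or.inr h)⟩)

/-! ### Codes of the objects of the canonical model -/

/-- The context for the theory `D` and the database `I`. -/
def ctxOf (D : BAT σ) (I : DB) (W : ℕ) : Ctx :=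
  ((σ.fluents, σ.actions), (D.init.map FOForm.code, List.ofFn fun A => (D.pre A).code,
    List.ofFn fun F => (D.ssa F).code), I, W)

/-- The list of the values of the object variables. -/
def envCode {n : ℕ} (x : Fin n → ULift.{u} ℕ) : List ℕ := List.ofFn fun i => (x i).down

/-- The code of an action of the canonical model. -/
def actCode (a : CanonAct.{u} σ) : ActCode := (a.1, envCode a.2)

theorem getD_ofFn {α : Type*} {n : ℕ} (f : Fin n → α) (i : Fin n) (d : α) :
    (List.ofFn f).getD i d = f i := by
  simp [List.getD]

@[simp] theorem envCode_cons {n : ℕ} (d : ULift.{u} ℕ) (x : Fin n → ULift.{u} ℕ) :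
    envCode (Fin.cons d x : Fin (n + 1) → ULift.{u} ℕ) = d.down :: envCode x := by
  simp [envCode, List.ofFn_succ]

theorem envCode_getD {n : ℕ} (x : Fin n → ULift.{u} ℕ) (i : Fin n) :
    (envCode x).getD i 0 = (x i).down := getD_ofFn _ i 0

theorem envCode_injective {n : ℕ} : Function.Injective (envCode : (Fin n → ULift.{u} ℕ) → List ℕ) :=
  fun _ _ h => funext fun i => ULift.ext _ _ (congrFun (List.ofFn_injective h) i)

theorem actCode_injective : Function.Injective (actCode : CanonAct.{u} σ → ActCode) := by
  rintro ⟨A, x⟩ ⟨B, y⟩ h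
  obtain ⟨h₁, h₂⟩ := Prod.ext_iff.1 h
  obtain rfl : A = B := Fin.ext h₁
  obtain rfl : x = y := envCode_injective h₂
  rfl

theorem OTerm.termValue_code {D : BAT σ} {I : DB} {n : ℕ} (t : OTerm n) (ht : t.consts ⊆ D.consts)
    (x : Fin n → ULift.{u} ℕ) :
    termValue I (envCode x) t.code = (t.eval (canon.{u} D I).const x).down := by
  cases t with
  | var i => simpa [termValue, OTerm.code, OTerm.eval] using envCode_getD x i
  | const c =>
    have hc : c ∈ D.consts := ht (by simp [OTerm.consts])
    simp [termValue, OTerm.code, OTerm.eval, canonConst_of_mem hc]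

theorem map_termValue_ofFn {D : BAT σ} {I : DB} {n k : ℕ} (args : Fin k → OTerm n)
    (ht : ∀ i, (args i).consts ⊆ D.consts) (x : Fin n → ULift.{u} ℕ) :
    ((List.ofFn fun i => (args i).code).map fun t => termValue I (envCode x) t) =
      envCode fun i => (args i).eval (canon.{u} D I).const x := by
  rw [List.map_ofFn, envCode]
  exact congrArg List.ofFn (funext fun i => (args i).termValue_code (ht i) x)

theorem ATerm.actionValue_code {D : BAT σ} {I : DB} {n m : ℕ} (t : ATerm σ n m)
    (ht : t.consts ⊆ D.consts) (x : Fin n → ULift.{u} ℕ) (y : Fin m → CanonAct.{u} σ) :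
    actionValue I (envCode x) (List.ofFn fun i => actCode (y i)) t.code =
      actCode (t.eval (canon.{u} D I) x y) := by
  cases t with
  | var i =>
    simp only [actionValue, ATerm.code, ATerm.eval, Nat.unpair_pair, decide_true, cond_true]
    exact getD_ofFn (fun i => actCode (y i)) i _
  | app A args =>
    have h := map_termValue_ofFn (I := I) args (fun i c hc => ht (by
      simp only [ATerm.consts, Finset.mem_biUnion]
      exact ⟨i, Finset.mem_univ _, hc⟩)) x
    simp only [actionValue, ATerm.code, ATerm.eval, Nat.unpair_pair, one_ne_zero, decide_false,
      cond_false, toList_encode, h]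
    rfl

theorem envCode_mem_tuples {n m : ℕ} {x : Fin n → ULift.{u} ℕ} :
    envCode x ∈ tuples m n ↔ ∀ i, (x i).down < m := by
  rw [mem_tuples, envCode]
  simp

theorem exists_envCode {n m : ℕ} {t : List ℕ} (ht : t ∈ tuples m n) :
    ∃ x : Fin n → ULift.{u} ℕ, t = envCode x ∧ ∀ i, (x i).down < m := by
  have h : ∃ x : Fin n → ULift.{u} ℕ, t = envCode x := by
    obtain ⟨rfl, -⟩ := mem_tuples.1 ht
    exact ⟨fun i => ⟨t.get i⟩, (List.ofFn_get t).symm⟩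
  obtain ⟨x, rfl⟩ := h
  exact ⟨x, rfl, envCode_mem_tuples.1 ht⟩

theorem length_actCode (a : CanonAct.{u} σ) : (actCode a).2.length = σ.arA a.1 := by
  simp [actCode, envCode]

theorem mem_actionsBelow {c : ActCode} {m : ℕ} : c ∈ actionsBelow σ.actions m ↔
    ∃ a : CanonAct.{u} σ, c = actCode a ∧ ∀ i, (a.2 i).down < m + σ.arA a.1 := by
  simp only [actionsBelow, List.mem_flatMap, List.mem_range, List.mem_map]
  constructor
  · rintro ⟨A, hA, t, ht, rfl⟩
    rw [List.getD_eq_getElem _ _ hA] at ht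
    obtain ⟨x, rfl, hx⟩ := exists_envCode.{u} ht
    exact ⟨⟨⟨A, hA⟩, x⟩, rfl, hx⟩
  · rintro ⟨⟨A, x⟩, rfl, hx⟩
    refine ⟨A, A.2, envCode x, ?_, rfl⟩
    rw [List.getD_eq_getElem _ _ A.2]
    exact envCode_mem_tuples.2 hx

/-- All the parameters of an action are smaller than `m`. -/
def ActBelow (a : CanonAct.{u} σ) (m : ℕ) : Prop := ∀ i, (a.2 i).down < m

/-! ### Quantifiers in the canonical model can be bounded -/

section

variable {D : BAT σ} {I : DB}

/-- The common source of all bounds on quantifiers: a tuple of arbitrary objects can be replaced by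
one with entries below `m + k`, without moving any object below `m` and without changing the
situation up to correspondence. -/
theorem exists_tuple_below (hI : InjConsts D I) {m : ℕ} (hm : I.Below m)
    {s : List (CanonAct.{u} σ)} (hs : HistBelow s m) {k : ℕ} (d : Fin k → ULift.{u} ℕ) :
    ∃ (H : Set (ULift.{u} ℕ × ULift.{u} ℕ)) (d' : Fin k → ULift.{u} ℕ),
      idBelow m ⊆ H ∧ (∀ i, (d' i).down < m + k) ∧ (∀ i, (d i, d' i) ∈ H) ∧
      Corr D (canon.{u} D I) (canon.{u} D I) H s s := by
  obtain ⟨H, hsub, hH, d', hd, hlt⟩ := exists_extend_below (pbij_idBelow.{u} m)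
    (fun p hp => hp.1 ▸ hp.2) d
  exact ⟨H, d', hsub, hlt, hd, (corr_idBelow hI hm s hs).mono hsub hH⟩

theorem exists_action_below (hI : InjConsts D I) {m : ℕ} (hm : I.Below m)
    {s : List (CanonAct.{u} σ)} (hs : HistBelow s m) (a : CanonAct.{u} σ) :
    ∃ (H : Set (ULift.{u} ℕ × ULift.{u} ℕ)) (a' : CanonAct.{u} σ),
      idBelow m ⊆ H ∧ ActBelow a' (m + σ.arA a'.1) ∧
      ActRel (canon.{u} D I) (canon.{u} D I) H a a' ∧
      Corr D (canon.{u} D I) (canon.{u} D I) H s s := by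
  obtain ⟨H, d', hsub, hlt, hd, hC⟩ := exists_tuple_below hI hm hs a.2
  exact ⟨H, ⟨a.1, d'⟩, hsub, hlt, ⟨a.1, a.2, d', rfl, rfl, hd⟩, hC⟩

theorem exists_object_below (hI : InjConsts D I) {m : ℕ} (hm : I.Below m)
    {s : List (CanonAct.{u} σ)} (hs : HistBelow s m) (d : ULift.{u} ℕ) :
    ∃ (H : Set (ULift.{u} ℕ × ULift.{u} ℕ)) (d' : ULift.{u} ℕ),
      idBelow m ⊆ H ∧ d'.down < m + 1 ∧ (d, d') ∈ H ∧
      Corr D (canon.{u} D I) (canon.{u} D I) H s s := by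
  obtain ⟨H, d', hsub, hlt, hd, hC⟩ := exists_tuple_below hI hm hs fun _ : Fin 1 => d
  exact ⟨H, d' 0, hsub, hlt 0, hd 0, hC⟩

end


end SitCalc

namespace SitCalc

variable {σ : Signature}

/-! ### Occurrences of constants -/

theorem OTerm.code_eq_iff {n : ℕ} (t : OTerm n) (c : ℕ) : t.code = Nat.pair 1 c ↔ c ∈ t.consts := by
  cases t with
  | var i => simp [OTerm.code, OTerm.consts, Nat.pair_eq_pair]
  | const c' => simp [OTerm.code, OTerm.consts, Nat.pair_eq_pair, eq_comm]

theorem mem_ofFn_code_iff {n k : ℕ} (args : Fin k → OTerm n) (c : ℕ) :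
    Nat.pair 1 c ∈ (List.ofFn fun i => (args i).code) ↔ ∃ i, c ∈ (args i).consts := by
  simp [List.mem_ofFn, OTerm.code_eq_iff]

theorem ATerm.occursInAction_code {n m : ℕ} (t : ATerm σ n m) (c : ℕ) :
    occursInAction c t.code = true ↔ c ∈ t.consts := by
  cases t with
  | var i => simp [occursInAction, ATerm.code, ATerm.consts]
  | app A args =>
    simp only [occursInAction, ATerm.code, ATerm.consts, Nat.unpair_pair, toList_encode,
      Finset.mem_biUnion, Finset.mem_univ, true_and, ← mem_ofFn_code_iff]
    simp

theorem decides_occursIn (g : Ctx) (c : ℕ) {n m : ℕ} (φ : FOForm σ n m) :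
    Decides (occursInNode g c φ.code) (c ∈ φ.consts) := by
  have hnext : next (occursInNode g c φ.code) = occursInStep g c φ.code := rfl
  induction φ with
  | fluent F args =>
    refine decides_of_answer (b := decide (Nat.pair 1 c ∈ List.ofFn fun i => (args i).code))
      (hnext.trans (by simp [occursInStep, FOForm.code])) ?_
    rw [decide_eq_true_iff, mem_ofFn_code_iff]
    simp [FOForm.consts]
  | eqO t₁ t₂ =>
    refine decides_of_answer (b := decide (t₁.code = Nat.pair 1 c) || decide (t₂.code = Nat.pair 1 c))
      (hnext.trans (by simp [occursInStep, FOForm.code])) ?_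
    simp [FOForm.consts, OTerm.code_eq_iff]
  | eqA a₁ a₂ =>
    refine decides_of_answer (b := occursInAction c a₁.code || occursInAction c a₂.code)
      (hnext.trans (by simp [occursInStep, FOForm.code])) ?_
    simp [FOForm.consts, ATerm.occursInAction_code]
  | neg φ ih => exact decides_of_one (hnext.trans (by simp [occursInStep, FOForm.code])) (ih rfl)
  | and φ ψ ih₁ ih₂ =>
    exact (decides_of_or (hnext.trans (by simp [occursInStep, FOForm.code])) (ih₁ rfl)
      (ih₂ rfl)).congr (by simp [FOForm.consts])
  | exO φ ih => exact decides_of_one (hnext.trans (by simp [occursInStep, FOForm.code])) (ih rfl)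
  | exA φ ih => exact decides_of_one (hnext.trans (by simp [occursInStep, FOForm.code])) (ih rfl)

/-- Codes record neither the signature nor the number of variables, so the question is asked about
any formula with the given code. Uniqueness of values shows that formulas with equal codes have the
same constants. -/
theorem decides_occurs (D : BAT σ) (I : DB) (W c : ℕ) :
    Decides (occursNode (ctxOf D I W) c) (c ∈ D.consts) := by
  have hcode : ∀ φ ∈ (ctxOf D I W).2.1.1 ++ (ctxOf D I W).2.1.2.1 ++ (ctxOf D I W).2.1.2.2,
      ∃ (n m : ℕ) (ψ : FOForm σ n m), φ = ψ.code := by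
    intro φ hφ
    simp only [ctxOf, List.mem_append, List.mem_map, List.mem_ofFn] at hφ
    rcases hφ with (⟨ψ, -, rfl⟩ | ⟨A, rfl⟩) | ⟨F, rfl⟩
    · exact ⟨_, _, ψ, rfl⟩
    · exact ⟨_, _, D.pre A, rfl⟩
    · exact ⟨_, _, D.ssa F, rfl⟩
  refine decides_of_exists (n := occursNode (ctxOf D I W) c)
    (l := (ctxOf D I W).2.1.1 ++ (ctxOf D I W).2.1.2.1 ++ (ctxOf D I W).2.1.2.2)
    (Q := fun φ => ∃ (n m : ℕ) (ψ : FOForm σ n m), φ = ψ.code ∧ c ∈ ψ.consts) rfl ?_ ?_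
  · intro φ hφ
    obtain ⟨n, m, ψ, rfl⟩ := hcode φ hφ
    have h := decides_occursIn (ctxOf D I W) c ψ
    refine ⟨?_, fun h' => h.2 fun hc => h' ⟨n, m, ψ, rfl, hc⟩⟩
    rintro ⟨n', m', ψ', e, hc⟩
    rw [e]
    exact (decides_occursIn (ctxOf D I W) c ψ').1 hc
  · rw [D.mem_consts_iff]
    constructor
    · rintro (⟨φ, hφ, hc⟩ | ⟨A, hc⟩ | ⟨F, hc⟩)
      · refine ⟨φ.code, ?_, _, _, φ, rfl, hc⟩
        exact List.mem_append_left _ (List.mem_append_left _ (List.mem_map_of_mem hφ))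
      · refine ⟨_, ?_, _, _, D.pre A, rfl, hc⟩
        exact List.mem_append_left _ (List.mem_append_right _ (List.mem_ofFn.2 ⟨A, rfl⟩))
      · refine ⟨_, ?_, _, _, D.ssa F, rfl, hc⟩
        exact List.mem_append_right _ (List.mem_ofFn.2 ⟨F, rfl⟩)
    · rintro ⟨φ, hφ, n, m, ψ, rfl, hc⟩
      -- two formulas with the same code have the same constants
      have key : ∀ {n' m' : ℕ} (χ : FOForm σ n' m'), χ.code = ψ.code → c ∈ χ.consts := by
        intro n' m' χ e
        by_contra hχ
        have h₁ := (decides_occursIn (ctxOf D I W) c χ).2 hχ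
        rw [e] at h₁
        exact Bool.false_ne_true (h₁.unique ((decides_occursIn (ctxOf D I W) c ψ).1 hc))
      simp only [ctxOf, List.mem_append, List.mem_map, List.mem_ofFn] at hφ
      rcases hφ with (⟨χ, hχ, e⟩ | ⟨A, e⟩) | ⟨F, e⟩
      · exact Or.inl ⟨χ, hχ, key χ e⟩
      · exact Or.inr (Or.inl ⟨A, key _ e⟩)
      · exact Or.inr (Or.inr ⟨F, key _ e⟩)

/-- All constants of the theory are below `W`, so it suffices to compare pairs below `W` and then to
ask which of them occur. -/
theorem decides_clash {D : BAT σ} {I : DB} {W : ℕ} (hW : ∀ c ∈ D.consts, c < W) :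
    Decides (clashNode (ctxOf D I W)) (¬ InjConsts D I) := by
  let l : List (ℕ × ℕ) := (List.range W).flatMap fun c => (List.range W).flatMap fun c' =>
    bif decide (I.value c = I.value c') && !decide (c = c') then [(c, c')] else []
  have hl : ∀ p : ℕ × ℕ, p ∈ l ↔ (p.1 < W ∧ p.2 < W) ∧ I.value p.1 = I.value p.2 ∧ p.1 ≠ p.2 := by
    rintro ⟨c, c'⟩
    simp only [l, List.mem_flatMap, List.mem_range]
    constructor
    · rintro ⟨a, ha, b, hb, h⟩
      cases hab : decide (I.value a = I.value b) && !decide (a = b) with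
      | false => simp [hab] at h
      | true =>
        simp only [hab, cond_true, List.mem_singleton, Prod.mk.injEq] at h
        obtain ⟨rfl, rfl⟩ := h
        simpa [ha, hb] using hab
    · rintro ⟨⟨hc, hc'⟩, h, hne⟩
      exact ⟨c, hc, c', hc', by simp [show I.value c = I.value c' from h, show c ≠ c' from hne]⟩
  refine decides_of_exists (l := l) (f := fun p => occurBothNode (ctxOf D I W) p.1 p.2)
    (Q := fun p => p.1 ∈ D.consts ∧ p.2 ∈ D.consts) ?_ ?_ ?_
  · change clashStep (ctxOf D I W) = _
    simp only [clashStep, l, List.map_flatMap]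
    congr 2
    funext c
    congr 1
    funext c'
    change (bif decide (I.value c = I.value c') && !decide (c = c') then _ else _) = _
    cases decide (I.value c = I.value c') && !decide (c = c') <;> rfl
  · exact fun p _ => decides_of_and rfl (decides_occurs D I W p.1) (decides_occurs D I W p.2)
  · simp only [InjConsts, hl]
    constructor
    · intro h
      push Not at h
      obtain ⟨c, hc, c', hc', h, hne⟩ := h
      exact ⟨(c, c'), ⟨⟨hW c hc, hW c' hc'⟩, h, hne⟩, hc, hc'⟩
    · rintro ⟨p, ⟨-, h, hne⟩, hc, hc'⟩ hinj
      exact hne (hinj _ hc _ hc' h)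

/-! ### First-order formulas -/

section

variable {D : BAT σ} {I : DB} {W : ℕ}

/-- The evaluation of the fluents after the actions `s` is correct. -/
def FluentsDecided (D : BAT σ) (I : DB) (W : ℕ) (s : List (CanonAct.{u} σ)) : Prop :=
  ∀ m, I.Below m → HistBelow s m → ∀ (F : σ.Fl) x, (∀ i, (x i).down < m) →
    Decides (fluentNode (ctxOf D I W) F (envCode x) (s.map actCode) m) (canonFluent D I s F x)

theorem ActBelow.rel {D : BAT σ} {I : DB} {a : CanonAct.{u} σ} {m : ℕ} (h : ActBelow a m) :
    ActRel (canon.{u} D I) (canon.{u} D I) (idBelow m) a a :=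
  ⟨a.1, a.2, a.2, rfl, rfl, fun i => ⟨rfl, h i⟩⟩

/-- Induction on the formula for one fixed history, with the fluents at that history as the base
case. The bound `m` grows under quantifiers to cover the new values. -/
theorem decides_fo_of (hI : InjConsts D I) {s : List (CanonAct.{u} σ)}
    (hP : FluentsDecided D I W s) {n k : ℕ} (φ : FOForm σ n k) : φ.consts ⊆ D.consts →
    ∀ (m : ℕ) (x : Fin n → ULift.{u} ℕ) (y : Fin k → CanonAct.{u} σ), I.Below m → HistBelow s m →
      (∀ i, (x i).down < m) → (∀ i, ActBelow (y i) m) →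
      Decides (foNode (ctxOf D I W) φ.code (envCode x) (List.ofFn fun i => actCode (y i))
        (s.map actCode) m) (φ.Holds (canon D I) s x y) := by
  have hnext : ∀ (c env acts m), next (foNode (ctxOf D I W) c env acts (s.map actCode) m) =
    foStep (ctxOf D I W) c env acts (s.map actCode) m := fun _ _ _ _ => rfl
  have hdb : (ctxOf D I W).2.2.1 = I := rfl
  have hM := canon_dynModel.{u} hI
  induction φ with
  | fluent F args =>
    intro hφ m x y hm hs hx hy
    have hargs : ∀ i, (args i).consts ⊆ D.consts :=
      fun i => (FOForm.consts_arg_subset (m := 0) i).trans hφ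
    refine decides_of_one ((hnext _ _ _ _).trans ?_) (hP m hm hs F
      (fun i => (args i).eval (canon.{u} D I).const x) fun i => ?_)
    · simp only [foStep, FOForm.code, Nat.unpair_pair, decide_true, cond_true, hdb, toList_encode,
        map_termValue_ofFn (I := I) args hargs x]
    · exact (OTerm.eval_rel (corr_idBelow hI hm s hs).consts (args i) (hargs i)
        fun j => ⟨rfl, hx j⟩).2
  | eqO t₁ t₂ =>
    intro hφ m x y hm hs hx hy
    refine decides_of_answer
      (b := same (t₁.eval (canon.{u} D I).const x).down (t₂.eval (canon.{u} D I).const x).down)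
      ((hnext _ _ _ _).trans ?_) ?_
    · simp [foStep, FOForm.code, hdb, t₁.termValue_code (Finset.union_subset_left hφ) x,
        t₂.termValue_code (Finset.union_subset_right hφ) x]
    · simp only [same, decide_eq_true_iff, FOForm.Holds]
      exact ⟨fun e => congrArg ULift.down e, fun e => ULift.ext _ _ e⟩
  | eqA a₁ a₂ =>
    intro hφ m x y hm hs hx hy
    refine decides_of_answer
      (b := same (actCode (a₁.eval (canon D I) x y)) (actCode (a₂.eval (canon D I) x y)))
      ((hnext _ _ _ _).trans ?_) ?_
    · simp [foStep, FOForm.code, hdb, a₁.actionValue_code (Finset.union_subset_left hφ) x y,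
        a₂.actionValue_code (Finset.union_subset_right hφ) x y]
    · simp only [same, decide_eq_true_iff, FOForm.Holds]
      exact actCode_injective.eq_iff.symm
  | neg φ ih =>
    intro hφ m x y hm hs hx hy
    exact decides_of_not ((hnext _ _ _ _).trans (by simp [foStep, FOForm.code]))
      (ih hφ m x y hm hs hx hy)
  | and φ ψ ih₁ ih₂ =>
    intro hφ m x y hm hs hx hy
    exact decides_of_and ((hnext _ _ _ _).trans (by simp [foStep, FOForm.code]))
      (ih₁ (Finset.union_subset_left hφ) m x y hm hs hx hy)
      (ih₂ (Finset.union_subset_right hφ) m x y hm hs hx hy)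
  | exO φ ih =>
    intro hφ m x y hm hs hx hy
    refine decides_of_exists (l := List.range (m + 1))
      (f := fun d => foNode (ctxOf D I W) φ.code (d :: envCode x) (List.ofFn fun i => actCode (y i))
        (s.map actCode) (m + 1)) (Q := fun d => φ.Holds (canon D I) s (Fin.cons ⟨d⟩ x) y)
      ((hnext _ _ _ _).trans (by simp [foStep, FOForm.code])) ?_ ?_
    · intro d hd
      rw [List.mem_range] at hd
      have := ih hφ (m + 1) (Fin.cons ⟨d⟩ x) y (hm.mono m.le_succ) (hs.mono m.le_succ)
        (fun i => Fin.cases hd (fun i => (hx i).trans m.lt_succ_self) i)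
        (fun i j => (hy i j).trans m.lt_succ_self)
      rwa [envCode_cons] at this
    · constructor
      · rintro ⟨d, hd⟩
        -- An arbitrary witness is replaced by a small one; the other values lie below `m` and are
        -- fixed, so the truth of the formula is preserved.
        obtain ⟨H, d', hsub, hlt, hdd', hC⟩ := exists_object_below hI hm hs d
        refine ⟨d'.down, List.mem_range.2 hlt, ?_⟩
        refine (hC.holds_iff hM hM (φ := φ) hφ (x := Fin.cons d x) (x' := Fin.cons d' x)
          (fun i => Fin.cases hdd' (fun i => hsub ⟨rfl, hx i⟩) i)
          fun i => ((hy i).rel.mono hsub)).1 hd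
      · rintro ⟨d, -, hd⟩
        exact ⟨⟨d⟩, hd⟩
  | exA φ ih =>
    intro hφ m x y hm hs hx hy
    refine decides_of_exists (l := actionsBelow σ.actions m)
      (f := fun a => foNode (ctxOf D I W) φ.code (envCode x)
        (a :: List.ofFn fun i => actCode (y i)) (s.map actCode) (m + a.2.length))
      (Q := fun c => ∃ a, c = actCode a ∧ φ.Holds (canon D I) s x (Fin.cons a y))
      ((hnext _ _ _ _).trans (by simp [foStep, FOForm.code, ctxOf])) ?_ ?_
    · intro c hc
      obtain ⟨a, rfl, ha⟩ := mem_actionsBelow.1 hc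
      have hle : m ≤ m + σ.arA a.1 := Nat.le_add_right _ _
      have := ih hφ (m + σ.arA a.1) x (Fin.cons a y) (hm.mono hle) (hs.mono hle) (fun i => (hx i).trans_le hle)
        (fun i => Fin.cases ha (fun i j => (hy i j).trans_le hle) i)
      rw [List.ofFn_succ] at this
      simp only [length_actCode]
      refine this.congr ⟨?_, fun h => ⟨a, rfl, h⟩⟩
      rintro ⟨b, hb, h⟩
      rwa [actCode_injective hb]
    · constructor
      · rintro ⟨a, ha⟩
        obtain ⟨H, a', hsub, hlt, haa', hC⟩ := exists_action_below hI hm hs a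
        refine ⟨actCode a', mem_actionsBelow.2 ⟨a', rfl, hlt⟩, a', rfl, ?_⟩
        exact (hC.holds_iff hM hM (φ := φ) hφ (y := Fin.cons a y) (y' := Fin.cons a' y)
          (fun i => hsub ⟨rfl, hx i⟩)
          fun i => Fin.cases haa' (fun i => ((hy i).rel.mono hsub)) i).1 ha
      · rintro ⟨c, -, a, -, ha⟩
        exact ⟨a, ha⟩

/-- Regression: a fluent after the last action is a first-order question about the shorter history,
so induction on the history terminates. -/
theorem fluentsDecided (hI : InjConsts D I) : ∀ s : List (CanonAct.{u} σ), FluentsDecided D I W s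
  | [], m, _, _, F, x, _ => by
    refine decides_of_answer (b := decide (envCode x ∈ I.1.getD F [])) rfl ?_
    rw [decide_eq_true_iff]
    exact Iff.rfl
  | a :: s, m, hm, hs, F, x, hx => by
    have h := decides_fo_of (W := W) hI (fluentsDecided hI s) (D.ssa F) (D.ssa_consts_subset F) m x
      (fun _ => a) hm (fun b hb => hs b (List.mem_cons_of_mem _ hb)) hx
      fun _ => hs a List.mem_cons_self
    refine decides_of_one ?_ (h.congr (FOForm.holds_canon D I s (D.ssa F) x fun _ => a).symm)
    change (true, [(true, foNode (ctxOf D I W) ((List.ofFn fun F => (D.ssa F).code).getD F 0)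
      (envCode x) [actCode a] (s.map actCode) m)]) = _
    rw [getD_ofFn]
    simp

theorem decides_fo (hI : InjConsts D I) {n k : ℕ} {φ : FOForm σ n k} (hφ : φ.consts ⊆ D.consts)
    {s : List (CanonAct.{u} σ)} {m : ℕ} (hm : I.Below m) (hs : HistBelow s m)
    {x : Fin n → ULift.{u} ℕ} (hx : ∀ i, (x i).down < m) {y : Fin k → CanonAct.{u} σ}
    (hy : ∀ i, ActBelow (y i) m) :
    Decides (foNode (ctxOf D I W) φ.code (envCode x) (List.ofFn fun i => actCode (y i))
      (s.map actCode) m) (φ.Holds (canon D I) s x y) :=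
  decides_fo_of hI (fluentsDecided hI s) φ hφ m x y hm hs hx hy

end


end SitCalc

namespace SitCalc

variable {σ : Signature} {D : BAT σ} {I : DB} {W : ℕ}

/-! ### Live objects and possible actions -/

theorem mem_envCode {n : ℕ} {x : Fin n → ULift.{u} ℕ} {d : ULift.{u} ℕ} :
    d.down ∈ envCode x ↔ ∃ i, x i = d := by
  rw [envCode, List.mem_ofFn]
  exact exists_congr fun i => ⟨fun e => ULift.ext _ _ e, fun e => congrArg ULift.down e⟩

theorem mem_liveStep {d : ULift.{u} ℕ} {hist : List ActCode} {m : ℕ} {p : Bool × Node} :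
    p ∈ (liveStep (ctxOf D I W) d.down hist m).2 ↔
      (∃ (F : σ.Fl) (x : Fin (σ.arF F) → ULift.{u} ℕ), (∀ i, (x i).down < m + σ.arF F) ∧
        (∃ i, x i = d) ∧
        p = (false, fluentNode (ctxOf D I W) F (envCode x) hist (m + σ.arF F))) ∨
      ∃ c < W, I.value c = d.down ∧ p = (false, occursNode (ctxOf D I W) c) := by
  have hfl : (ctxOf D I W).1.1 = σ.fluents := rfl
  have hWW : (ctxOf D I W).2.2.2 = W := rfl
  have hdb : (ctxOf D I W).2.2.1 = I := rfl
  have hif : ∀ (b : Bool) (q : Bool × Node), (p ∈ bif b then [q] else []) ↔ b = true ∧ p = q := by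
    intro b q
    cases b <;> simp
  simp only [liveStep, List.mem_append, List.mem_flatMap, List.mem_range, hif, decide_eq_true_iff,
    hfl, hWW, hdb]
  refine or_congr ⟨?_, ?_⟩ (exists_congr fun c => Iff.rfl)
  · rintro ⟨F, hF, t, ht, hd, rfl⟩
    rw [List.getD_eq_getElem _ _ hF] at ht ⊢
    obtain ⟨x, rfl, hx⟩ := exists_envCode.{u} ht
    exact ⟨⟨F, hF⟩, x, hx, mem_envCode.1 hd, rfl⟩
  · rintro ⟨F, x, hx, hd, rfl⟩
    refine ⟨F, F.2, envCode x, ?_⟩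
    rw [List.getD_eq_getElem _ _ F.2]
    exact ⟨envCode_mem_tuples.2 hx, mem_envCode.2 hd, rfl⟩

theorem decides_live (hI : InjConsts D I) (hW : ∀ c ∈ D.consts, c < W)
    {s : List (CanonAct.{u} σ)} {m : ℕ} (hm : I.Below m) (hs : HistBelow s m) {d : ULift.{u} ℕ}
    (hd : d.down < m) : Decides (liveNode (ctxOf D I W) d.down (s.map actCode) m)
      (d ∈ (canon.{u} D I).adom D.consts s) := by
  have hnext : next (liveNode (ctxOf D I W) d.down (s.map actCode) m) =
    liveStep (ctxOf D I W) d.down (s.map actCode) m := rfl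
  rw [Structure.mem_adom_iff]
  constructor
  · rintro (⟨F, x, hF, i, rfl⟩ | ⟨c, hc, rfl⟩)
    -- Since the live object is below `m`, the replacement fixes it, and the small tuple still
    -- contains it.
    · obtain ⟨H, x', hsub, hlt, hxx', hC⟩ := exists_tuple_below hI hm hs x
      have hx' : x' i = x i := ((hC.pbij.eq_iff (hsub ⟨rfl, hd⟩) (hxx' i)).1 rfl).symm
      refine .some (p := (false, fluentNode (ctxOf D I W) F (envCode x') (s.map actCode)
        (m + σ.arF F))) rfl (hnext ▸ mem_liveStep.2 (Or.inl ⟨F, x', hlt, ⟨i, hx'⟩, rfl⟩)) ?_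
      exact (fluentsDecided hI s _ (hm.mono (Nat.le_add_right _ _)) (hs.mono (Nat.le_add_right _ _))
        F x' hlt).1 ((hC.fluents H subset_rfl hC.pbij F x x' hxx').1 hF)
    · refine .some (p := (false, occursNode (ctxOf D I W) c)) rfl (hnext ▸ mem_liveStep.2
        (Or.inr ⟨c, hW c hc, (canonConst_of_mem hc).symm, rfl⟩)) ?_
      exact (decides_occurs D I W c).1 hc
  · intro h
    refine .all rfl fun p hp => ?_
    rw [hnext, mem_liveStep] at hp
    rcases hp with ⟨F, x, hx, ⟨i, hi⟩, rfl⟩ | ⟨c, -, hc, rfl⟩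
    · exact (fluentsDecided hI s _ (hm.mono (Nat.le_add_right _ _)) (hs.mono (Nat.le_add_right _ _))
        F x hx).2 fun hF => h (Or.inl ⟨F, x, hF, i, hi⟩)
    · refine (decides_occurs D I W c).2 fun hcC => h (Or.inr ⟨c, hcC, ?_⟩)
      exact ULift.ext _ _ ((canonConst_of_mem hcC).trans hc)

/-- An action with large parameters can be exchanged for one with small parameters, because `S` is
invariant under correspondences that fix the objects below `m`. `S` must be decided for larger
bounds, since the action may introduce fresh objects. -/
theorem decides_dia (hI : InjConsts D I) {c : ℕ} {env : List ℕ} {V : List Approx}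
    {S : Set (List (CanonAct.{u} σ))} {m : ℕ} (hm : I.Below m)
    (hc : ∀ m' s, m ≤ m' → HistBelow s m' →
      Decides (muNode (ctxOf D I W) c env (s.map actCode) V m') (s ∈ S))
    (hS : ∀ H s s', idBelow m ⊆ H → Corr D (canon.{u} D I) (canon.{u} D I) H s s' →
      (s ∈ S ↔ s' ∈ S)) {s : List (CanonAct.{u} σ)} (hs : HistBelow s m) :
    Decides (diaNode (ctxOf D I W) c env (s.map actCode) V m)
      (∃ a, (canon.{u} D I).Poss a s ∧ a :: s ∈ S) := by
  have hM := canon_dynModel.{u} hI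
  refine decides_of_exists (l := actionsBelow σ.actions m)
    (f := fun a => possAndNode (ctxOf D I W) c env (a :: s.map actCode) V (m + a.2.length))
    (Q := fun c => ∃ a, c = actCode a ∧ (canon.{u} D I).Poss a s ∧ a :: s ∈ S) rfl ?_ ?_
  · intro b hb
    obtain ⟨a, rfl, ha⟩ := mem_actionsBelow.1 hb
    have hle : m ≤ m + σ.arA a.1 := Nat.le_add_right _ _
    have hpre := decides_fo (W := W) hI (D.pre_consts_subset a.1) (hm.mono hle) (hs.mono hle) ha
      (y := Fin.elim0) fun i => i.elim0
    have hmu := hc (m + σ.arA a.1) (a :: s) hle fun b hb => by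
      rcases List.mem_cons.1 hb with rfl | hb
      exacts [ha, hs.mono hle b hb]
    rw [length_actCode]
    have h := decides_of_and (n := possAndNode (ctxOf D I W) c env (actCode a :: s.map actCode) V
      (m + σ.arA a.1)) ?_ hpre hmu
    · refine h.congr ⟨?_, fun h => ⟨a, rfl, (hM.2.2.2.1 a.1 a.2 s).2 h.1, h.2⟩⟩
      rintro ⟨a', e, h₁, h₂⟩
      obtain rfl := actCode_injective e
      exact ⟨(hM.2.2.2.1 a.1 a.2 s).1 h₁, h₂⟩
    · change (true, [(true, foNode (ctxOf D I W) ((List.ofFn fun A => (D.pre A).code).getD a.1 0)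
        (envCode a.2) [] (s.map actCode) (m + σ.arA a.1)), _]) = _
      rw [getD_ofFn]
      rfl
  · constructor
    · rintro ⟨a, ha, haS⟩
      obtain ⟨H, a', hsub, hlt, haa', hC⟩ := exists_action_below hI hm hs a
      exact ⟨actCode a', mem_actionsBelow.2 ⟨a', rfl, hlt⟩, a', rfl,
        (hC.poss_iff hM hM haa').1 ha, (hS H _ _ hsub (hC.do hM hM haa')).1 haS⟩
    · rintro ⟨c, -, a, -, ha⟩
      exact ⟨a, ha⟩

theorem decides_live_and (hI : InjConsts D I) (hW : ∀ c ∈ D.consts, c < W)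
    {s : List (CanonAct.{u} σ)} {m n : ℕ} (hm : I.Below m) (hs : HistBelow s m)
    {x : Fin n → ULift.{u} ℕ} (hx : ∀ i, (x i).down < m) (X : List (Fin n)) {N N' : Node} {b : Bool}
    {P : Prop} (hN' : DecidesLit (b, N') P)
    (hN : next N = (true, (b, N') :: (X.map Fin.val).map fun i =>
      (true, liveNode (ctxOf D I W) ((envCode x).getD i 0) (s.map actCode) m))) :
    Decides N ((∀ i ∈ X, x i ∈ (canon.{u} D I).adom D.consts s) ∧ P) := by
  have hlive : ∀ i, Decides (liveNode (ctxOf D I W) ((envCode x).getD (i : Fin n) 0)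
      (s.map actCode) m) (x i ∈ (canon.{u} D I).adom D.consts s) := fun i => by
    rw [envCode_getD]
    exact decides_live hI hW hm hs (hx i)
  have hmem : ∀ i ∈ X, (true, liveNode (ctxOf D I W) ((envCode x).getD (i : Fin n) 0)
      (s.map actCode) m) ∈ (next N).2 := fun i hi => by
    rw [hN, List.map_map]
    exact List.mem_cons_of_mem _ (List.mem_map.2 ⟨i, hi, rfl⟩)
  constructor
  · rintro ⟨hX, hP⟩
    refine .all (by rw [hN]) fun p hp => ?_
    rw [hN, List.map_map] at hp
    rcases List.mem_cons.1 hp with rfl | hp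
    · exact hN'.1 hP
    · obtain ⟨i, hi, rfl⟩ := List.mem_map.1 hp
      exact (hlive i).1 (hX i hi)
  · intro h
    by_cases hP : P
    · have hX : ¬ ∀ i ∈ X, x i ∈ (canon.{u} D I).adom D.consts s := fun hX => h ⟨hX, hP⟩
      push Not at hX
      obtain ⟨i, hi, hxi⟩ := hX
      exact .some (by rw [hN]; rfl) (hmem i hi) ((hlive i).2 hxi)
    · exact .some (p := (b, N')) (by rw [hN]; rfl) (by rw [hN]; exact List.mem_cons_self)
        (hN'.2 hP)

/-! ### Formulas of the mu-calculus -/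

/-- The evaluation of the predicate variables is correct. -/
def PredsDecided (D : BAT σ) (I : DB) (W : ℕ) (m : ℕ) {k : ℕ} (V : List Approx)
    (S : Fin k → Set (List (CanonAct.{u} σ))) : Prop :=
  ∀ (Z : Fin k) env m' s, m ≤ m' → HistBelow s m' →
    Decides (muNode (ctxOf D I W) (Nat.pair 6 Z) env (s.map actCode) V m') (s ∈ S Z)

theorem PredsDecided.mono {m m' k : ℕ} {V : List Approx} {S : Fin k → Set (List (CanonAct.{u} σ))}
    (h : PredsDecided D I W m V S) (hm : m ≤ m') : PredsDecided D I W m' V S :=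
  fun Z env m₁ s h₁ => h Z env m₁ s (hm.trans h₁)

/-- Pushing an entry shifts the outer variables by one; the step for a variable reads only its own
entry and the stack beneath it, so their nodes keep their successors. -/
theorem PredsDecided.cons {m k : ℕ} {V : List Approx} {S : Fin k → Set (List (CanonAct.{u} σ))}
    (h : PredsDecided D I W m V S) {c i : ℕ} {env : List ℕ} {E : Set (List (CanonAct.{u} σ))}
    (hE : ∀ env' m' s, m ≤ m' → HistBelow s m' →
      Decides (muNode (ctxOf D I W) (Nat.pair 6 0) env' (s.map actCode) ((c, env, i) :: V) m')
        (s ∈ E)) :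
    PredsDecided D I W m ((c, env, i) :: V) (Fin.cons E S : Fin (k + 1) → Set _) := by
  intro Z
  refine Fin.cases hE (fun Z env' m' s hm hs => ?_) Z
  refine (h Z env' m' s hm hs).congr_next ?_
  change muStep (ctxOf D I W) (Nat.pair 6 (Z + 1)) env' (s.map actCode) ((c, env, i) :: V) m' =
    muStep (ctxOf D I W) (Nat.pair 6 Z) env' (s.map actCode) V m'
  simp [muStep]

/-- Evaluation is correct for the semantics by approximants, without any use of boundedness. The
invariance hypothesis on `S` is what allows witnesses and actions to be replaced by small ones under
predicate variables. -/
theorem decides_mu (hI : InjConsts D I) (hW : ∀ c ∈ D.consts, c < W) {n k : ℕ}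
    (Φ : MuForm σ n k) : Φ.consts ⊆ D.consts → ∀ {m : ℕ} {x : Fin n → ULift.{u} ℕ}
      {V : List Approx} {S : Fin k → Set (List (CanonAct.{u} σ))}, I.Below m →
      (∀ i, (x i).down < m) → PredsDecided D I W m V S →
      PredRel D (canon.{u} D I) (canon.{u} D I) (idBelow m) S S →
      ∀ {s}, HistBelow s m →
      Decides (muNode (ctxOf D I W) Φ.code (envCode x) (s.map actCode) V m)
        (s ∈ Φ.aext (canon.{u} D I) D.consts (typeBound W + 1) x S) := by
  have hnext : ∀ (c env) (s : List (CanonAct.{u} σ)) (V m),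
    next (muNode (ctxOf D I W) c env (s.map actCode) V m) =
      muStep (ctxOf D I W) c env (s.map actCode) V m := fun _ _ _ _ _ => rfl
  have hM := canon_dynModel.{u} hI
  induction Φ with
  | fo φ =>
    intro hΦ m x V S hm hx hV hS s hs
    have h : Decides (foNode (ctxOf D I W) φ.code (envCode x) [] (s.map actCode) m)
        (φ.Holds (canon.{u} D I) s x Fin.elim0) := by
      simpa using decides_fo (W := W) hI hΦ hm hs hx (y := Fin.elim0) fun i => i.elim0
    exact decides_of_one ((hnext _ _ _ _ _).trans (by simp [muStep, MuForm.code])) h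
  | neg Φ ih =>
    intro hΦ m x V S hm hx hV hS s hs
    exact decides_of_not ((hnext _ _ _ _ _).trans (by simp [muStep, MuForm.code]))
      (ih hΦ hm hx hV hS hs)
  | and Φ Ψ ih₁ ih₂ =>
    intro hΦ m x V S hm hx hV hS s hs
    exact decides_of_and ((hnext _ _ _ _ _).trans (by simp [muStep, MuForm.code]))
      (ih₁ (Finset.union_subset_left hΦ) hm hx hV hS hs)
      (ih₂ (Finset.union_subset_right hΦ) hm hx hV hS hs)
  | exLive Φ ih =>
    intro hΦ m x V S hm hx hV hS s hs
    refine decides_of_exists (l := List.range (m + 1))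
      (f := fun d => liveAndNode (ctxOf D I W) Φ.code (d :: envCode x) (s.map actCode) V (m + 1))
      (Q := fun d => (⟨d⟩ : ULift.{u} ℕ) ∈ (canon.{u} D I).adom D.consts s ∧
        s ∈ Φ.aext (canon.{u} D I) D.consts (typeBound W + 1) (Fin.cons ⟨d⟩ x) S)
      ((hnext _ _ _ _ _).trans (by simp [muStep, MuForm.code])) ?_ ?_
    · intro d hd
      rw [List.mem_range] at hd
      have h := ih hΦ (hm.mono m.le_succ) (x := Fin.cons ⟨d⟩ x)
        (fun i => Fin.cases hd (fun i => (hx i).trans m.lt_succ_self) i) (hV.mono m.le_succ)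
        (hS.mono (idBelow_mono m.le_succ)) (hs.mono m.le_succ)
      rw [envCode_cons] at h
      exact decides_of_and rfl
        (decides_live hI hW (d := ⟨d⟩) (hm.mono m.le_succ) (hs.mono m.le_succ) hd) h
    · constructor
      · rintro ⟨d, hd, hsd⟩
        obtain ⟨H, d', hsub, hlt, hdd', hC⟩ := exists_object_below hI hm hs d
        refine ⟨d'.down, List.mem_range.2 hlt, (hC.mem_adom_iff hM hM hdd').1 hd, ?_⟩
        exact (Φ.mem_aext_iff hM hM _ hΦ (x := Fin.cons d x) (x' := Fin.cons d' x)
          (fun i => Fin.cases hdd' (fun i => hsub ⟨rfl, hx i⟩) i) (hS.mono hsub) hC).1 hsd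
      · rintro ⟨d, -, hd⟩
        exact ⟨⟨d⟩, hd⟩
  | dia X Φ ih =>
    intro hΦ m x V S hm hx hV hS s hs
    have hdia := decides_dia hI hm (c := Φ.code) (env := envCode x) (V := V)
      (S := Φ.aext (canon.{u} D I) D.consts (typeBound W + 1) x S)
      (fun m' s hm' hs => ih hΦ (hm.mono hm') (fun i => (hx i).trans_le hm') (hV.mono hm')
        (hS.mono (idBelow_mono hm')) hs)
      (fun H s s' hsub hC => Φ.mem_aext_iff hM hM _ hΦ (fun i => hsub ⟨rfl, hx i⟩) (hS.mono hsub) hC)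
      hs
    exact decides_live_and hI hW hm hs hx X hdia.lit
      ((hnext _ _ _ _ _).trans (by simp [muStep, MuForm.code]))
  | box X Φ ih =>
    intro hΦ m x V S hm hx hV hS s hs
    have hdia := decides_dia hI hm (c := Nat.pair 1 Φ.code) (env := envCode x) (V := V)
      (S := (Φ.aext (canon.{u} D I) D.consts (typeBound W + 1) x S)ᶜ)
      (fun m' s hm' hs => decides_of_not ((hnext _ _ _ _ _).trans (by simp [muStep]))
        (ih hΦ (hm.mono hm') (fun i => (hx i).trans_le hm') (hV.mono hm')
          (hS.mono (idBelow_mono hm')) hs))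
      (fun H s s' hsub hC => not_congr (Φ.mem_aext_iff hM hM _ hΦ (fun i => hsub ⟨rfl, hx i⟩)
        (hS.mono hsub) hC)) hs
    refine (decides_live_and hI hW hm hs hx X hdia.lit_not
      ((hnext _ _ _ _ _).trans (by simp [muStep, MuForm.code]))).congr (and_congr_right' ?_)
    push Not
    exact forall₂_congr fun a _ => not_not.symm
  | pvar Z => exact fun _ m x V S hm hx hV hS s hs => hV Z (envCode x) m s le_rfl hs
  | mu Φ ih =>
    intro hΦ m x V S hm hx hV hS s hs
    let T : ℕ → Set (List (CanonAct.{u} σ)) := fun i => (fun E =>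
      Φ.aext (canon.{u} D I) D.consts (typeBound W + 1) x (Fin.cons E S))^[i] ∅
    -- If the variable is evaluated correctly at index `i`, then the body yields iterate `i + 1`.
    -- Together with the empty set at index 0, this settles all indices by induction, although the
    -- syntax does not decrease.
    have hstep : ∀ i, PredsDecided D I W m ((Φ.code, envCode x, i) :: V)
        (Fin.cons (T i) S : Fin (_ + 1) → Set _) → ∀ m' s, m ≤ m' → HistBelow s m' →
        Decides (muNode (ctxOf D I W) Φ.code (envCode x) (s.map actCode)
          ((Φ.code, envCode x, i) :: V) m') (s ∈ T (i + 1)) := by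
      intro i h m' s hm' hs
      change Decides _ (s ∈ (fun E => Φ.aext (canon.{u} D I) D.consts (typeBound W + 1) x
        (Fin.cons E S))^[i + 1] ∅)
      rw [Function.iterate_succ_apply']
      exact ih hΦ (hm.mono hm') (fun i => (hx i).trans_le hm') (h.mono hm')
        ((hS.cons fun H s s' hsub hC => Φ.mem_iterate_aext_iff hM hM _ hΦ
          (H := idBelow m) (fun i => ⟨rfl, hx i⟩) hS i H s s' hsub hC).mono (idBelow_mono hm')) hs
    have hpred : ∀ i, PredsDecided D I W m ((Φ.code, envCode x, i) :: V)
        (Fin.cons (T i) S : Fin (_ + 1) → Set _) := by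
      intro i
      induction i with
      | zero =>
        refine hV.cons fun env' m' s _ _ => decides_of_answer (b := false)
          ((hnext _ _ _ _ _).trans (by simp [muStep])) ?_
        simp [T]
      | succ i ihi =>
        refine hV.cons fun env' m' s hm' hs =>
          decides_of_one ((hnext _ _ _ _ _).trans ?_) (hstep i ihi m' s hm' hs)
        simp [muStep]
    refine decides_of_one ((hnext _ _ _ _ _).trans ?_)
      (hstep (typeBound W) (hpred _) m s le_rfl hs)
    simp [muStep, MuForm.code, ctxOf]


end SitCalc

namespace SitCalc

variable {σ : Signature} {D : BAT σ}

/-! ### The size of a theory -/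

theorem le_encode_of_mem {a : ℕ} {l : List ℕ} (h : a ∈ l) : a ≤ Encodable.encode l :=
  encode_le_of_mem h

theorem OTerm.lt_code {n c : ℕ} {t : OTerm n} (h : c ∈ t.consts) : c < t.code := by
  cases t with
  | var i => simp [OTerm.consts] at h
  | const c' =>
    obtain rfl : c = c' := by simpa [OTerm.consts] using h
    have := Nat.add_le_pair 1 c
    simp only [OTerm.code]
    omega

theorem lt_encode_ofFn_code {n k c : ℕ} {args : Fin k → OTerm n}
    (h : c ∈ Finset.univ.biUnion fun i => (args i).consts) :
    c < Encodable.encode (List.ofFn fun i => (args i).code) := by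
  obtain ⟨i, -, hi⟩ := Finset.mem_biUnion.1 h
  exact (OTerm.lt_code hi).trans_le (le_encode_of_mem (List.mem_ofFn.2 ⟨i, rfl⟩))

theorem ATerm.lt_code {n m c : ℕ} {t : ATerm σ n m} (h : c ∈ t.consts) : c < t.code := by
  cases t with
  | var i => simp [ATerm.consts] at h
  | app A args =>
    exact (lt_encode_ofFn_code h).trans_le
      ((Nat.right_le_pair _ _).trans (Nat.right_le_pair _ _))

theorem FOForm.lt_code {n m c : ℕ} {φ : FOForm σ n m} : c ∈ φ.consts → c < φ.code := by
  induction φ with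
  | fluent F args =>
    exact fun h => (lt_encode_ofFn_code h).trans_le
      ((Nat.right_le_pair _ _).trans (Nat.right_le_pair _ _))
  | eqO t₁ t₂ =>
    intro h
    rcases Finset.mem_union.1 h with h | h
    · exact (OTerm.lt_code h).trans_le ((Nat.left_le_pair _ _).trans (Nat.right_le_pair _ _))
    · exact (OTerm.lt_code h).trans_le ((Nat.right_le_pair _ _).trans (Nat.right_le_pair _ _))
  | eqA t₁ t₂ =>
    intro h
    rcases Finset.mem_union.1 h with h | h
    · exact (ATerm.lt_code h).trans_le ((Nat.left_le_pair _ _).trans (Nat.right_le_pair _ _))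
    · exact (ATerm.lt_code h).trans_le ((Nat.right_le_pair _ _).trans (Nat.right_le_pair _ _))
  | neg φ ih => exact fun h => (ih h).trans_le (Nat.right_le_pair _ _)
  | and φ ψ ih₁ ih₂ =>
    intro h
    rcases Finset.mem_union.1 h with h | h
    · exact (ih₁ h).trans_le ((Nat.left_le_pair _ _).trans (Nat.right_le_pair _ _))
    · exact (ih₂ h).trans_le ((Nat.right_le_pair _ _).trans (Nat.right_le_pair _ _))
  | exO φ ih => exact fun h => (ih h).trans_le (Nat.right_le_pair _ _)
  | exA φ ih => exact fun h => (ih h).trans_le (Nat.right_le_pair _ _)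

/-- The numbers that matter in the theory, and `b`, are bounded by `W`. -/
structure BAT.Fits (D : BAT σ) (b W : ℕ) : Prop where
  bound : b ≤ W
  consts : ∀ c ∈ D.consts, c < W
  fluents : σ.fluents.length ≤ W
  arity : ∀ F, σ.arF F ≤ W

/-- A single number above the code dominates constants, arities and the number of fluents, since
codes dominate the codes of their parts. -/
theorem BAT.fits_of_code_le {b W : ℕ} (hD : D.code ≤ W) (hb : b ≤ W) : D.Fits b W := by
  have hmem : ∀ l : List ℕ, Encodable.encode l ∈ [Encodable.encode σ.fluents,
      Encodable.encode σ.actions, Encodable.encode (D.init.map FOForm.code),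
      Encodable.encode (List.ofFn fun A => (D.pre A).code),
      Encodable.encode (List.ofFn fun F => (D.ssa F).code)] → Encodable.encode l ≤ W :=
    fun l hl => (le_encode_of_mem hl).trans hD
  have hcode : ∀ (l : List ℕ), Encodable.encode l ≤ W → ∀ {n m c} {φ : FOForm σ n m},
      φ.code ∈ l → c ∈ φ.consts → c < W := fun l hl _ _ _ _ hφ hc =>
    (FOForm.lt_code hc).trans_le ((le_encode_of_mem hφ).trans hl)
  refine ⟨hb, fun c hc => ?_, ?_, fun F => ?_⟩
  · rcases D.mem_consts_iff.1 hc with ⟨φ, hφ, hc⟩ | ⟨A, hc⟩ | ⟨F, hc⟩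
    · exact hcode _ (hmem _ (by simp)) (List.mem_map_of_mem hφ) hc
    · exact hcode _ (hmem (List.ofFn fun A => (D.pre A).code) (by simp))
        (List.mem_ofFn.2 ⟨A, rfl⟩) hc
    · exact hcode _ (hmem (List.ofFn fun F => (D.ssa F).code) (by simp))
        (List.mem_ofFn.2 ⟨F, rfl⟩) hc
  · exact (Encodable.length_le_encode _).trans (hmem _ (by simp))
  · exact (le_encode_of_mem (List.get_mem _ _)).trans (hmem σ.fluents (by simp))

/-- The whole input serves as the bound `W`: it exceeds the codes of all its components, so no
separate bound has to be computed. -/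
theorem parse_encode (D : BAT σ) (l : List ℕ) (I : DB) :
    parse (Encodable.encode (D.code :: l)) I = ctxOf D I (Encodable.encode (D.code :: l)) := by
  simp only [parse, toList_encode, List.getD_cons_zero, BAT.code, List.getD_cons_succ]
  rfl

/-! ### Candidates -/

theorem activeIso_of_injOn {C : Finset ℕ} {I : Interp.{u} σ} {J : Interp.{v} σ} (e : I.Dom → J.Dom)
    (he : Set.InjOn e (I.adom C))
    (hF : ∀ F y, J.fluent F y ↔ ∃ x, I.fluent F x ∧ ∀ i, y i = e (x i))
    (hc : ∀ c ∈ C, J.const c = e (I.const c)) : ActiveIso C I J := by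
  have hbij : Set.BijOn e (I.adom C) (J.adom C) := by
    refine ⟨?_, he, ?_⟩
    · rintro d (⟨F, x, hx, i, rfl⟩ | ⟨c, hcC, rfl⟩)
      · exact Or.inl ⟨F, fun i => e (x i), (hF F _).2 ⟨x, hx, fun _ => rfl⟩, i, rfl⟩
      · exact Or.inr ⟨c, hcC, hc c hcC⟩
    · rintro d (⟨F, y, hy, i, rfl⟩ | ⟨c, hcC, rfl⟩)
      · obtain ⟨x, hx, hxy⟩ := (hF F y).1 hy
        exact ⟨x i, Or.inl ⟨F, x, hx, i, rfl⟩, (hxy i).symm⟩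
      · exact ⟨I.const c, Or.inr ⟨c, hcC, rfl⟩, (hc c hcC).symm⟩
  refine ⟨hbij.equiv e, fun F x => ?_, fun c hcC => (hc c hcC).symm⟩
  change I.fluent F (fun i => (x i : I.Dom)) ↔ J.fluent F fun i => e (x i)
  rw [hF]
  refine ⟨fun h => ⟨_, h, fun _ => rfl⟩, ?_⟩
  rintro ⟨y, hy, hxy⟩
  have : (fun i => (x i : I.Dom)) = y :=
    funext fun i => he (x i).2 (Or.inl ⟨F, y, hy, i, rfl⟩) (hxy i)
  rwa [this]

theorem value_map_range {W c : ℕ} (hc : c < W) :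
    (((List.range W).map fun c => (c, c)).lookup c).getD 0 = c := by
  cases h : ((List.range W).map fun c => (c, c)).lookup c with
  | none =>
    rw [List.lookup_eq_none_iff] at h
    have := h (c, c) (List.mem_map.2 ⟨c, List.mem_range.2 hc, rfl⟩)
    simp at this
  | some d =>
    obtain ⟨a, -, ha⟩ := List.mem_map.1 (mem_of_lookup_eq_some h)
    simp only [Prod.mk.injEq] at ha
    simp [← ha.1, ← ha.2]

theorem Structure.BoundedSit.exists_cover {M : Structure.{u} σ} [Nonempty M.Obj] {b : ℕ}
    {s : M.Sit} (h : M.BoundedSit b s) :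
    ∃ g : (Σ F : σ.Fl, Fin b × Fin (σ.arF F)) → M.Obj,
      ∀ F x, M.fluent F x s → ∀ i, ∃ t, g t = x i := by
  choose g hg using fun F => h.exists_enum F
  refine ⟨fun t => g t.1 t.2.1 t.2.2, fun F x hx i => ?_⟩
  obtain ⟨k, hk⟩ := hg F x hx
  exact ⟨⟨F, k, i⟩, congrFun hk i⟩

theorem Structure.BoundedSit.finite_adom {M : Structure.{u} σ} [Nonempty M.Obj] {b : ℕ}
    {s : M.Sit} (h : M.BoundedSit b s) (C : Finset ℕ) : (M.adom C s).Finite := by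
  obtain ⟨g, hg⟩ := h.exists_cover
  refine ((Set.finite_range g).union (C.finite_toSet.image M.const)).subset ?_
  rintro d (⟨F, x, hx, i, rfl⟩ | ⟨c, hc, rfl⟩)
  · exact Or.inl (hg F x hx i)
  · exact Or.inr ⟨c, hc, rfl⟩

theorem BAT.Fits.card_positions_le {b W : ℕ} (h : D.Fits b W) :
    Fintype.card (Σ F : σ.Fl, Fin b × Fin (σ.arF F)) ≤ W * W * W := by
  simp only [Fintype.card_sigma, Fintype.card_prod, Fintype.card_fin]
  calc ∑ F : σ.Fl, b * σ.arF F ≤ ∑ _F : σ.Fl, W * W :=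
        Finset.sum_le_sum fun F _ => Nat.mul_le_mul h.bound (h.arity F)
    _ = σ.fluents.length * (W * W) := by simp
    _ ≤ W * (W * W) := Nat.mul_le_mul_right _ h.fluents
    _ = W * W * W := by ring

/-- The objects of the active domain of a bounded situation can be named by small numbers, with each
constant naming itself. -/
theorem BAT.Fits.exists_naming {b W : ℕ} (hW : D.Fits b W) {M : Structure.{u} σ}
    (hM : M.UniqueNames) {s : M.Sit} (hb : M.BoundedSit b s) :
    ∃ e : M.Obj → ℕ, Set.InjOn e (M.adom D.consts s) ∧
      (∀ d ∈ M.adom D.consts s, e d < W + W * W * W) ∧ ∀ c ∈ D.consts, e (M.const c) = c := by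
  classical
  have : Nonempty M.Obj := ⟨M.const 0⟩
  obtain ⟨g, hg⟩ := hb.exists_cover
  have hconst : Function.Injective M.const := fun c d e => by_contra fun hne => hM c d hne e
  let ι := Fintype.equivFin (Σ F : σ.Fl, Fin b × Fin (σ.arF F))
  -- Constants take precedence and name themselves; other live objects are named by a position in a
  -- fluent, shifted by `W` to avoid the constants. Objects outside the active domain may receive
  -- the default 0.
  let e : M.Obj → ℕ := fun d =>
    if h : ∃ c ∈ D.consts, M.const c = d then h.choose
    else if h : ∃ t, g t = d then W + ι h.choose else 0
  have he₁ : ∀ c ∈ D.consts, e (M.const c) = c := fun c hc => by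
    have h : ∃ c' ∈ D.consts, M.const c' = M.const c := ⟨c, hc, rfl⟩
    simp only [e, dif_pos h]
    exact hconst h.choose_spec.2
  have he₂ : ∀ d ∈ M.adom D.consts s, (∃ c ∈ D.consts, M.const c = d) ∨
      ∃ t, g t = d ∧ e d = W + ι t := by
    intro d hd
    by_cases h : ∃ c ∈ D.consts, M.const c = d
    · exact Or.inl h
    · rcases hd with ⟨F, x, hx, i, rfl⟩ | hd
      · have h' := hg F x hx i
        refine Or.inr ⟨h'.choose, h'.choose_spec, ?_⟩
        simp only [e, dif_neg h, dif_pos h']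
      · exact absurd hd h
  refine ⟨e, fun d hd d' hd' h => ?_, fun d hd => ?_, he₁⟩
  · rcases he₂ d hd with ⟨c, hc, rfl⟩ | ⟨t, rfl, ht⟩ <;>
      rcases he₂ d' hd' with ⟨c', hc', rfl⟩ | ⟨t', rfl, ht'⟩
    · rw [he₁ c hc, he₁ c' hc'] at h
      rw [h]
    · rw [he₁ c hc, ht'] at h
      have := hW.consts c hc
      omega
    · rw [he₁ c' hc', ht] at h
      have := hW.consts c' hc'
      omega
    · rw [ht, ht'] at h
      rw [ι.injective (Fin.ext (Nat.add_left_cancel h))]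
  · rcases he₂ d hd with ⟨c, hc, rfl⟩ | ⟨t, rfl, ht⟩
    · rw [he₁ c hc]
      exact (hW.consts c hc).trans_le (Nat.le_add_right _ _)
    · rw [ht]
      exact Nat.add_lt_add_left ((ι t).2.trans_le hW.card_positions_le) _

/-- Renaming the initial active domain by small numbers turns it into one of the enumerated
databases, and the naming is the isomorphism. -/
theorem BAT.Fits.exists_candidate {b W : ℕ} (hW : D.Fits b W) {M : Structure.{u} σ}
    (hM : M.UniqueNames) (hb : M.BoundedSit b M.S₀) :
    ∃ I ∈ candidates σ.fluents W, D.InClass I M := by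
  classical
  obtain ⟨e, hinj, hlt, hconst⟩ := hW.exists_naming hM hb
  obtain ⟨E, hE, hEt⟩ := exists_mem_extensions (m := W + W * W * W) σ.fluents fun i t =>
    decide (∃ (F : σ.Fl) (x : Fin (σ.arF F) → M.Obj), F.val = i ∧ M.fluent F x M.S₀ ∧
      t = List.ofFn fun i => e (x i))
  have hfl : ∀ (F : σ.Fl) (y : Fin (σ.arF F) → ℕ), List.ofFn y ∈ E.getD F [] ↔
      ∃ x : Fin (σ.arF F) → M.Obj, M.fluent F x M.S₀ ∧ ∀ i, y i = e (x i) := by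
    intro F y
    rw [hEt F F.2, decide_eq_true_iff, mem_tuples]
    constructor
    · rintro ⟨-, F', x, hF, hx, hy⟩
      obtain rfl := Fin.ext hF
      exact ⟨x, hx, fun i => congrFun (List.ofFn_injective hy) i⟩
    · rintro ⟨x, hx, hy⟩
      obtain rfl : y = fun i => e (x i) := funext hy
      refine ⟨⟨List.length_ofFn, fun d hd => ?_⟩, F, x, rfl, hx, rfl⟩
      obtain ⟨i, rfl⟩ := List.mem_ofFn.1 hd
      exact hlt _ (Or.inl ⟨F, x, hx, i, rfl⟩)
  exact ⟨_, List.mem_map_of_mem hE, activeIso_of_injOn e hinj hfl fun c hc =>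
    (value_map_range (hW.consts c hc)).trans (hconst c hc).symm⟩

/-! ### Truth in the canonical model -/

theorem MuForm.trueIn_iff_aext {b W : ℕ} (hW : D.Fits b W) {M : Structure.{u} σ}
    (hM : D.DynModel M) (hb : M.Bounded b) {Φ : MuForm σ 0 0} (hΦ : Φ.Admissible D)
    (hc : Φ.code ≤ W) : Φ.TrueIn D M ↔
      M.S₀ ∈ Φ.aext M D.consts (typeBound W + 1) Fin.elim0 Fin.elim0 :=
  Φ.mem_ext_iff hM hb (W := W) (fun n hn => (card_sitType_le D hW.bound hn hW.consts hW.fluents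
    hW.arity).trans (Nat.le_succ _)) hΦ.1 hΦ.2 (by omega) (fun Z => Z.elim0)
    (fun _ _ Z => Z.elim0) _ hM.1.executable_init

theorem MuForm.trueIn_iff_of_corr {b W : ℕ} (hW : D.Fits b W) {M : Structure.{u} σ}
    {M' : Structure.{v} σ} (hM : D.DynModel M) (hM' : D.DynModel M') (hb : M.Bounded b)
    {H : Set (M.Obj × M'.Obj)} (hC : Corr D M M' H M.S₀ M'.S₀) {Φ : MuForm σ 0 0}
    (hΦ : Φ.Admissible D) (hc : Φ.code ≤ W) : Φ.TrueIn D M ↔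
      M'.S₀ ∈ Φ.aext M' D.consts (typeBound W + 1) Fin.elim0 Fin.elim0 :=
  (Φ.trueIn_iff_aext hW hM hb hΦ hc).trans
    (Φ.mem_aext_iff hM hM' _ hΦ.2 (fun i => i.elim0) (fun Z => Z.elim0) hC)

theorem BAT.DynModel.finite_adom_init {M : Structure.{u} σ} (hM : D.DynModel M) {b : ℕ}
    (hb : M.Bounded b) : (M.adom D.consts M.S₀).Finite :=
  haveI : Nonempty M.Obj := ⟨M.const 0⟩
  (hb _ hM.1.executable_init).finite_adom _

/-- The initial axioms are first-order sentences over `C`, so corresponding initial situations agree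
on them. Consistency with the theory is therefore a property of the class. -/
theorem BAT.model_iff_of_corr {M : Structure.{u} σ} {M' : Structure.{v} σ} (hM : D.DynModel M)
    (hM' : D.DynModel M') {H : Set (M.Obj × M'.Obj)} (hC : Corr D M M' H M.S₀ M'.S₀) :
    D.Model M ↔ D.Model M' := by
  refine (and_iff_right hM).trans (Iff.trans ?_ (and_iff_right hM').symm)
  exact forall₂_congr fun φ hφ => hC.holds_iff hM hM' (D.init_consts_subset hφ)
    (fun i => i.elim0) fun i => i.elim0

variable {I : DB}

theorem canon_modelDB (hI : InjConsts D I) : D.ModelDB I (canon.{u} D I) :=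
  ⟨canon_dynModel hI, canon_inClass D I⟩

theorem BAT.Model.injConsts (h : D.Model (canon.{u} D I)) : InjConsts D I :=
  BAT.ModelDB.injConsts ⟨h.1, canon_inClass D I⟩

theorem BAT.ModelDB.model_iff {M : Structure.{u} σ} (h : D.ModelDB I M) :
    D.Model M ↔ D.Model (canon.{v} D I) := by
  obtain ⟨H, hC⟩ := BAT.InClass.exists_corr.{u, v} h.2
  exact BAT.model_iff_of_corr h.1 (canon_dynModel h.injConsts) hC

/-- Boundedness replaces fixpoints by approximants inside `M`, and the correspondence then moves
them to the canonical model. -/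
theorem BAT.ModelDB.trueIn_iff {b W : ℕ} (hW : D.Fits b W) {M : Structure.{u} σ}
    (h : D.ModelDB I M) (hb : M.Bounded b) {Φ : MuForm σ 0 0} (hΦ : Φ.Admissible D)
    (hc : Φ.code ≤ W) : Φ.TrueIn D M ↔
      [] ∈ Φ.aext (canon.{u} D I) D.consts (typeBound W + 1) Fin.elim0 Fin.elim0 := by
  obtain ⟨H, hC⟩ := BAT.InClass.exists_corr.{u, u} h.2
  exact Φ.trueIn_iff_of_corr hW h.1 (canon_dynModel h.injConsts) hb hC hΦ hc

theorem decides_mu_init {b W : ℕ} (hW : D.Fits b W) (hI : InjConsts D I) {Φ : MuForm σ 0 0}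
    (hΦ : Φ.Admissible D) :
    Decides (muNode (ctxOf D I W) Φ.code [] [] [] (Encodable.encode I + 1))
      ([] ∈ Φ.aext (canon.{u} D I) D.consts (typeBound W + 1) Fin.elim0 Fin.elim0) :=
  decides_mu hI hW.consts Φ hΦ.2 I.below_encode (x := Fin.elim0) (fun i => i.elim0)
    (V := []) (fun Z => Z.elim0) (fun Z => Z.elim0) (s := []) fun a ha => by simp at ha

theorem decides_mu_canon {b W : ℕ} (hW : D.Fits b W) (hI : InjConsts D I)
    (hb : (canon.{u} D I).Bounded b) {Φ : MuForm σ 0 0} (hΦ : Φ.Admissible D) (hc : Φ.code ≤ W) :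
    Decides (muNode (ctxOf D I W) Φ.code [] [] [] (Encodable.encode I + 1))
      (Φ.TrueIn D (canon.{u} D I)) :=
  (decides_mu_init hW hI hΦ).congr ((canon_modelDB hI).trueIn_iff hW hb hΦ hc)

/-! ### The questions -/

/-- If constants clash there are no models and entailment is vacuous. Otherwise all models agree
with the canonical one, which is itself a model. -/
theorem decides_entailsDB {b W : ℕ} (hW : D.Fits b W) (hb : BAT.BoundedByDB.{u} D I b)
    {Φ : MuForm σ 0 0} (hΦ : Φ.Admissible D) (hc : Φ.code ≤ W) :
    Decides (entailsDBNode (ctxOf D I W) Φ.code) (BAT.EntailsDB.{u} D I Φ) := by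
  have hnext : next (entailsDBNode (ctxOf D I W) Φ.code) = (false,
    [(false, clashNode (ctxOf D I W)),
      (false, muNode (ctxOf D I W) Φ.code [] [] [] (Encodable.encode I + 1))]) := rfl
  have hclash := decides_clash (I := I) hW.consts
  by_cases hI : InjConsts D I
  · refine (decides_of_or hnext hclash (decides_mu_init.{u} hW hI hΦ)).congr ?_
    rw [or_iff_right (not_not.2 hI)]
    have hcanon := canon_modelDB.{u} hI
    constructor
    · exact fun h => (hcanon.trueIn_iff hW (hb _ hcanon) hΦ hc).1 (h _ hcanon)
    · exact fun h M hM => (hM.trueIn_iff hW (hb M hM) hΦ hc).2 h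
  · have hE : BAT.EntailsDB.{u} D I Φ := fun M hM => absurd hM.injConsts hI
    refine ⟨fun _ => ?_, fun h => absurd hE h⟩
    exact .some (p := (false, clashNode (ctxOf D I W))) rfl (by rw [hnext]; simp) (hclash.1 hI)

theorem decides_consistent {b W : ℕ} (hW : D.Fits b W) :
    Decides (consistentNode (ctxOf D I W)) (D.Model (canon.{u} D I)) := by
  have hnext : next (consistentNode (ctxOf D I W)) = (true, (false, clashNode (ctxOf D I W)) ::
    (D.init.map FOForm.code).map fun φ =>
      (true, foNode (ctxOf D I W) φ [] [] [] (Encodable.encode I + 1))) := rfl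
  have hclash := decides_clash (I := I) hW.consts
  have hfo : InjConsts D I → ∀ φ ∈ D.init, Decides
      (foNode (ctxOf D I W) φ.code [] [] [] (Encodable.encode I + 1))
      (φ.Holds (canon.{u} D I) [] Fin.elim0 Fin.elim0) := fun hI φ hφ => by
    simpa [envCode] using decides_fo.{u} (W := W) hI (D.init_consts_subset hφ) I.below_encode
      (s := []) (fun a ha => by simp at ha) (x := Fin.elim0) (fun i => i.elim0)
      (y := Fin.elim0) fun i => i.elim0
  constructor
  · intro h
    refine .all rfl ?_
    rw [hnext, List.map_map]
    intro p hp
    rcases List.mem_cons.1 hp with rfl | hp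
    · exact hclash.2 (not_not.2 h.injConsts)
    · obtain ⟨φ, hφ, rfl⟩ := List.mem_map.1 hp
      exact (hfo h.injConsts φ hφ).1 (h.2 φ hφ)
  · intro h
    by_cases hI : InjConsts D I
    · have hex : ¬ ∀ φ ∈ D.init, φ.Holds (canon.{u} D I) [] Fin.elim0 Fin.elim0 :=
        fun hall => h ⟨canon_dynModel hI, hall⟩
      push Not at hex
      obtain ⟨φ, hφ, hn⟩ := hex
      refine .some (p := (true, foNode (ctxOf D I W) φ.code [] [] [] (Encodable.encode I + 1)))
        rfl ?_ ((hfo hI φ hφ).2 hn)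
      rw [hnext, List.map_map]
      exact List.mem_cons_of_mem _ (List.mem_map.2 ⟨φ, hφ, rfl⟩)
    · exact .some (p := (false, clashNode (ctxOf D I W))) rfl (by rw [hnext]; simp) (hclash.1 hI)

theorem decides_implies {b W : ℕ} (hW : D.Fits b W) (hb : BAT.BoundedBy.{u} D b)
    {Φ : MuForm σ 0 0} (hΦ : Φ.Admissible D) (hc : Φ.code ≤ W) :
    Decides (impliesNode (ctxOf D I W) Φ.code)
      (D.Model (canon.{u} D I) → Φ.TrueIn D (canon.{u} D I)) := by
  have hnext : next (impliesNode (ctxOf D I W) Φ.code) = (false,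
    [(true, consistentNode (ctxOf D I W)),
      (false, muNode (ctxOf D I W) Φ.code [] [] [] (Encodable.encode I + 1))]) := rfl
  have hcons := decides_consistent.{u} (I := I) hW
  by_cases h : D.Model (canon.{u} D I)
  · have hmu := decides_mu_canon hW h.injConsts (hb _ h) hΦ hc
    constructor
    · exact fun hP => .some (p := (false, muNode (ctxOf D I W) Φ.code [] [] []
        (Encodable.encode I + 1))) rfl (by rw [hnext]; simp) (hmu.1 (hP h))
    · refine fun hP => .all rfl ?_
      rw [hnext]
      simpa using ⟨hcons.1 h, hmu.2 fun hT => hP fun _ => hT⟩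
  · exact ⟨fun _ => .some (p := (true, consistentNode (ctxOf D I W))) rfl (by rw [hnext]; simp)
      (hcons.2 h), fun hP => absurd (fun h' => absurd h' h) hP⟩

/-- The initial situation is executable, hence bounded, so a candidate describes it; its canonical
model inherits the initial axioms from `M`. -/
theorem BAT.Fits.exists_class {b W : ℕ} (hW : D.Fits b W) (hb : BAT.BoundedBy.{u} D b)
    {M : Structure.{u} σ} (hM : D.Model M) :
    ∃ I ∈ candidates σ.fluents W, D.InClass I M ∧ D.Model (canon.{u} D I) := by
  obtain ⟨I, hI, hcl⟩ := hW.exists_candidate hM.1.2.2.1 (hb M hM _ hM.1.1.executable_init)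
  exact ⟨I, hI, hcl, (BAT.ModelDB.model_iff ⟨hM.1, hcl⟩).1 hM⟩

theorem decides_entails {b W : ℕ} (hW : D.Fits b W) (hb : BAT.BoundedBy.{u} D b)
    {Φ : MuForm σ 0 0} (hΦ : Φ.Admissible D) (hc : Φ.code ≤ W) :
    Decides (entailsNode (ctxOf D I W) Φ.code) (BAT.Entails.{u} D Φ) := by
  refine decides_of_forall (l := candidates σ.fluents W)
    (f := fun J => impliesNode (ctxOf D J W) Φ.code) rfl
    (fun J _ => decides_implies.{u} hW hb hΦ hc) ⟨fun h J _ => h _, fun h M hM => ?_⟩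
  obtain ⟨J, hJ, hcl, hcanon⟩ := hW.exists_class hb hM
  exact (BAT.ModelDB.trueIn_iff hW ⟨hM.1, hcl⟩ (hb M hM) hΦ hc).2
    (((canon_modelDB hcanon.injConsts).trueIn_iff hW (hb _ hcanon) hΦ hc).1 (h J hJ hcanon))

theorem ev_classes_iff {b W : ℕ} (hW : D.Fits b W) (L : List DB) :
    Ev next (classesNode (ctxOf D I W) (Encodable.encode L)) true ↔
      (∀ J ∈ candidates σ.fluents W, J ∈ L ↔ D.Model (canon.{u} D J)) ∧
        ∀ J ∈ L, D.Model (canon.{u} D J) := by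
  have hnext : next (classesNode (ctxOf D I W) (Encodable.encode L)) = (true,
    ((candidates σ.fluents W).map fun J => (decide (J ∈ L), consistentNode (ctxOf D J W))) ++
      L.map fun J => (true, consistentNode (ctxOf D J W))) := by
    change classesStep (ctxOf D I W) (Encodable.encode L) = _
    simp only [classesStep, Encodable.encodek, Option.getD_some]
    rfl
  have hcons : ∀ J v, Ev next (consistentNode (ctxOf D J W)) v ↔
      (v = true ↔ D.Model (canon.{u} D J)) := by
    intro J v
    have h := decides_consistent.{u} (I := J) hW
    by_cases hJ : D.Model (canon.{u} D J)
    · rw [iff_true_right hJ]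
      exact ⟨fun hv => hv.unique (h.1 hJ), fun hv => hv ▸ h.1 hJ⟩
    · rw [iff_false_right hJ, Bool.not_eq_true]
      exact ⟨fun hv => hv.unique (h.2 hJ), fun hv => hv ▸ h.2 hJ⟩
  have hev : Ev next (classesNode (ctxOf D I W) (Encodable.encode L)) true ↔
      ∀ p ∈ (next (classesNode (ctxOf D I W) (Encodable.encode L))).2, Ev next p.2 p.1 := by
    refine ⟨?_, fun h => .all (by rw [hnext]) h⟩
    rintro (⟨-, h⟩ | ⟨h, -, -⟩)
    · exact h
    · rw [hnext] at h
      simp at h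
  rw [hev, hnext]
  simp only [List.forall_mem_append, List.forall_mem_map, hcons, decide_eq_true_iff, true_iff]

/-- Once the canonical model satisfies the initial axioms, every model of the database does, so the
database can replace these axioms within its class. -/
theorem BAT.modelDB_iff (h : D.Model (canon.{u} D I)) (M : Structure.{u} σ) :
    D.ModelDB I M ↔ D.Model M ∧ D.InClass I M :=
  ⟨fun hM => ⟨hM.model_iff.2 h, hM.2⟩, fun hM => ⟨hM.1.1, hM.2⟩⟩

theorem MuForm.trueIn_iff_of_activeIso {b : ℕ} (hb : BAT.BoundedBy.{u} D b) {M M' : Structure.{u} σ}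
    (hM : D.Model M) (hM' : D.Model M')
    (h : ActiveIso D.consts (M.interp M.S₀) (M'.interp M'.S₀)) {Φ : MuForm σ 0 0}
    (hΦ : Φ.Admissible D) : Φ.TrueIn D M ↔ Φ.TrueIn D M' := by
  have hW : D.Fits b (D.code + b + Φ.code) := BAT.fits_of_code_le (by omega) (by omega)
  obtain ⟨H, hC⟩ := exists_corr_of_activeIso (hM.1.finite_adom_init (hb M hM)) h
  exact (Φ.trueIn_iff_of_corr hW hM.1 hM'.1 (hb M hM) hC hΦ (by omega)).trans
    (Φ.trueIn_iff_aext hW hM'.1 (hb M' hM') hΦ (by omega)).symm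

/-! ### The algorithms -/

/-- Every family of questions with answers is decided by an algorithm. -/
theorem exists_partrec_answers {q : ℕ → Node} (hq : Primrec q) :
    ∃ f : ℕ →. ℕ, Nat.Partrec f ∧ ∀ x P, Decides (q x) P → Answers f x P := by
  obtain ⟨f, hf, h⟩ := exists_partrec_search primrec_next (β := Bool) (q := fun x y => (y, q x))
    (Primrec.pair Primrec.snd (hq.comp Primrec.fst))
  refine ⟨f, hf, fun x P hP => ⟨fun hp => ?_, fun hp => ?_⟩⟩
  · obtain ⟨y, hy, hfx⟩ := h x ⟨true, hP.1 hp⟩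
    obtain rfl := hy.unique (hP.1 hp)
    exact hfx
  · obtain ⟨y, hy, hfx⟩ := h x ⟨false, hP.2 hp⟩
    obtain rfl := hy.unique (hP.2 hp)
    exact hfx

theorem exists_partrec_entails : ∃ f : ℕ →. ℕ, Nat.Partrec f ∧
    ∀ (σ : Signature) (D : BAT σ) (b : ℕ) (Φ : MuForm σ 0 0),
      BAT.BoundedBy.{u} D b → Φ.Admissible D →
      Answers f (Encodable.encode [D.code, b, Φ.code]) (BAT.Entails.{u} D Φ) := by
  obtain ⟨f, hf, h⟩ := exists_partrec_answers
    (q := fun x => entailsNode (parse x ([], [])) ((toList x).getD 2 0)) (by fun_prop)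
  refine ⟨f, hf, fun σ D b Φ hb hΦ => h _ _ ?_⟩
  rw [parse_encode, toList_encode]
  exact decides_entails (BAT.fits_of_code_le (le_encode_of_mem (by simp))
    (le_encode_of_mem (by simp))) hb hΦ (le_encode_of_mem (by simp))

theorem exists_partrec_entailsDB : ∃ f : ℕ →. ℕ, Nat.Partrec f ∧
    ∀ (σ : Signature) (D : BAT σ) (b : ℕ) (I : DB) (Φ : MuForm σ 0 0),
      BAT.BoundedByDB.{u} D I b → Φ.Admissible D →
      Answers f (Encodable.encode [D.code, b, Encodable.encode I, Φ.code])
        (BAT.EntailsDB.{u} D I Φ) := by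
  obtain ⟨f, hf, h⟩ := exists_partrec_answers
    (q := fun x => entailsDBNode
      (parse x ((Encodable.decode (α := DB) ((toList x).getD 2 0)).getD ([], [])))
      ((toList x).getD 3 0)) (by fun_prop)
  refine ⟨f, hf, fun σ D b I Φ hb hΦ => h _ _ ?_⟩
  rw [parse_encode, toList_encode]
  simp only [List.getD_cons_succ, List.getD_cons_zero, Encodable.encodek, Option.getD_some]
  exact decides_entailsDB (BAT.fits_of_code_le (le_encode_of_mem (by simp))
    (le_encode_of_mem (by simp))) hb hΦ (le_encode_of_mem (by simp))

theorem exists_partrec_classes : ∃ f : ℕ →. ℕ, Nat.Partrec f ∧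
    ∀ (σ : Signature) (D : BAT σ) (b : ℕ), BAT.BoundedBy.{u} D b →
      ∃ L : List DB, f (Encodable.encode [D.code, b]) = Part.some (Encodable.encode L) ∧
        (∀ M : Structure.{u} σ, D.Model M → ∃ I ∈ L, D.InClass I M) ∧
        ∀ I ∈ L, D.Model (canon.{u} D I) := by
  classical
  obtain ⟨f, hf, h⟩ := exists_partrec_search primrec_next (β := List DB)
    (q := fun x L => (true, classesNode (parse x ([], [])) (Encodable.encode L)))
    (by unfold Primrec₂; fun_prop)
  refine ⟨f, hf, fun σ D b hb => ?_⟩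
  have hW : D.Fits b (Encodable.encode [D.code, b]) :=
    BAT.fits_of_code_le (le_encode_of_mem (by simp)) (le_encode_of_mem (by simp))
  have hx := h (Encodable.encode [D.code, b])
  simp only [parse_encode, ev_classes_iff.{u} hW] at hx
  -- The list of consistent candidates exists, so the search halts; it may return another list, but
  -- any list returned passes the same test.
  obtain ⟨L, ⟨h₁, h₂⟩, hL⟩ := hx ⟨(candidates σ.fluents (Encodable.encode [D.code, b])).filter
    fun J => D.Model (canon.{u} D J), by simp +contextual⟩
  refine ⟨L, hL, fun M hM => ?_, h₂⟩
  obtain ⟨J, hJ, hcl, hcanon⟩ := hW.exists_class hb hM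
  exact ⟨J, (h₁ J hJ).2 hcanon, hcl⟩

end SitCalc

/-! ### Assembly of the three algorithms and the invariance of truth -/

theorem mainTheorem2 :
    -- `dec` decides entailment, `cls` lists the classes of models,
    -- `cinfo` is the procedure for complete information
    ∃ dec cls cinfo : ℕ →. ℕ, Nat.Partrec dec ∧ Nat.Partrec cls ∧ Nat.Partrec cinfo ∧
      -- checking whether a bounded theory entails a closed formula is decidable
      (∀ (σ : Signature) (D : BAT σ) (b : ℕ) (Φ : MuForm σ 0 0),
        BAT.BoundedBy.{u} D b → Φ.Admissible D →
        Answers dec (Encodable.encode [D.code, b, Φ.code]) (BAT.Entails.{u} D Φ)) ∧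
      -- the procedure for complete information is correct
      (∀ (σ : Signature) (D : BAT σ) (b : ℕ) (I : DB) (Φ : MuForm σ 0 0),
        BAT.BoundedByDB.{u} D I b → Φ.Admissible D →
        Answers cinfo (Encodable.encode [D.code, b, Encodable.encode I, Φ.code])
          (BAT.EntailsDB.{u} D I Φ)) ∧
      (∀ (σ : Signature) (D : BAT σ) (b : ℕ), BAT.BoundedBy.{u} D b →
        -- the models split into finitely many classes by the initial active-domain interpretation
        (∃ L : List DB, cls (Encodable.encode [D.code, b]) = Part.some (Encodable.encode L) ∧
          (∀ M : Structure.{u} σ, D.Model M → ∃ I ∈ L, D.InClass I M) ∧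
          -- each class is the class of the models of a bounded theory with complete information
          ∀ I ∈ L, (∃ M : Structure.{u} σ, D.Model M ∧ D.InClass I M) ∧
            (∀ M : Structure.{u} σ, D.ModelDB I M ↔ D.Model M ∧ D.InClass I M) ∧
            BAT.BoundedByDB.{u} D I b) ∧
        -- models in the same class satisfy the same closed formulas
        ∀ M M' : Structure.{u} σ, D.Model M → D.Model M' →
          ActiveIso D.consts (M.interp M.S₀) (M'.interp M'.S₀) →
          ∀ Φ : MuForm σ 0 0, Φ.Admissible D → (Φ.TrueIn D M ↔ Φ.TrueIn D M')) := by
  obtain ⟨dec, hdec, h₁⟩ := exists_partrec_entails.{u}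
  obtain ⟨cls, hcls, h₂⟩ := exists_partrec_classes.{u}
  obtain ⟨cinfo, hcinfo, h₃⟩ := exists_partrec_entailsDB.{u}
  refine ⟨dec, cls, cinfo, hdec, hcls, hcinfo, h₁, h₃, fun σ D b hb => ⟨?_, ?_⟩⟩
  · obtain ⟨L, hL, hall, hcons⟩ := h₂ σ D b hb
    -- The canonical model of a listed database witnesses that its class is non-empty, and
    -- boundedness is inherited because models of the database are models of the theory.
    refine ⟨L, hL, hall, fun I hI => ⟨⟨_, hcons I hI, canon_inClass D I⟩,
      BAT.modelDB_iff (hcons I hI), fun M hM => ?_⟩⟩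
    exact hb M ((BAT.modelDB_iff (hcons I hI) M).1 hM).1
  · exact fun M M' hM hM' h Φ hΦ => Φ.trueIn_iff_of_activeIso hb hM hM' h hΦ
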